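/- Let $g\in C^2(\mathbb R)$ be bounded and strictly increasing, with $g(0)=0$, strictly concave on $(0,+\infty)$ and strictly convex on $(-\infty,0)$; put $g_\pm=\lim_{s\to\pm\infty}g(s)$ and $G(s)=\int_0^s g$. Let $p:\mathbb R\to\mathbb R$ be bounded and continuous, with an asymptotic average $A(p)$, that is, $\frac1T\int_t^{t+T}p(s)\,ds\to A(p)$ as $T\to+\infty$ uniformly in $t\in\mathbb R$, and suppose that $g_-<A(p)<g_+$. For $a<b$ let $H_0^1(a,b)^+=\{u\in H_0^1(a,b):u\ge 0\}$, $$J_{(a,b)}(u)=\int_a^b\Big[\tfrac12\dot u^2(t)-G(u(t))+p(t)u(t)\Big]dt,\qquad \varphi^+(a,b)=\inf_{u\in H_0^1(a,b)^+}J_{(a,b)}(u).$$ Call $\tilde L>0$ a positivity threshold if, whenever $b-a\ge\tilde L$, every minimizer of $J_{(a,b)}$ in $H_0^1(a,b)^+$ is strictly positive in $(a,b)$. Then positivity thresholds exist. Moreover, for every positivity threshold $\tilde L$, the function $\varphi^+$ is of class $C^1$ on $\{(a,b)\in\mathbb R^2: b-a>\tilde L\}$, and for every $(a,b)$ in this set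 $J_{(a,b)}$ has a unique minimizer $u=u(\cdot\,;a,b)$ in $H_0^1(a,b)^+$; it solves $\ddot u+g(u)=p$ in $(a,b)$, $u(a)=0=u(b)$, $u>0$ in $(a,b)$, its derivative has finite limits $\dot u(a^+)$ and $\dot u(b^-)$, and $$\frac{\partial\varphi^+}{\partial a}(a,b)=\tfrac12\,\dot u^2(a^+),\qquad \frac{\partial\varphi^+}{\partial b}(a,b)=-\tfrac12\,\dot u^2(b^-).$$ -/

import Mathlib

open Set Filter Topology MeasureTheory

noncomputable section

namespace BoundedReaction

/-- Standing assumption on the reaction term `g`. -/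
structure Reaction (g : ℝ → ℝ) : Prop where
  zero : g 0 = 0
  contDiff : ContDiff ℝ 2 g
  bounded : ∃ C : ℝ, ∀ s, |g s| ≤ C
  strictMono : StrictMono g
  strictConcave : StrictConcaveOn ℝ (Ioi 0) g
  strictConvex : StrictConvexOn ℝ (Iio 0) g

/-- `p` has asymptotic average `A`: the means of `p` over `[t, t + T]` tend to `A` as
`T → +∞`, uniformly in `t`. -/
def HasAsymptoticAverage (p : ℝ → ℝ) (A : ℝ) : Prop :=
  TendstoUniformly (fun (T : ℝ) (t : ℝ) => (1 / T) * ∫ s in t..(t + T), p s) (fun _ => A) atTop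

/-- Assumption on the forcing term `p`: bounded and continuous on the line, with an asymptotic
average lying strictly between the limits `gm` and `gp` of the reaction term. -/
structure Forcing (gm gp : ℝ) (p : ℝ → ℝ) : Prop where
  continuous : Continuous p
  bounded : ∃ C : ℝ, ∀ t, |p t| ≤ C
  average : ∃ A : ℝ, HasAsymptoticAverage p A ∧ gm < A ∧ A < gp

/-- The primitive of `g` vanishing at `0`. -/
def primitive (g : ℝ → ℝ) (s : ℝ) : ℝ := ∫ x in (0 : ℝ)..s, g x

/-- The cone `H_0^1(a,b)^+` for `a < b`, through the continuous representatives: absolutely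
continuous functions on `[a,b]` with square integrable derivative, vanishing at both endpoints,
nonnegative. Values outside `[a,b]` are irrelevant. -/
def H01Plus (a b : ℝ) : Set (ℝ → ℝ) :=
  {u | AbsolutelyContinuousOnInterval u a b ∧
    MemLp (deriv u) 2 (volume.restrict (Ioo a b)) ∧
    u a = 0 ∧ u b = 0 ∧ ∀ t ∈ Icc a b, 0 ≤ u t}

/-- The action functional `J_{(a,b)}`. -/
def action (g p : ℝ → ℝ) (a b : ℝ) (u : ℝ → ℝ) : ℝ :=
  ∫ t in a..b, ((1 / 2) * (deriv u t) ^ 2 - primitive g (u t) + p t * u t)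

/-- The minimal energy `φ⁺(a,b)`. -/
def phiPlus (g p : ℝ → ℝ) (a b : ℝ) : ℝ :=
  sInf (action g p a b '' H01Plus a b)

/-- `u` minimizes the action over `H_0^1(a,b)^+`. -/
def IsMinimizer (g p : ℝ → ℝ) (a b : ℝ) (u : ℝ → ℝ) : Prop :=
  u ∈ H01Plus a b ∧ ∀ v ∈ H01Plus a b, action g p a b u ≤ action g p a b v

/-- `L` is a length from which on every nonnegative minimizer is strictly positive in the
interior of its interval. -/
def IsPositivityThreshold (g p : ℝ → ℝ) (L : ℝ) : Prop :=
  0 < L ∧ ∀ a b : ℝ, L ≤ b - a → ∀ u : ℝ → ℝ, IsMinimizer g p a b u → ∀ t ∈ Ioo a b, 0 < u t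

/-- `u` solves `u'' + g(u) = p` in `(a,b)`, `u(a) = 0 = u(b)`, `u > 0` in `(a,b)`. -/
def SolvesPositiveBVP (g p : ℝ → ℝ) (a b : ℝ) (u : ℝ → ℝ) : Prop :=
  (∀ t ∈ Ioo a b, DifferentiableAt ℝ u t ∧ HasDerivAt (deriv u) (p t - g (u t)) t) ∧
    ContinuousOn u (Icc a b) ∧ u a = 0 ∧ u b = 0 ∧ ∀ t ∈ Ioo a b, 0 < u t

end BoundedReaction

end

/-! Write G for the primitive of g. Since g is increasing, G is convex, so G(u + εφ) ≥ G(u) + ε g(u)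
φ, and comparing a minimizer over the cone with u + εφ gives a one-sided first variation
(`first_variation_nonneg`). Tested with tent functions it bounds second divided differences of u:
weakly u'' ≤ p - g(u) (`slope_le`), with equality when u is positive in the interior
(`slope_eq_of_pos`), whence C² regularity. Minimizers exist by the direct method: bounded actions
give uniform convergence of a subsequence, and the parallelogram identity makes the derivatives
Cauchy in L² (`exists_subseq_limit`).

Positivity. Choose K > 0 with g(K) > A. A parabola shows that the minimal energy is at most -c
(b-a)³ up to lower powers of b-a, while a function bounded by S (b-a) has action at least -2CS
(b-a)². So on long intervals a minimizer exceeds S (b-a) somewhere (`exists_large`). It then has to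
descend steeply through the level K, and semiconcavity keeps the slope negative up to and beyond any
later interior zero, contradicting u ≥ 0 (`pos_right_of_large`). Reflecting time treats the other
side.

Uniqueness. Suppose two positive minimizers satisfy u < v on an interval, with equality at its ends.
Integrating the derivative of (u' + v')(v - u)/2 turns J(u) - J(v) there into the error of the
trapezoidal rule for g, which is positive by strict concavity on (0,∞) (`action_lt_of_lt`). Pasting
v into u then lowers the action.

Differentiability. Replacing the minimizer near b by an affine piece ending at b + e gives φ⁺(a,b+e)
≤ φ⁺(a,b) - u'(b)² e/2 + o(|e|) with a uniform remainder (`phiPlus_right_le`). Exchanging the two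
intervals yields the opposite inequality with the slope taken at b + e, so the derivative exists as
soon as u'(b) depends continuously on the interval. That continuity follows from compactness and
uniqueness (`tendsto_minimizer`, `tendsto_deriv_endpoint`), and continuous partial derivatives make
φ⁺ of class C¹. -/

noncomputable section

namespace BoundedReaction

/-! ### Absolutely continuous functions with square integrable derivative -/

/-- `u` is absolutely continuous on the interval with square integrable derivative. -/
structure IsH1 (a b : ℝ) (u : ℝ → ℝ) : Prop where
  ac : AbsolutelyContinuousOnInterval u a b
  sq : IntervalIntegrable (fun t => deriv u t ^ 2) volume a b

theorem _root_.AbsolutelyContinuousOnInterval.congr {u v : ℝ → ℝ} {a b : ℝ}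
    (hu : AbsolutelyContinuousOnInterval u a b) (h : EqOn u v (uIcc a b)) :
    AbsolutelyContinuousOnInterval v a b := by
  rw [absolutelyContinuousOnInterval_iff] at hu ⊢
  intro ε hε
  obtain ⟨δ, hδ, H⟩ := hu ε hε
  refine ⟨δ, hδ, fun E hE hlt => ?_⟩
  convert H E hE hlt using 1
  refine Finset.sum_congr rfl fun i hi => ?_
  rw [h (hE.1 i hi).1, h (hE.1 i hi).2]

theorem deriv_eq_of_eqOn_Icc {u v : ℝ → ℝ} {a b t : ℝ} (h : EqOn u v (Icc a b))
    (ht : t ∈ Ioo a b) : deriv u t = deriv v t :=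
  Filter.EventuallyEq.deriv_eq (Filter.eventuallyEq_of_mem (Icc_mem_nhds ht.1 ht.2) h)

theorem ae_ne_point (c : ℝ) : ∀ᵐ t : ℝ, t ≠ c := by
  simp [ae_iff]

/-- Almost every point of the half-open interval lies in the open one. -/
theorem ae_mem_Ioo_of_mem_uIoc {a b : ℝ} (hab : a ≤ b) :
    ∀ᵐ t : ℝ, t ∈ uIoc a b → t ∈ Ioo a b := by
  filter_upwards [ae_ne_point b] with t ht h
  rw [uIoc_of_le hab] at h
  exact ⟨h.1, lt_of_le_of_ne h.2 ht⟩

theorem intervalIntegrable_congr_Ioo {f h : ℝ → ℝ} {a b : ℝ} (hab : a ≤ b)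
    (e : ∀ t ∈ Ioo a b, f t = h t) (hf : IntervalIntegrable f volume a b) :
    IntervalIntegrable h volume a b := by
  refine hf.congr_ae ?_
  rw [Filter.EventuallyEq, ae_restrict_iff' measurableSet_uIoc]
  filter_upwards [ae_mem_Ioo_of_mem_uIoc hab] with t ht h
  exact e t (ht h)

theorem integral_congr_Ioo {f h : ℝ → ℝ} {a b : ℝ} (hab : a ≤ b)
    (e : ∀ t ∈ Ioo a b, f t = h t) : ∫ t in a..b, f t = ∫ t in a..b, h t := by
  refine intervalIntegral.integral_congr_ae ?_
  filter_upwards [ae_mem_Ioo_of_mem_uIoc hab] with t ht h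
  exact e t (ht h)

namespace IsH1

variable {a b c d : ℝ} {u v : ℝ → ℝ}

theorem congr (hab : a ≤ b) (hu : IsH1 a b u) (h : EqOn u v (Icc a b)) : IsH1 a b v := by
  refine ⟨hu.ac.congr (by rwa [uIcc_of_le hab]), ?_⟩
  exact intervalIntegrable_congr_Ioo hab
    (fun t ht => by rw [deriv_eq_of_eqOn_Icc h ht]) hu.sq

theorem continuousOn (hab : a ≤ b) (hu : IsH1 a b u) : ContinuousOn u (Icc a b) := by
  simpa [uIcc_of_le hab] using hu.ac.continuousOn

theorem mono (hu : IsH1 a b u) (hac : a ≤ c) (hcd : c ≤ d) (hdb : d ≤ b) : IsH1 c d u := by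
  have h : uIcc c d ⊆ uIcc a b := by
    rw [uIcc_of_le hcd, uIcc_of_le (hac.trans (hcd.trans hdb))]
    exact Icc_subset_Icc hac hdb
  exact ⟨hu.ac.mono h, hu.sq.mono_set h⟩

theorem intervalIntegrable_deriv (hu : IsH1 a b u) : IntervalIntegrable (deriv u) volume a b :=
  hu.ac.intervalIntegrable_deriv

theorem integral_deriv (hu : IsH1 a b u) : ∫ t in a..b, deriv u t = u b - u a :=
  hu.ac.integral_deriv_eq_sub

theorem memLp (hab : a ≤ b) (hu : IsH1 a b u) :
    MemLp (deriv u) 2 (volume.restrict (Ioc a b)) := by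
  rw [memLp_two_iff_integrable_sq (measurable_deriv u).aestronglyMeasurable]
  exact (intervalIntegrable_iff_integrableOn_Ioc_of_le hab).1 hu.sq

theorem ae_differentiableAt (hu : IsH1 a b u) :
    ∀ᵐ t : ℝ, t ∈ uIoc a b → DifferentiableAt ℝ u t := by
  filter_upwards [hu.ac.ae_differentiableAt] with t ht h
  exact ht (uIoc_subset_uIcc h)

/-- The product of the derivatives of two such functions is integrable. -/
theorem intervalIntegrable_mul (hab : a ≤ b) (hu : IsH1 a b u) (hv : IsH1 a b v) :
    IntervalIntegrable (fun t => deriv u t * deriv v t) volume a b := by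
  rw [intervalIntegrable_iff_integrableOn_Ioc_of_le hab]
  exact (hu.memLp hab).integrable_mul (hv.memLp hab)

/-- Linear combinations: derivative almost everywhere. -/
theorem ae_deriv_lin (hu : IsH1 a b u) (hv : IsH1 a b v) (r s : ℝ) :
    ∀ᵐ t : ℝ, t ∈ uIoc a b →
      deriv (fun t => r * u t + s * v t) t = r * deriv u t + s * deriv v t := by
  filter_upwards [hu.ae_differentiableAt, hv.ae_differentiableAt] with t h1 h2 ht
  exact (((h1 ht).hasDerivAt.const_mul r).add ((h2 ht).hasDerivAt.const_mul s)).deriv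

theorem lin (hab : a ≤ b) (hu : IsH1 a b u) (hv : IsH1 a b v) (r s : ℝ) :
    IsH1 a b (fun t => r * u t + s * v t) := by
  refine ⟨(hu.ac.const_mul r).add (hv.ac.const_mul s), ?_⟩
  have h : IntervalIntegrable (fun t => r ^ 2 * deriv u t ^ 2 +
      2 * r * s * (deriv u t * deriv v t) + s ^ 2 * deriv v t ^ 2) volume a b :=
    ((hu.sq.const_mul _).add ((hu.intervalIntegrable_mul hab hv).const_mul _)).add
      (hv.sq.const_mul _)
  refine h.congr_ae ?_
  rw [Filter.EventuallyEq, ae_restrict_iff' measurableSet_uIoc]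
  filter_upwards [hu.ae_deriv_lin hv r s] with t h1 ht
  rw [h1 ht]
  ring

theorem sub (hab : a ≤ b) (hu : IsH1 a b u) (hv : IsH1 a b v) :
    IsH1 a b (fun t => u t - v t) :=
  (hu.lin hab hv 1 (-1)).congr hab fun t _ => by ring

theorem ae_deriv_sub (hu : IsH1 a b u) (hv : IsH1 a b v) :
    ∀ᵐ t : ℝ, t ∈ uIoc a b → deriv (fun t => u t - v t) t = deriv u t - deriv v t := by
  filter_upwards [hu.ae_differentiableAt, hv.ae_differentiableAt] with t h1 h2 ht
  exact ((h1 ht).hasDerivAt.sub (h2 ht).hasDerivAt).deriv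

theorem of_lipschitzOnWith {K : NNReal} (hab : a ≤ b) (h : LipschitzOnWith K u (Icc a b)) :
    IsH1 a b u := by
  refine ⟨LipschitzOnWith.absolutelyContinuousOnInterval (K := K) (by rwa [uIcc_of_le hab]), ?_⟩
  rw [intervalIntegrable_iff_integrableOn_Ioo_of_le hab]
  refine Measure.integrableOn_of_bounded (M := (K : ℝ) ^ 2) (by simp)
    ((measurable_deriv u).pow_const 2).aestronglyMeasurable ?_
  rw [ae_restrict_iff' measurableSet_Ioo]
  refine ae_of_all _ fun t ht => ?_
  have := norm_deriv_le_of_lipschitzOn (Icc_mem_nhds ht.1 ht.2) h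
  rw [norm_pow]
  exact pow_le_pow_left₀ (norm_nonneg _) this 2

theorem of_hasDerivAt {u' : ℝ → ℝ} (hab : a ≤ b) (h : ∀ t, HasDerivAt u (u' t) t)
    (hc : Continuous u') : IsH1 a b u := by
  obtain ⟨M, hM⟩ := (isCompact_Icc (a := a) (b := b)).exists_bound_of_continuousOn hc.continuousOn
  refine of_lipschitzOnWith (K := M.toNNReal) hab ?_
  refine (convex_Icc a b).lipschitzOnWith_of_nnnorm_hasDerivWithin_le
    (fun t _ => (h t).hasDerivWithinAt) fun t ht => ?_
  rw [← NNReal.coe_le_coe, coe_nnnorm]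
  exact (hM t ht).trans (Real.le_coe_toNNReal M)

/-- Functions given as a primitive of a square integrable function. -/
theorem of_integral {f : ℝ → ℝ} (hab : a ≤ b) (hf : MemLp f 2 (volume.restrict (Ioc a b)))
    (h : ∀ t ∈ Icc a b, u t = u a + ∫ s in a..t, f s) :
    IsH1 a b u ∧ ∀ᵐ t : ℝ, t ∈ uIoc a b → deriv u t = f t := by
  have hfi : IntegrableOn f (Ioc a b) :=
    hf.integrable (by norm_num)
  have hfi' : IntervalIntegrable f volume a b :=
    (intervalIntegrable_iff_integrableOn_Ioc_of_le hab).2 hfi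
  have hac : AbsolutelyContinuousOnInterval (fun t => u a + ∫ s in a..t, f s) a b := by
    have h1 := hfi'.absolutelyContinuousOnInterval_intervalIntegral (c := a) left_mem_uIcc
    have h2 : AbsolutelyContinuousOnInterval (fun _ : ℝ => u a) a b :=
      LipschitzOnWith.absolutelyContinuousOnInterval (K := 0) (LipschitzWith.const _).lipschitzOnWith
    exact h2.add h1
  have hd : ∀ᵐ t : ℝ, t ∈ uIoc a b → deriv u t = f t := by
    filter_upwards [hfi'.ae_hasDerivAt_integral, ae_mem_Ioo_of_mem_uIoc hab] with t ht h1 h2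
    have h4 := (ht (uIoc_subset_uIcc h2) a left_mem_uIcc).const_add (u a)
    rw [← h4.deriv]
    exact deriv_eq_of_eqOn_Icc (a := a) (b := b) h (h1 h2)
  refine ⟨⟨hac.congr (by rw [uIcc_of_le hab]; exact fun t ht => (h t ht).symm), ?_⟩, hd⟩
  have h5 : IntervalIntegrable (fun t => f t ^ 2) volume a b :=
    (intervalIntegrable_iff_integrableOn_Ioc_of_le hab).2 hf.integrable_sq
  refine h5.congr_ae ?_
  rw [Filter.EventuallyEq, ae_restrict_iff' measurableSet_uIoc]
  filter_upwards [hd] with t h1 ht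
  rw [h1 ht]

theorem integral_deriv_left (hu : IsH1 a b u) {t : ℝ} (ht : t ∈ Icc a b) :
    u t = u a + ∫ s in a..t, deriv u s := by
  rw [(hu.mono le_rfl ht.1 ht.2).integral_deriv]
  ring

/-- Gluing at an interior point. -/
theorem glue (hac : a ≤ c) (hcb : c ≤ b) (hu : IsH1 a c u) (hv : IsH1 c b v) (h : u c = v c) :
    IsH1 a b (fun t => if t ≤ c then u t else v t) := by
  set w : ℝ → ℝ := fun t => if t ≤ c then u t else v t with hw
  have hwu : EqOn u w (Icc a c) := fun t ht => by simp [hw, ht.2]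
  have hwv : EqOn v w (Icc c b) := fun t ht => by
    rcases eq_or_lt_of_le ht.1 with h1 | h1
    · simp [hw, ← h1, h]
    · simp [hw, h1]
  have h1 := hu.congr hac hwu
  have h2 := hv.congr hcb hwv
  have hsq := h1.sq.trans h2.sq
  have hd := h1.intervalIntegrable_deriv.trans h2.intervalIntegrable_deriv
  -- On each half the glued function is the primitive of its own derivative, hence on the whole
  -- interval; the kink at `c` needs no separate treatment.
  refine (of_integral (f := deriv w) (hac.trans hcb) ?_ fun t ht => ?_).1
  · rw [memLp_two_iff_integrable_sq (measurable_deriv w).aestronglyMeasurable]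
    exact (intervalIntegrable_iff_integrableOn_Ioc_of_le (hac.trans hcb)).1 hsq
  · rcases le_total t c with htc | htc
    · exact h1.integral_deriv_left ⟨ht.1, htc⟩
    · rw [h2.integral_deriv_left ⟨htc, ht.2⟩,
        ← intervalIntegral.integral_add_adjacent_intervals h1.intervalIntegrable_deriv
        ((h2.mono le_rfl htc ht.2).intervalIntegrable_deriv), h1.integral_deriv]
      ring

/-- Cauchy-Schwarz for the increment. -/
theorem sq_sub_le (hab : a ≤ b) (hu : IsH1 a b u) :
    (u b - u a) ^ 2 ≤ (b - a) * ∫ t in a..b, deriv u t ^ 2 := by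
  rcases eq_or_lt_of_le hab with rfl | hlt
  · simp
  -- `s` is the mean of the derivative; the inequality says that the variance of the derivative is
  -- nonnegative.
  set s := (u b - u a) / (b - a) with hs
  have hpos : 0 < b - a := sub_pos.2 hlt
  have h : 0 ≤ ∫ t in a..b, (deriv u t - s) ^ 2 :=
    intervalIntegral.integral_nonneg hab fun t _ => sq_nonneg _
  have e : ∫ t in a..b, (deriv u t - s) ^ 2
      = (∫ t in a..b, deriv u t ^ 2) - 2 * s * (u b - u a) + (b - a) * s ^ 2 := by
    rw [← hu.integral_deriv, ← intervalIntegral.integral_const_mul,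
      ← intervalIntegral.integral_sub hu.sq (hu.intervalIntegrable_deriv.const_mul _),
      ← smul_eq_mul (b - a), ← intervalIntegral.integral_const,
      ← intervalIntegral.integral_add (hu.sq.sub (hu.intervalIntegrable_deriv.const_mul _))
        intervalIntegrable_const]
    exact intervalIntegral.integral_congr fun t _ => by ring
  rw [e] at h
  have hsb : u b - u a = s * (b - a) := by rw [hs]; field_simp
  rw [hsb] at h ⊢
  nlinarith

end IsH1

/-! ### The cone, the action and its first variation -/

theorem mem_H01Plus_iff {a b : ℝ} (hab : a ≤ b) {u : ℝ → ℝ} :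
    u ∈ H01Plus a b ↔ IsH1 a b u ∧ u a = 0 ∧ u b = 0 ∧ ∀ t ∈ Icc a b, 0 ≤ u t := by
  have : MemLp (deriv u) 2 (volume.restrict (Ioo a b)) ↔
      IntervalIntegrable (fun t => deriv u t ^ 2) volume a b := by
    rw [memLp_two_iff_integrable_sq (measurable_deriv u).aestronglyMeasurable,
      intervalIntegrable_iff_integrableOn_Ioo_of_le hab]
    rfl
  constructor
  · rintro ⟨h1, h2, h3⟩
    exact ⟨⟨h1, this.1 h2⟩, h3⟩
  · rintro ⟨h1, h3⟩
    exact ⟨h1.ac, this.2 h1.sq, h3⟩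

/-- The part of the hypotheses on `g` and `p` which is local in time. -/
structure Admissible (g p : ℝ → ℝ) (C : ℝ) : Prop where
  g_cont : Continuous g
  g_mono : Monotone g
  concave : StrictConcaveOn ℝ (Ioi 0) g
  g_bdd : ∀ s, |g s| ≤ C
  p_cont : Continuous p
  p_bdd : ∀ t, |p t| ≤ C

theorem primitive_sub {g : ℝ → ℝ} (hg : Continuous g) (x y : ℝ) :
    primitive g y - primitive g x = ∫ s in x..y, g s :=
  intervalIntegral.integral_interval_sub_left (hg.intervalIntegrable _ _)
    (hg.intervalIntegrable _ _)

theorem continuous_primitive {g : ℝ → ℝ} (hg : Continuous g) : Continuous (primitive g) :=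
  continuous_iff_continuousAt.2 fun _ =>
    (intervalIntegral.integral_hasDerivAt_right (hg.intervalIntegrable _ _)
      (hg.stronglyMeasurableAtFilter _ _) hg.continuousAt).continuousAt

theorem primitive_zero (g : ℝ → ℝ) : primitive g 0 = 0 := by simp [primitive]

/-- The integral `∫ u'²`. -/
def kinetic (a b : ℝ) (u : ℝ → ℝ) : ℝ := ∫ t in a..b, deriv u t ^ 2

/-- The zeroth order part of the action. -/
def potential (g p : ℝ → ℝ) (a b : ℝ) (u : ℝ → ℝ) : ℝ :=
  ∫ t in a..b, (p t * u t - primitive g (u t))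

theorem kinetic_nonneg {a b : ℝ} (hab : a ≤ b) (u : ℝ → ℝ) : 0 ≤ kinetic a b u :=
  intervalIntegral.integral_nonneg hab fun _ _ => sq_nonneg _

theorem IsH1.kinetic_lin {a b : ℝ} {u v : ℝ → ℝ} (hab : a ≤ b) (hu : IsH1 a b u)
    (hv : IsH1 a b v) (r s : ℝ) : kinetic a b (fun t => r * u t + s * v t) =
      r ^ 2 * kinetic a b u + 2 * r * s * (∫ t in a..b, deriv u t * deriv v t)
        + s ^ 2 * kinetic a b v := by
  unfold kinetic
  rw [← intervalIntegral.integral_const_mul, ← intervalIntegral.integral_const_mul,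
    ← intervalIntegral.integral_const_mul,
    ← intervalIntegral.integral_add (hu.sq.const_mul _)
      ((hu.intervalIntegrable_mul hab hv).const_mul _),
    ← intervalIntegral.integral_add ((hu.sq.const_mul _).add
      ((hu.intervalIntegrable_mul hab hv).const_mul _)) (hv.sq.const_mul _)]
  refine intervalIntegral.integral_congr_ae ?_
  filter_upwards [hu.ae_deriv_lin hv r s] with t h1 ht
  rw [h1 ht]
  ring

theorem action_congr (g p : ℝ → ℝ) {a b : ℝ} {u v : ℝ → ℝ} (hab : a ≤ b)
    (h : EqOn u v (Icc a b)) : action g p a b u = action g p a b v :=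
  integral_congr_Ioo hab fun t ht => by
    rw [deriv_eq_of_eqOn_Icc h ht, h (Ioo_subset_Icc_self ht)]

theorem action_zero (g p : ℝ → ℝ) (a b : ℝ) : action g p a b (fun _ => 0) = 0 := by
  simp [action, primitive_zero]

theorem zero_mem_H01Plus {a b : ℝ} (hab : a ≤ b) : (fun _ => 0) ∈ H01Plus a b := by
  rw [mem_H01Plus_iff hab]
  exact ⟨IsH1.of_lipschitzOnWith (K := 0) hab (LipschitzWith.const _).lipschitzOnWith,
    rfl, rfl, fun _ _ => le_rfl⟩

namespace Admissible

variable {g p : ℝ → ℝ} {C : ℝ}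

theorem C_nonneg (h : Admissible g p C) : 0 ≤ C := (abs_nonneg _).trans (h.g_bdd 0)

/-- Monotonicity of `g` makes its primitive convex, and this is the tangent line inequality. It
gives upper bounds for the potential part of the action that are linear in the perturbation. -/
theorem primitive_ge (h : Admissible g p C) (x y : ℝ) :
    primitive g x + g x * (y - x) ≤ primitive g y := by
  have e := primitive_sub h.g_cont x y
  rcases le_total x y with hxy | hxy
  · have : ∫ _ in x..y, g x ≤ ∫ s in x..y, g s :=
      intervalIntegral.integral_mono_on hxy intervalIntegrable_const
        (h.g_cont.intervalIntegrable _ _) fun s hs => h.g_mono hs.1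
    rw [intervalIntegral.integral_const, smul_eq_mul] at this
    linarith
  · have : ∫ s in y..x, g s ≤ ∫ _ in y..x, g x :=
      intervalIntegral.integral_mono_on hxy (h.g_cont.intervalIntegrable _ _)
        intervalIntegrable_const fun s hs => h.g_mono hs.2
    rw [intervalIntegral.integral_const, smul_eq_mul] at this
    rw [intervalIntegral.integral_symm] at e
    linarith

theorem abs_primitive_sub_le (h : Admissible g p C) (x y : ℝ) :
    |primitive g y - primitive g x| ≤ C * |y - x| := by
  rw [primitive_sub h.g_cont, ← Real.norm_eq_abs]
  exact intervalIntegral.norm_integral_le_of_norm_le_const fun s _ => h.g_bdd s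

/-- The trapezoidal rule underestimates the integral of `g` on the positive half-line. -/
theorem trapezoid_lt (h : Admissible g p C) {x y : ℝ} (hx : 0 < x) (hxy : x < y) :
    (g x + g y) / 2 * (y - x) < primitive g y - primitive g x := by
  rw [primitive_sub h.g_cont]
  set m := (g y - g x) / (y - x) with hm
  have hpos : 0 < y - x := sub_pos.2 hxy
  have hmy : m * (y - x) = g y - g x := by rw [hm]; field_simp
  have e : ∫ s in x..y, (g x + m * (s - x)) = (g x + g y) / 2 * (y - x) := by
    rw [intervalIntegral.integral_add intervalIntegrable_const
      (Continuous.intervalIntegrable (by fun_prop) _ _), intervalIntegral.integral_const,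
      intervalIntegral.integral_const_mul,
      intervalIntegral.integral_comp_sub_right (fun s => s), integral_id]
    simp only [smul_eq_mul]
    have : g y = g x + m * (y - x) := by linarith
    rw [this]
    ring
  rw [← e]
  -- The chord lies strictly below the graph, by strict concavity; its integral is the trapezoidal
  -- value.
  have key : ∀ s ∈ Ioo x y, g x + m * (s - x) < g s := by
    intro s hs
    have h1 := h.concave.2 (mem_Ioi.2 hx) (mem_Ioi.2 (hx.trans hxy)) hxy.ne
      (div_pos (sub_pos.2 hs.2) hpos) (div_pos (sub_pos.2 hs.1) hpos)
      (by field_simp; ring)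
    simp only [smul_eq_mul] at h1
    have h2 : (y - s) / (y - x) * x + (s - x) / (y - x) * y = s := by field_simp; ring
    rw [h2] at h1
    refine lt_of_eq_of_lt ?_ h1
    rw [hm]
    field_simp
    ring
  refine intervalIntegral.integral_lt_integral_of_continuousOn_of_le_of_exists_lt hxy
    (by fun_prop) h.g_cont.continuousOn (fun s hs => ?_) ⟨(x + y) / 2, ⟨by linarith, by linarith⟩,
    key _ ⟨by linarith, by linarith⟩⟩
  rcases eq_or_lt_of_le hs.2 with h1 | h1
  · rw [h1]; linarith
  · exact (key s ⟨hs.1, h1⟩).le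

theorem continuousOn_potential (h : Admissible g p C) {u : ℝ → ℝ} {s : Set ℝ}
    (hu : ContinuousOn u s) : ContinuousOn (fun t => p t * u t - primitive g (u t)) s :=
  (h.p_cont.continuousOn.mul hu).sub ((continuous_primitive h.g_cont).comp_continuousOn hu)

theorem intervalIntegrable_potential (h : Admissible g p C) {u : ℝ → ℝ} {a b : ℝ} (hab : a ≤ b)
    (hu : ContinuousOn u (Icc a b)) :
    IntervalIntegrable (fun t => p t * u t - primitive g (u t)) volume a b :=
  (h.continuousOn_potential (by rwa [uIcc_of_le hab])).intervalIntegrable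

theorem action_eq (h : Admissible g p C) {u : ℝ → ℝ} {a b : ℝ} (hab : a ≤ b)
    (hu : IsH1 a b u) : action g p a b u = 1 / 2 * kinetic a b u + potential g p a b u := by
  unfold action kinetic potential
  rw [← intervalIntegral.integral_const_mul, ← intervalIntegral.integral_add
    (hu.sq.const_mul _) (h.intervalIntegrable_potential hab (hu.continuousOn hab))]
  exact intervalIntegral.integral_congr fun t _ => by ring

theorem intervalIntegrable_action (h : Admissible g p C) {u : ℝ → ℝ} {a b : ℝ} (hab : a ≤ b)
    (hu : IsH1 a b u) : IntervalIntegrable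
      (fun t => (1 / 2) * (deriv u t) ^ 2 - primitive g (u t) + p t * u t) volume a b := by
  have := (hu.sq.const_mul (1 / 2)).add
    (h.intervalIntegrable_potential hab (hu.continuousOn hab))
  exact this.congr fun t _ => by ring

theorem action_add (h : Admissible g p C) {u : ℝ → ℝ} {a b c : ℝ} (hac : a ≤ c) (hcb : c ≤ b)
    (hu : IsH1 a b u) : action g p a b u = action g p a c u + action g p c b u :=
  (intervalIntegral.integral_add_adjacent_intervals
    (h.intervalIntegrable_action hac (hu.mono le_rfl hac hcb))
    (h.intervalIntegrable_action hcb (hu.mono hac hcb le_rfl))).symm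

/-- Nonnegativity of the first variation along admissible directions. -/
theorem first_variation_nonneg (h : Admissible g p C) {a b : ℝ} (hab : a ≤ b) {u φ : ℝ → ℝ}
    (hu : IsMinimizer g p a b u) (hφ : IsH1 a b φ) {ε₀ : ℝ} (hε₀ : 0 < ε₀)
    (hm : (fun t => u t + ε₀ * φ t) ∈ H01Plus a b) :
    0 ≤ (∫ t in a..b, deriv u t * deriv φ t) + ∫ t in a..b, (p t - g (u t)) * φ t := by
  have hu1 := (mem_H01Plus_iff hab).1 hu.1
  have hm1 := (mem_H01Plus_iff hab).1 hm
  have hcu := hu1.1.continuousOn hab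
  have hcφ := hφ.continuousOn hab
  have hφa : φ a = 0 := by
    have := hm1.2.1
    rw [hu1.2.1, zero_add] at this
    exact (mul_eq_zero.1 this).resolve_left hε₀.ne'
  have hφb : φ b = 0 := by
    have := hm1.2.2.1
    rw [hu1.2.2.1, zero_add] at this
    exact (mul_eq_zero.1 this).resolve_left hε₀.ne'
  set I := (∫ t in a..b, deriv u t * deriv φ t) + ∫ t in a..b, (p t - g (u t)) * φ t with hI
  have hint : IntervalIntegrable (fun t => (p t - g (u t)) * φ t) volume a b := by
    refine ContinuousOn.intervalIntegrable ?_
    rw [uIcc_of_le hab]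
    exact (h.p_cont.continuousOn.sub (h.g_cont.comp_continuousOn hcu)).mul hcφ
  have key : ∀ ε ∈ Ioc 0 ε₀, 0 ≤ ε * I + ε ^ 2 / 2 * kinetic a b φ := by
    intro ε hε
    have hw : IsH1 a b (fun t => u t + ε * φ t) :=
      (hu1.1.lin hab hφ 1 ε).congr hab fun t _ => by simp
    have hmem : (fun t => u t + ε * φ t) ∈ H01Plus a b := by
      rw [mem_H01Plus_iff hab]
      refine ⟨hw, by simp [hu1.2.1, hφa], by simp [hu1.2.2.1, hφb], fun t ht => ?_⟩
      have h1 := hu1.2.2.2 t ht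
      have h2 := hm1.2.2.2 t ht
      -- Convexity of the cone: u + εφ lies on the segment from u to u + ε₀φ.
      have h3 : ε₀ * (u t + ε * φ t) = (ε₀ - ε) * u t + ε * (u t + ε₀ * φ t) := by ring
      have h4 : 0 ≤ ε₀ * (u t + ε * φ t) := by
        rw [h3]
        exact add_nonneg (mul_nonneg (by linarith [hε.2]) h1) (mul_nonneg hε.1.le h2)
      exact nonneg_of_mul_nonneg_right h4 hε₀
    have h1 := hu.2 _ hmem
    rw [h.action_eq hab hw, h.action_eq hab hu1.1] at h1
    have h2 : kinetic a b (fun t => u t + ε * φ t) =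
        kinetic a b u + 2 * ε * (∫ t in a..b, deriv u t * deriv φ t) + ε ^ 2 * kinetic a b φ := by
      simpa using hu1.1.kinetic_lin hab hφ 1 ε
    have h3 : potential g p a b (fun t => u t + ε * φ t) ≤
        potential g p a b u + ε * ∫ t in a..b, (p t - g (u t)) * φ t := by
      unfold potential
      rw [← intervalIntegral.integral_const_mul, ← intervalIntegral.integral_add
        (h.intervalIntegrable_potential hab hcu) (hint.const_mul _)]
      refine intervalIntegral.integral_mono_on hab
        (h.intervalIntegrable_potential hab (hw.continuousOn hab))
        ((h.intervalIntegrable_potential hab hcu).add (hint.const_mul _)) fun t _ => ?_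
      have := h.primitive_ge (u t) (u t + ε * φ t)
      nlinarith
    rw [h2] at h1
    rw [hI]
    nlinarith
  by_contra hneg
  push Not at hneg
  have hk := kinetic_nonneg hab φ
  set k := kinetic a b φ
  -- If `I` were negative, this step is so short that the quadratic term ε²k/2 could not compensate
  -- ε I.
  set ε := min ε₀ (-I / (k + 1)) with hε
  have hεpos : 0 < ε := lt_min hε₀ (div_pos (by linarith) (by linarith))
  have h1 := key ε ⟨hεpos, min_le_left _ _⟩
  have h2 : ε * (k + 1) ≤ -I := by
    rw [← le_div_iff₀ (by linarith)]
    exact min_le_right _ _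
  have h3 : 0 ≤ I + ε / 2 * k := by
    by_contra hc
    push Not at hc
    nlinarith
  nlinarith

end Admissible

/-! ### Tent functions and second divided differences of minimizers -/

/-- The piecewise affine function with value `1` at `y`, vanishing outside `(x,z)`. -/
def tent (x y z t : ℝ) : ℝ := max 0 (min ((t - x) / (y - x)) ((z - t) / (z - y)))

section tent

variable {x y z t : ℝ}

theorem tent_nonneg : 0 ≤ tent x y z t := le_max_left _ _

theorem tent_eq_left (hxy : x < y) (hyz : y < z) (h : t ∈ Icc x y) :
    tent x y z t = (t - x) / (y - x) := by
  have h1 : (t - x) / (y - x) ≤ 1 := (div_le_one (by linarith)).2 (by linarith [h.2])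
  have h2 : 1 ≤ (z - t) / (z - y) := (one_le_div (by linarith)).2 (by linarith [h.2])
  have h3 : 0 ≤ (t - x) / (y - x) := div_nonneg (by linarith [h.1]) (by linarith)
  rw [tent, min_eq_left (h1.trans h2), max_eq_right h3]

theorem tent_eq_right (hxy : x < y) (hyz : y < z) (h : t ∈ Icc y z) :
    tent x y z t = (z - t) / (z - y) := by
  have h1 : 1 ≤ (t - x) / (y - x) := (one_le_div (by linarith)).2 (by linarith [h.1])
  have h2 : (z - t) / (z - y) ≤ 1 := (div_le_one (by linarith)).2 (by linarith [h.1])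
  have h3 : 0 ≤ (z - t) / (z - y) := div_nonneg (by linarith [h.2]) (by linarith)
  rw [tent, min_eq_right (h2.trans h1), max_eq_right h3]

theorem tent_eq_zero_left (hxy : x < y) (h : t ≤ x) : tent x y z t = 0 :=
  max_eq_left ((min_le_left _ _).trans (div_nonpos_of_nonpos_of_nonneg (by linarith)
    (by linarith)))

theorem tent_eq_zero_right (hyz : y < z) (h : z ≤ t) : tent x y z t = 0 :=
  max_eq_left ((min_le_right _ _).trans (div_nonpos_of_nonpos_of_nonneg (by linarith)
    (by linarith)))

theorem tent_le_one (hxy : x < y) (hyz : y < z) : tent x y z t ≤ 1 := by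
  refine max_le zero_le_one ?_
  rcases le_total t y with h | h
  · exact (min_le_left _ _).trans ((div_le_one (by linarith)).2 (by linarith))
  · exact (min_le_right _ _).trans ((div_le_one (by linarith)).2 (by linarith))

theorem continuous_tent : Continuous (tent x y z) := by unfold tent; fun_prop

theorem isH1_tent {a b : ℝ} (hab : a ≤ b) : IsH1 a b (tent x y z) := by
  have aff : ∀ m c : ℝ, LipschitzWith ‖m‖₊ fun t : ℝ => m * t + c := fun m c =>
    LipschitzWith.of_dist_le_mul fun s t => by
      rw [Real.dist_eq, Real.dist_eq, coe_nnnorm, Real.norm_eq_abs, ← abs_mul]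
      apply le_of_eq
      congr 1
      ring
  have h1 := (aff (1 / (y - x)) (-x / (y - x))).min (aff (-1 / (z - y)) (z / (z - y)))
  have h2 := h1.const_max 0
  refine (IsH1.of_lipschitzOnWith hab h2.lipschitzOnWith).congr hab fun t _ => ?_
  unfold tent
  congr 2 <;> ring

theorem integral_tent_mul {a b : ℝ} {q : ℝ → ℝ} (hax : a ≤ x) (hxy : x < y) (hyz : y < z)
    (hzb : z ≤ b) (hq : ContinuousOn q (Icc a b)) :
    ∫ t in a..b, q t * tent x y z t = (∫ t in x..y, q t * ((t - x) / (y - x))) +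
      ∫ t in y..z, q t * ((z - t) / (z - y)) := by
  have hi : ∀ c d, a ≤ c → c ≤ d → d ≤ b →
      IntervalIntegrable (fun t => q t * tent x y z t) volume c d := fun c d h1 h2 h3 => by
    refine ContinuousOn.intervalIntegrable ?_
    rw [uIcc_of_le h2]
    exact (hq.mono (Icc_subset_Icc h1 h3)).mul continuous_tent.continuousOn
  rw [← intervalIntegral.integral_add_adjacent_intervals (hi a x le_rfl hax (by linarith))
      (hi x b hax (by linarith) le_rfl),
    ← intervalIntegral.integral_add_adjacent_intervals (hi x y hax hxy.le (by linarith))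
      (hi y b (by linarith) (by linarith) le_rfl),
    ← intervalIntegral.integral_add_adjacent_intervals (hi y z (by linarith) hyz.le hzb)
      (hi z b (by linarith) hzb le_rfl)]
  have e1 : ∫ t in a..x, q t * tent x y z t = 0 := by
    rw [integral_congr_Ioo (h := fun _ => 0) hax fun t ht => by
      rw [tent_eq_zero_left hxy ht.2.le, mul_zero]]
    simp
  have e4 : ∫ t in z..b, q t * tent x y z t = 0 := by
    rw [integral_congr_Ioo (h := fun _ => 0) hzb fun t ht => by
      rw [tent_eq_zero_right hyz ht.1.le, mul_zero]]
    simp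
  rw [e1, e4, zero_add, add_zero]
  congr 1
  · exact integral_congr_Ioo hxy.le fun t ht => by
      rw [tent_eq_left hxy hyz (Ioo_subset_Icc_self ht)]
  · exact integral_congr_Ioo hyz.le fun t ht => by
      rw [tent_eq_right hxy hyz (Ioo_subset_Icc_self ht)]

/-- The derivative of the tent is constant on each side of `y`, so the pairing is a difference of
two mean slopes. The first variation thereby becomes a statement about values of `u` alone. -/
theorem integral_deriv_mul_tent {a b : ℝ} {u : ℝ → ℝ} (hax : a ≤ x) (hxy : x < y) (hyz : y < z)
    (hzb : z ≤ b) (hu : IsH1 a b u) :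
    ∫ t in a..b, deriv u t * deriv (tent x y z) t =
      (u y - u x) / (y - x) - (u z - u y) / (z - y) := by
  have hi : ∀ c d, a ≤ c → c ≤ d → d ≤ b →
      IntervalIntegrable (fun t => deriv u t * deriv (tent x y z) t) volume c d :=
    fun c d h1 h2 h3 => (hu.mono h1 h2 h3).intervalIntegrable_mul h2 (isH1_tent h2)
  rw [← intervalIntegral.integral_add_adjacent_intervals (hi a x le_rfl hax (by linarith))
      (hi x b hax (by linarith) le_rfl),
    ← intervalIntegral.integral_add_adjacent_intervals (hi x y hax hxy.le (by linarith))
      (hi y b (by linarith) (by linarith) le_rfl),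
    ← intervalIntegral.integral_add_adjacent_intervals (hi y z (by linarith) hyz.le hzb)
      (hi z b (by linarith) hzb le_rfl)]
  have e1 : ∫ t in a..x, deriv u t * deriv (tent x y z) t = 0 := by
    rw [integral_congr_Ioo (h := fun _ => 0) hax fun t ht => by
      rw [deriv_eq_of_eqOn_Icc (v := fun _ => 0)
        (fun s hs => tent_eq_zero_left hxy hs.2) ht, deriv_const, mul_zero]]
    simp
  have e4 : ∫ t in z..b, deriv u t * deriv (tent x y z) t = 0 := by
    rw [integral_congr_Ioo (h := fun _ => 0) hzb fun t ht => by
      rw [deriv_eq_of_eqOn_Icc (v := fun _ => 0)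
        (fun s hs => tent_eq_zero_right hyz hs.1) ht, deriv_const, mul_zero]]
    simp
  have e2 : ∫ t in x..y, deriv u t * deriv (tent x y z) t = (u y - u x) / (y - x) := by
    rw [integral_congr_Ioo (h := fun t => deriv u t * (1 / (y - x))) hxy.le fun t ht => by
      rw [deriv_eq_of_eqOn_Icc (fun s hs => tent_eq_left hxy hyz hs) ht]
      congr 1
      exact (((hasDerivAt_id t).sub_const x).div_const (y - x)).deriv]
    rw [intervalIntegral.integral_mul_const,
      (hu.mono hax hxy.le (by linarith)).integral_deriv, mul_one_div]
  have e3 : ∫ t in y..z, deriv u t * deriv (tent x y z) t = -((u z - u y) / (z - y)) := by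
    rw [integral_congr_Ioo (h := fun t => deriv u t * (-1 / (z - y))) hyz.le fun t ht => by
      rw [deriv_eq_of_eqOn_Icc (fun s hs => tent_eq_right hxy hyz hs) ht]
      congr 1
      exact (((hasDerivAt_id t).const_sub z).div_const (z - y)).deriv]
    rw [intervalIntegral.integral_mul_const,
      (hu.mono (by linarith) hyz.le hzb).integral_deriv]
    ring
  rw [e1, e2, e3, e4]
  ring

end tent

namespace Admissible

variable {g p : ℝ → ℝ} {C : ℝ} {a b x y z : ℝ} {u : ℝ → ℝ}

theorem continuousOn_forcing (h : Admissible g p C) (hab : a ≤ b) (hu : IsH1 a b u) :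
    ContinuousOn (fun t => p t - g (u t)) (Icc a b) :=
  h.p_cont.continuousOn.sub (h.g_cont.comp_continuousOn (hu.continuousOn hab))

theorem abs_forcing_le (h : Admissible g p C) (t s : ℝ) : |p t - g s| ≤ 2 * C := by
  have h1 := abs_le.1 (h.p_bdd t)
  have h2 := abs_le.1 (h.g_bdd s)
  rw [abs_le]
  constructor <;> linarith

/-- Semiconcavity of minimizers, in terms of second divided differences. -/
theorem slope_le (h : Admissible g p C) (hu : IsMinimizer g p a b u) (hax : a ≤ x) (hxy : x < y)
    (hyz : y < z) (hzb : z ≤ b) : (u z - u y) / (z - y) ≤ (u y - u x) / (y - x) +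
      ((∫ t in x..y, (p t - g (u t)) * ((t - x) / (y - x))) +
        ∫ t in y..z, (p t - g (u t)) * ((z - t) / (z - y))) := by
  have hab : a ≤ b := by linarith
  have hu1 := (mem_H01Plus_iff hab).1 hu.1
  have hm : (fun t => u t + 1 * tent x y z t) ∈ H01Plus a b := by
    rw [mem_H01Plus_iff hab]
    refine ⟨(hu1.1.lin hab (isH1_tent (x := x) (y := y) (z := z) hab) 1 1).congr hab fun t _ => by simp, ?_, ?_, ?_⟩
    · simp [tent_eq_zero_left hxy hax, hu1.2.1]
    · simp [tent_eq_zero_right hyz hzb, hu1.2.2.1]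
    · exact fun t ht => add_nonneg (hu1.2.2.2 t ht) (mul_nonneg zero_le_one tent_nonneg)
  have := h.first_variation_nonneg hab hu (isH1_tent (x := x) (y := y) (z := z) hab) one_pos hm
  rw [integral_deriv_mul_tent hax hxy hyz hzb hu1.1,
    integral_tent_mul hax hxy hyz hzb (h.continuousOn_forcing hab hu1.1)] at this
  linarith

/-- On a compact subinterval of the interior a positive minimizer is bounded away from zero, so a
small multiple of the tent may also be subtracted, and the first variation vanishes in that
direction. -/
theorem slope_eq_of_pos (h : Admissible g p C) (hu : IsMinimizer g p a b u)
    (hpos : ∀ t ∈ Ioo a b, 0 < u t) (hax : a < x) (hxy : x < y)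
    (hyz : y < z) (hzb : z < b) : (u z - u y) / (z - y) = (u y - u x) / (y - x) +
      ((∫ t in x..y, (p t - g (u t)) * ((t - x) / (y - x))) +
        ∫ t in y..z, (p t - g (u t)) * ((z - t) / (z - y))) := by
  refine le_antisymm (h.slope_le hu hax.le hxy hyz hzb.le) ?_
  have hab : a ≤ b := by linarith
  have hu1 := (mem_H01Plus_iff hab).1 hu.1
  obtain ⟨t₀, ht₀, hmin⟩ := (isCompact_Icc (a := x) (b := z)).exists_isMinOn
    (nonempty_Icc.2 (by linarith))
    ((hu1.1.continuousOn hab).mono (Icc_subset_Icc hax.le hzb.le))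
  -- The minimum of `u` over the support of the tent is the room available for a downward
  -- perturbation, since the tent is at most 1.
  have hε : 0 < u t₀ := hpos _ ⟨by linarith [ht₀.1], by linarith [ht₀.2]⟩
  have hH : IsH1 a b (fun t => -tent x y z t) :=
    ((isH1_tent (x := x) (y := y) (z := z) hab).lin hab (isH1_tent (x := x) (y := y) (z := z) hab) (-1) 0).congr hab fun t _ => by simp
  have hm : (fun t => u t + u t₀ * (-tent x y z t)) ∈ H01Plus a b := by
    rw [mem_H01Plus_iff hab]
    refine ⟨(hu1.1.lin hab hH 1 (u t₀)).congr hab fun t _ => by simp, ?_, ?_, fun t ht => ?_⟩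
    · simp [tent_eq_zero_left hxy hax.le, hu1.2.1]
    · simp [tent_eq_zero_right hyz hzb.le, hu1.2.2.1]
    · rcases le_or_gt t x with h1 | h1
      · simpa [tent_eq_zero_left hxy h1] using hu1.2.2.2 t ht
      rcases le_or_gt z t with h2 | h2
      · simpa [tent_eq_zero_right hyz h2] using hu1.2.2.2 t ht
      have h3 : u t₀ ≤ u t := hmin ⟨h1.le, h2.le⟩
      have h4 := tent_le_one (t := t) hxy hyz
      nlinarith
  have := h.first_variation_nonneg hab hu hH hε hm
  have e1 : ∫ t in a..b, deriv u t * deriv (fun t => -tent x y z t) t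
      = -∫ t in a..b, deriv u t * deriv (tent x y z) t := by
    rw [← intervalIntegral.integral_neg]
    refine intervalIntegral.integral_congr fun t _ => ?_
    simp only [deriv.fun_neg]
    ring
  have e2 : ∫ t in a..b, (p t - g (u t)) * -tent x y z t
      = -∫ t in a..b, (p t - g (u t)) * tent x y z t := by
    rw [← intervalIntegral.integral_neg]
    exact intervalIntegral.integral_congr fun t _ => by ring
  rw [e1, e2, integral_deriv_mul_tent hax.le hxy hyz hzb.le hu1.1,
    integral_tent_mul hax.le hxy hyz hzb.le (h.continuousOn_forcing hab hu1.1)] at this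
  linarith

end Admissible

/-! ### Compactness and existence of minimizers -/

theorem L2_norm_sq {μ : Measure ℝ} (f : Lp ℝ 2 μ) : ‖f‖ ^ 2 = ∫ x, f x ^ 2 ∂μ := by
  rw [← real_inner_self_eq_norm_sq, L2.inner_def]
  exact integral_congr_ae (ae_of_all _ fun x => by simp [sq])

/-- Compactness of bounded sets of `1/2`-Hölder functions. -/
theorem exists_subseq_tendstoUniformlyOn {A B R : ℝ} {w : ℕ → ℝ → ℝ}
    (h0 : ∀ n, w n A = 0)
    (hR : ∀ n, ∀ s ∈ Icc A B, ∀ t ∈ Icc A B, (w n t - w n s) ^ 2 ≤ R * |t - s|) (hAB : A ≤ B) :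
    ∃ φ : ℕ → ℕ, StrictMono φ ∧ ∃ v : ℝ → ℝ,
      TendstoUniformlyOn (fun k => w (φ k)) v atTop (Icc A B) := by
  have hmod : ∀ n, ∀ s ∈ Icc A B, ∀ t ∈ Icc A B, |w n t - w n s| ≤ √(R * |t - s|) :=
    fun n s hs t ht => Real.abs_le_sqrt (hR n s hs t ht)
  have hsq : Tendsto (fun r : ℝ => √(R * r)) (𝓝 0) (𝓝 0) := by
    have : Continuous fun r : ℝ => √(R * r) := by fun_prop
    simpa using this.tendsto 0
  have hcont : ∀ n, Continuous fun t : Icc A B => w n t := fun n => by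
    rw [Metric.continuous_iff']
    intro s ε hε
    have h1 : Tendsto (fun t : Icc A B => √(R * |(t : ℝ) - s|)) (𝓝 s) (𝓝 0) := by
      have : Continuous fun t : Icc A B => √(R * |(t : ℝ) - s|) := by fun_prop
      simpa using this.tendsto s
    filter_upwards [h1.eventually (gt_mem_nhds hε)] with t ht
    exact (hmod n s s.2 t t.2).trans_lt ht
  let F : ℕ → BoundedContinuousFunction (Icc A B) ℝ := fun n =>
    BoundedContinuousFunction.mkOfCompact ⟨_, hcont n⟩
  have hcpt : IsCompact (closure (range F)) := by
    refine BoundedContinuousFunction.arzela_ascoli (Metric.closedBall 0 √(|R| * (B - A)))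
      (isCompact_closedBall _ _) _ ?_ ?_
    · rintro _ x ⟨n, rfl⟩
      have h1 := hmod n A (left_mem_Icc.2 hAB) x x.2
      rw [h0, sub_zero] at h1
      rw [mem_closedBall_zero_iff, Real.norm_eq_abs]
      refine h1.trans (Real.sqrt_le_sqrt ?_)
      rw [abs_of_nonneg (sub_nonneg.2 x.2.1)]
      exact mul_le_mul (le_abs_self R) (by linarith [x.2.2]) (sub_nonneg.2 x.2.1) (abs_nonneg R)
    · refine Metric.equicontinuous_of_continuity_modulus (fun r => √(R * r)) hsq _ ?_
      rintro x y ⟨_, n, rfl⟩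
      rw [Real.dist_eq, abs_sub_comm]
      refine (hmod n x x.2 y y.2).trans (le_of_eq ?_)
      rw [Subtype.dist_eq, Real.dist_eq, abs_sub_comm]
  obtain ⟨f, -, φ, hφ, hlim⟩ := hcpt.tendsto_subseq fun n => subset_closure (mem_range_self n)
  refine ⟨φ, hφ, fun t => if ht : t ∈ Icc A B then f ⟨t, ht⟩ else 0, ?_⟩
  rw [Metric.tendstoUniformlyOn_iff]
  intro ε hε
  filter_upwards [Metric.tendsto_nhds.1 hlim ε hε] with k hk t ht
  rw [dif_pos ht, dist_comm]
  exact (BoundedContinuousFunction.dist_coe_le_dist (⟨t, ht⟩ : Icc A B)).trans_lt hk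

theorem IsH1.holder {a b R : ℝ} {u : ℝ → ℝ} (hu : IsH1 a b u)
    (hR : kinetic a b u ≤ R) {s t : ℝ} (hs : s ∈ Icc a b) (ht : t ∈ Icc a b) :
    (u t - u s) ^ 2 ≤ R * |t - s| := by
  wlog hst : s ≤ t generalizing s t
  · rw [abs_sub_comm, ← neg_sub, neg_sq]
    exact this ht hs (le_of_not_ge hst)
  have h1 := (hu.mono hs.1 hst ht.2).sq_sub_le hst
  rw [abs_of_nonneg (sub_nonneg.2 hst), mul_comm]
  refine h1.trans (mul_le_mul_of_nonneg_left (le_trans ?_ hR) (sub_nonneg.2 hst))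
  exact intervalIntegral.integral_mono_interval hs.1 hst ht.2
    (ae_of_all _ fun t => sq_nonneg _) hu.sq

namespace Admissible

variable {g p : ℝ → ℝ} {C : ℝ} {a b : ℝ} {u v : ℝ → ℝ}

theorem abs_potential_integrand_le (h : Admissible g p C) (t s : ℝ) :
    |p t * s - primitive g s| ≤ 2 * C * |s| := by
  have h1 := h.abs_primitive_sub_le 0 s
  rw [primitive_zero, sub_zero, sub_zero] at h1
  have h2 : |p t * s| ≤ C * |s| := by
    rw [abs_mul]
    exact mul_le_mul_of_nonneg_right (h.p_bdd t) (abs_nonneg s)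
  calc _ ≤ |p t * s| + |primitive g s| := abs_sub _ _
    _ ≤ _ := by linarith

/-- A function vanishing at `a` satisfies u² ≤ E (b-a), with E its kinetic integral. The potential
grows only linearly in u, so it is absorbed by half of the kinetic term. -/
theorem coercive (h : Admissible g p C) (hab : a < b) (hu : u ∈ H01Plus a b) :
    kinetic a b u / 4 - 4 * C ^ 2 * (b - a) ^ 3 ≤ action g p a b u := by
  have hu1 := (mem_H01Plus_iff hab.le).1 hu
  rw [h.action_eq hab.le hu1.1]
  have hl : 0 < b - a := sub_pos.2 hab
  set l := b - a with hl'
  set E := kinetic a b u with hE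
  have key : ∀ t ∈ Icc a b, -(E / (4 * l) + 4 * C ^ 2 * l ^ 2) ≤ p t * u t - primitive g (u t) := by
    intro t ht
    have h1 := (abs_le.1 (h.abs_potential_integrand_le t (u t))).1
    have h0 := hu1.2.2.2 t ht
    rw [abs_of_nonneg h0] at h1
    have h2 := hu1.1.holder le_rfl (left_mem_Icc.2 hab.le) ht
    rw [hu1.2.1, sub_zero, abs_of_nonneg (sub_nonneg.2 ht.1)] at h2
    have h3 : u t ^ 2 ≤ E * l := h2.trans
      (mul_le_mul_of_nonneg_left (by linarith [ht.2]) (kinetic_nonneg hab.le u))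
    have h4 : u t ^ 2 / (4 * l ^ 2) ≤ E / (4 * l) := by
      rw [div_le_div_iff₀ (by positivity) (by positivity)]
      nlinarith
    -- Young's inequality, weighted so that the first term integrates over the interval to at most
    -- E/4.
    have h5 : 2 * C * u t ≤ u t ^ 2 / (4 * l ^ 2) + 4 * C ^ 2 * l ^ 2 := by
      have : u t ^ 2 / (4 * l ^ 2) + 4 * C ^ 2 * l ^ 2 - 2 * C * u t
          = (u t / (2 * l) - 2 * C * l) ^ 2 := by field_simp; ring
      nlinarith [sq_nonneg (u t / (2 * l) - 2 * C * l)]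
    linarith
  have h1 : ∫ _ in a..b, -(E / (4 * l) + 4 * C ^ 2 * l ^ 2) ≤ potential g p a b u :=
    intervalIntegral.integral_mono_on hab.le intervalIntegrable_const
      (h.intervalIntegrable_potential hab.le (hu1.1.continuousOn hab.le)) key
  rw [intervalIntegral.integral_const, smul_eq_mul, ← hl'] at h1
  have h2 : l * -(E / (4 * l) + 4 * C ^ 2 * l ^ 2) = -(E / 4) - 4 * C ^ 2 * l ^ 3 := by
    field_simp; ring
  linarith

theorem abs_potential_sub_le (h : Admissible g p C) (hab : a ≤ b)
    (hu : ContinuousOn u (Icc a b)) (hv : ContinuousOn v (Icc a b)) {r : ℝ}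
    (hr : ∀ t ∈ Icc a b, |u t - v t| ≤ r) :
    |potential g p a b u - potential g p a b v| ≤ 2 * C * r * (b - a) := by
  unfold potential
  rw [← intervalIntegral.integral_sub (h.intervalIntegrable_potential hab hu)
    (h.intervalIntegrable_potential hab hv), ← Real.norm_eq_abs]
  refine (intervalIntegral.norm_integral_le_of_norm_le_const (C := 2 * C * r) fun t ht => ?_).trans
    (le_of_eq (by rw [abs_of_nonneg (sub_nonneg.2 hab)]))
  rw [uIoc_of_le hab] at ht
  have h0 := hr t (Ioc_subset_Icc_self ht)
  have h1 := h.abs_primitive_sub_le (v t) (u t)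
  have h2 : |p t * (u t - v t)| ≤ C * |u t - v t| := by
    rw [abs_mul]
    exact mul_le_mul_of_nonneg_right (h.p_bdd t) (abs_nonneg _)
  have h3 := mul_le_mul_of_nonneg_left h0 h.C_nonneg
  rw [Real.norm_eq_abs, show p t * u t - primitive g (u t) - (p t * v t - primitive g (v t))
    = p t * (u t - v t) - (primitive g (u t) - primitive g (v t)) by ring]
  have h4 := abs_sub (p t * (u t - v t)) (primitive g (u t) - primitive g (v t))
  linarith

/-- The midpoint deficit controls the distance of the derivatives. -/
theorem kinetic_sub_le (h : Admissible g p C) (hab : a ≤ b) (hu : IsH1 a b u) (hv : IsH1 a b v)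
    {r : ℝ} (hr : ∀ t ∈ Icc a b, |u t - v t| ≤ r) :
    kinetic a b (fun t => u t - v t) / 8 ≤ (action g p a b u + action g p a b v) / 2 -
      action g p a b (fun t => 1 / 2 * u t + 1 / 2 * v t) + C * r * (b - a) := by
  have hz := hu.lin hab hv (1 / 2) (1 / 2)
  rw [h.action_eq hab hu, h.action_eq hab hv, h.action_eq hab hz,
    hu.kinetic_lin hab hv (1 / 2) (1 / 2)]
  have e : kinetic a b (fun t => u t - v t) = kinetic a b (fun t => 1 * u t + (-1) * v t) := by
    congr 1
    ext t
    ring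
  rw [e, hu.kinetic_lin hab hv]
  have h1 := abs_le.1 (h.abs_potential_sub_le hab (hz.continuousOn hab) (hu.continuousOn hab)
    -- The midpoint lies within r/2 of both functions. The factor 1/8 in the conclusion is the
    -- kinetic weight 1/2 times the 1/4 of the parallelogram identity.
    (r := r / 2) fun t ht => by
      rw [show 1 / 2 * u t + 1 / 2 * v t - u t = -((u t - v t) / 2) by ring, abs_neg, abs_div,
        abs_two]
      linarith [hr t ht])
  have h2 := abs_le.1 (h.abs_potential_sub_le hab (hz.continuousOn hab) (hv.continuousOn hab)
    (r := r / 2) fun t ht => by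
      rw [show 1 / 2 * u t + 1 / 2 * v t - v t = (u t - v t) / 2 by ring, abs_div, abs_two]
      linarith [hr t ht])
  linarith [h1.2, h2.2]

/-- Compactness of sequences which are asymptotically minimizing at midpoints. -/
theorem exists_subseq_limit (h : Admissible g p C) (hab : a < b) {w : ℕ → ℝ → ℝ}
    (hw : ∀ n, w n ∈ H01Plus a b) {l : ℝ}
    (hl : Tendsto (fun n => action g p a b (w n)) atTop (𝓝 l))
    (hmid : ∀ ε > 0, ∃ N, ∀ n ≥ N, ∀ m ≥ N,
      l - ε ≤ action g p a b (fun t => 1 / 2 * w n t + 1 / 2 * w m t)) :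
    ∃ φ : ℕ → ℕ, StrictMono φ ∧ ∃ v ∈ H01Plus a b, action g p a b v = l ∧
      TendstoUniformlyOn (fun k => w (φ k)) v atTop (Icc a b) := by
  have hab' := hab.le
  have hw1 := fun n => (mem_H01Plus_iff hab').1 (hw n)
  obtain ⟨M, hM⟩ := hl.bddAbove_range
  have hk : ∀ n, kinetic a b (w n) ≤ 4 * (M + 4 * C ^ 2 * (b - a) ^ 3) := fun n => by
    have h1 := h.coercive hab (hw n)
    have h2 : action g p a b (w n) ≤ M := hM (mem_range_self n)
    linarith
  obtain ⟨φ, hφ, v, hv⟩ := exists_subseq_tendstoUniformlyOn (fun n => (hw1 n).2.1)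
    (fun n s hs t ht => (hw1 n).1.holder (hk n) hs ht) hab'
  refine ⟨φ, hφ, v, ?_⟩
  have hpt : ∀ t ∈ Icc a b, Tendsto (fun k => w (φ k) t) atTop (𝓝 (v t)) := fun t ht =>
    hv.tendsto_at ht
  set μ := volume.restrict (Ioc a b) with hμ
  have hL := fun k => (hw1 (φ k)).1.memLp hab'
  let F : ℕ → Lp ℝ 2 μ := fun k => (hL k).toLp
  have hFk : ∀ k m, ‖F k - F m‖ ^ 2 = kinetic a b (fun t => w (φ k) t - w (φ m) t) := by
    intro k m
    rw [L2_norm_sq, kinetic, intervalIntegral.integral_of_le hab']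
    refine integral_congr_ae ?_
    have h1 := (ae_restrict_iff' measurableSet_uIoc).2
      ((hw1 (φ k)).1.ae_deriv_sub (hw1 (φ m)).1)
    rw [uIoc_of_le hab'] at h1
    filter_upwards [h1, Lp.coeFn_sub (F k) (F m), (hL k).coeFn_toLp, (hL m).coeFn_toLp]
      with t h1 h2 h3 h4
    rw [h2, h1, Pi.sub_apply, h3, h4]
  have hFn : ∀ k, ‖F k‖ ^ 2 = kinetic a b (w (φ k)) := by
    intro k
    rw [L2_norm_sq, kinetic, intervalIntegral.integral_of_le hab']
    refine integral_congr_ae ?_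
    filter_upwards [(hL k).coeFn_toLp] with t h3
    rw [h3]
  -- The midpoint deficit is at most ε²/32 + ε²/32 and the uniform distance contributes at most
  -- ε²/64; the sum stays below ε²/8, the bound needed for distance less than ε.
  have hcauchy : CauchySeq F := by
    rw [Metric.cauchySeq_iff]
    intro ε hε
    obtain ⟨N₁, hN₁⟩ := hmid (ε ^ 2 / 32) (by positivity)
    obtain ⟨N₂, hN₂⟩ := (Metric.tendsto_atTop.1 hl) (ε ^ 2 / 32) (by positivity)
    set r := ε ^ 2 / (64 * (C * (b - a) + 1)) with hr
    have hCl : 0 ≤ C * (b - a) := mul_nonneg h.C_nonneg (sub_nonneg.2 hab')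
    have hr0 : 0 < r := by positivity
    obtain ⟨N₃, hN₃⟩ := eventually_atTop.1 (Metric.tendstoUniformlyOn_iff.1 hv (r / 2) (by positivity))
    refine ⟨max N₁ (max N₂ N₃), fun k hk' m hm' => ?_⟩
    simp only [ge_iff_le, max_le_iff] at hk' hm'
    have hd : ∀ t ∈ Icc a b, |w (φ k) t - w (φ m) t| ≤ r := fun t ht => by
      have h1 := hN₃ k hk'.2.2 t ht
      have h2 := hN₃ m hm'.2.2 t ht
      have h3 := dist_triangle_left (w (φ k) t) (w (φ m) t) (v t)
      rw [← Real.dist_eq]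
      linarith
    have h1 := h.kinetic_sub_le hab' (hw1 (φ k)).1 (hw1 (φ m)).1 hd
    rw [← hFk] at h1
    have h2 := hN₁ (φ k) (hk'.1.trans (hφ.id_le k)) (φ m) (hm'.1.trans (hφ.id_le m))
    have h3 := hN₂ (φ k) (hk'.2.1.trans (hφ.id_le k))
    have h4 := hN₂ (φ m) (hm'.2.1.trans (hφ.id_le m))
    rw [Real.dist_eq, abs_lt] at h3 h4
    have h5 : C * r * (b - a) ≤ ε ^ 2 / 64 := by
      have : C * r * (b - a) = ε ^ 2 / 64 * (C * (b - a) / (C * (b - a) + 1)) := by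
        rw [hr]; field_simp
      rw [this]
      exact mul_le_of_le_one_right (by positivity) ((div_le_one (by positivity)).2 (by linarith))
    rw [dist_eq_norm]
    refine lt_of_pow_lt_pow_left₀ 2 hε.le ?_
    have : 0 < ε ^ 2 := by positivity
    linarith
  obtain ⟨f, hf⟩ := cauchySeq_tendsto_of_complete hcauchy
  have hfmem : MemLp f 2 μ := Lp.memLp f
  have hint : ∀ t ∈ Icc a b, v t = ∫ s in a..t, f s := by
    intro t ht
    have hsub : Ioc a t ⊆ Ioc a b := Ioc_subset_Ioc_right ht.2
    have hr : ∀ q : ℝ → ℝ, ∫ s in a..t, q s = ∫ s in Ioc a t, q s ∂μ := fun q => by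
      rw [intervalIntegral.integral_of_le ht.1, hμ,
        Measure.restrict_restrict measurableSet_Ioc, inter_eq_self_of_subset_left hsub]
    have hfin : μ (Ioc a t) ≠ ⊤ := (measure_lt_top μ _).ne
    have h1 : Tendsto (fun k => ∫ s in Ioc a t, F k s ∂μ) atTop
        (𝓝 (∫ s in Ioc a t, f s ∂μ)) := by
      -- The integral over (a,t] is the inner product with an indicator, hence continuous in L²;
      -- this identifies the uniform limit `v` as the primitive of `f`.
      have h2 := (tendsto_const_nhds (x := indicatorConstLp 2 (μ := μ) (measurableSet_Ioc (a := a)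
        (b := t)) hfin (1 : ℝ))).inner (𝕜 := ℝ) hf
      simpa only [L2.inner_indicatorConstLp_one] using h2
    rw [hr]
    refine tendsto_nhds_unique (hpt t ht) (h1.congr fun k => ?_)
    rw [setIntegral_congr_ae (g := deriv (w (φ k))) measurableSet_Ioc
      ((hL k).coeFn_toLp.mono fun x hx _ => hx), ← hr,
      ((hw1 (φ k)).1.mono le_rfl ht.1 ht.2).integral_deriv, (hw1 (φ k)).2.1, sub_zero]
  have hva : v a = 0 := by simpa using hint a (left_mem_Icc.2 hab')
  obtain ⟨hvH, hvd⟩ := IsH1.of_integral (u := v) hab' hfmem fun t ht => by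
    rw [hva, zero_add]; exact hint t ht
  have hkv : kinetic a b v = ‖f‖ ^ 2 := by
    rw [L2_norm_sq, kinetic, intervalIntegral.integral_of_le hab']
    have h1 := (ae_restrict_iff' measurableSet_uIoc).2 hvd
    rw [uIoc_of_le hab'] at h1
    refine integral_congr_ae ?_
    filter_upwards [h1] with t h1
    rw [h1]
  have hvmem : v ∈ H01Plus a b := by
    rw [mem_H01Plus_iff hab']
    refine ⟨hvH, hva, ?_, fun t ht => ge_of_tendsto' (hpt t ht) fun k => (hw1 (φ k)).2.2.2 t ht⟩
    exact tendsto_nhds_unique (hpt b (right_mem_Icc.2 hab'))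
      (by simp only [(hw1 _).2.2.1]; exact tendsto_const_nhds)
  refine ⟨hvmem, ?_, hv⟩
  have hkin : Tendsto (fun k => kinetic a b (w (φ k))) atTop (𝓝 (kinetic a b v)) := by
    rw [hkv]
    exact (hf.norm.pow 2).congr hFn
  have hpot : Tendsto (fun k => potential g p a b (w (φ k))) atTop (𝓝 (potential g p a b v)) := by
    rw [Metric.tendsto_nhds]
    intro ε hε
    have hCl : 0 ≤ C * (b - a) := mul_nonneg h.C_nonneg (sub_nonneg.2 hab')
    set r := ε / (4 * (C * (b - a) + 1)) with hr
    filter_upwards [Metric.tendstoUniformlyOn_iff.1 hv r (by positivity)] with k hk'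
    rw [Real.dist_eq]
    refine (h.abs_potential_sub_le hab' ((hw1 (φ k)).1.continuousOn hab')
      (hvH.continuousOn hab') (r := r) fun t ht => ?_).trans_lt ?_
    · rw [abs_sub_comm]; exact (hk' t ht).le
    · have : 2 * C * r * (b - a) = ε / 2 * (C * (b - a) / (C * (b - a) + 1)) := by
        rw [hr]; field_simp; ring
      rw [this]
      refine (mul_le_of_le_one_right (by positivity)
        ((div_le_one (by positivity)).2 (by linarith))).trans_lt (by linarith)
  refine tendsto_nhds_unique ?_ (hl.comp hφ.tendsto_atTop)
  rw [h.action_eq hab' hvH]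
  exact ((hkin.const_mul _).add hpot).congr fun k => (h.action_eq hab' (hw1 (φ k)).1).symm

theorem bddBelow_action (h : Admissible g p C) (hab : a < b) :
    BddBelow (action g p a b '' H01Plus a b) := by
  refine ⟨-(4 * C ^ 2 * (b - a) ^ 3), ?_⟩
  rintro _ ⟨u, hu, rfl⟩
  have h1 := h.coercive hab hu
  have h2 := kinetic_nonneg hab.le u
  linarith

theorem phiPlus_le (h : Admissible g p C) (hab : a < b) (hu : u ∈ H01Plus a b) :
    phiPlus g p a b ≤ action g p a b u :=
  csInf_le (h.bddBelow_action hab) (mem_image_of_mem _ hu)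

theorem isMinimizer_iff (h : Admissible g p C) (hab : a < b) :
    IsMinimizer g p a b u ↔ u ∈ H01Plus a b ∧ action g p a b u = phiPlus g p a b := by
  constructor
  · rintro ⟨h1, h2⟩
    refine ⟨h1, le_antisymm (le_csInf ⟨_, mem_image_of_mem _ h1⟩ ?_) (h.phiPlus_le hab h1)⟩
    rintro _ ⟨v, hv, rfl⟩
    exact h2 v hv
  · rintro ⟨h1, h2⟩
    exact ⟨h1, fun v hv => h2 ▸ h.phiPlus_le hab hv⟩

/-- Direct method. The cone is convex, so midpoints of a minimizing sequence are competitors and the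
midpoint hypothesis of the compactness lemma is automatic. -/
theorem exists_isMinimizer (h : Admissible g p C) (hab : a < b) :
    ∃ u, IsMinimizer g p a b u := by
  have hne : (action g p a b '' H01Plus a b).Nonempty :=
    ⟨_, mem_image_of_mem _ (zero_mem_H01Plus hab.le)⟩
  have hseq : ∀ n : ℕ, ∃ w ∈ H01Plus a b,
      action g p a b w < phiPlus g p a b + 1 / ((n : ℝ) + 1) := fun n => by
    obtain ⟨_, ⟨w, hw, rfl⟩, hlt⟩ := exists_lt_of_csInf_lt hne
      (lt_add_of_pos_right (phiPlus g p a b) (Nat.one_div_pos_of_nat (n := n)))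
    exact ⟨w, hw, hlt⟩
  choose w hw hlt using hseq
  have hlim : Tendsto (fun n => action g p a b (w n)) atTop (𝓝 (phiPlus g p a b)) := by
    refine tendsto_of_tendsto_of_tendsto_of_le_of_le tendsto_const_nhds ?_
      (fun n => h.phiPlus_le hab (hw n)) fun n => (hlt n).le
    simpa using (tendsto_one_div_add_atTop_nhds_zero_nat (𝕜 := ℝ)).const_add (phiPlus g p a b)
  suffices hmid : ∀ ε > 0, ∃ N : ℕ, ∀ n ≥ N, ∀ m ≥ N, phiPlus g p a b - ε ≤
      action g p a b (fun t => 1 / 2 * w n t + 1 / 2 * w m t) by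
    obtain ⟨φ, -, v, hv, hJ, -⟩ := h.exists_subseq_limit hab hw hlim hmid
    exact ⟨v, (h.isMinimizer_iff hab).2 ⟨hv, hJ⟩⟩
  · intro ε hε
    refine ⟨0, fun n _ m _ => ?_⟩
    have h1 := (mem_H01Plus_iff hab.le).1 (hw n)
    have h2 := (mem_H01Plus_iff hab.le).1 (hw m)
    have : (fun t => 1 / 2 * w n t + 1 / 2 * w m t) ∈ H01Plus a b := by
      rw [mem_H01Plus_iff hab.le]
      refine ⟨h1.1.lin hab.le h2.1 _ _, by simp [h1.2.1, h2.2.1], by simp [h1.2.2.1, h2.2.2.1],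
        fun t ht => ?_⟩
      have h3 := h1.2.2.2 t ht
      have h4 := h2.2.2.2 t ht
      positivity
    linarith [h.phiPlus_le hab this]

end Admissible

/-! ### Reflection of time -/

section reflection

variable {g p : ℝ → ℝ} {a b C : ℝ} {u : ℝ → ℝ}

theorem IsH1.comp_neg (hab : a ≤ b) (hu : IsH1 a b u) : IsH1 (-b) (-a) (fun t => u (-t)) := by
  have hsq : IntervalIntegrable (fun t => deriv (fun t => u (-t)) t ^ 2) volume (-b) (-a) := by
    have h1 := (IntervalIntegrable.iff_comp_neg (by simp)).1 hu.sq.symm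
    simpa only [deriv_comp_neg, neg_sq] using h1
  refine (IsH1.of_integral (f := deriv fun t => u (-t)) (neg_le_neg hab) ?_ fun t ht => ?_).1
  · rw [memLp_two_iff_integrable_sq (measurable_deriv _).aestronglyMeasurable]
    exact (intervalIntegrable_iff_integrableOn_Ioc_of_le (neg_le_neg hab)).1 hsq
  · simp only [deriv_comp_neg]
    rw [intervalIntegral.integral_neg, intervalIntegral.integral_comp_neg, neg_neg,
      (hu.mono (by linarith [ht.2]) (by linarith [ht.1]) le_rfl).integral_deriv]
    ring

theorem action_comp_neg (g p : ℝ → ℝ) (a b : ℝ) (u : ℝ → ℝ) :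
    action g (fun t => p (-t)) (-b) (-a) (fun t => u (-t)) = action g p a b u := by
  unfold action
  simp only [deriv_comp_neg, neg_sq]
  rw [intervalIntegral.integral_comp_neg
    (fun t => 1 / 2 * deriv u t ^ 2 - primitive g (u t) + p t * u t), neg_neg, neg_neg]

theorem H01Plus_comp_neg (hab : a ≤ b) (hu : u ∈ H01Plus a b) :
    (fun t => u (-t)) ∈ H01Plus (-b) (-a) := by
  rw [mem_H01Plus_iff hab] at hu
  rw [mem_H01Plus_iff (neg_le_neg hab)]
  exact ⟨hu.1.comp_neg hab, by simpa using hu.2.2.1, by simpa using hu.2.1,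
    fun t ht => hu.2.2.2 _ ⟨by linarith [ht.2], by linarith [ht.1]⟩⟩

theorem IsMinimizer.comp_neg (hab : a ≤ b) (hu : IsMinimizer g p a b u) :
    IsMinimizer g (fun t => p (-t)) (-b) (-a) (fun t => u (-t)) := by
  refine ⟨H01Plus_comp_neg hab hu.1, fun v hv => ?_⟩
  have h1 := H01Plus_comp_neg (neg_le_neg hab) hv
  rw [neg_neg, neg_neg] at h1
  have h2 := hu.2 _ h1
  have h3 := action_comp_neg g p a b (fun t => v (-t))
  simp only [neg_neg] at h3
  rw [action_comp_neg, h3]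
  exact h2

theorem IsPositivityThreshold.comp_neg {L : ℝ} (hL : IsPositivityThreshold g p L) :
    IsPositivityThreshold g (fun t => p (-t)) L := by
  refine ⟨hL.1, fun a b hab u hu t ht => ?_⟩
  have h1 := hu.comp_neg (by linarith [hL.1])
  simp only [neg_neg] at h1
  have := hL.2 (-b) (-a) (by linarith) _ h1 (-t) ⟨by linarith [ht.2], by linarith [ht.1]⟩
  simpa using this

theorem Admissible.comp_neg (h : Admissible g p C) : Admissible g (fun t => p (-t)) C :=
  { h with
    p_cont := h.p_cont.comp continuous_neg
    p_bdd := fun t => h.p_bdd (-t) }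

theorem Admissible.phiPlus_comp_neg (h : Admissible g p C) (hab : a < b) :
    phiPlus g (fun t => p (-t)) (-b) (-a) = phiPlus g p a b := by
  obtain ⟨u, hu⟩ := h.exists_isMinimizer hab
  have h1 := ((h.comp_neg).isMinimizer_iff (neg_lt_neg hab)).1 (hu.comp_neg hab.le)
  rw [← h1.2, action_comp_neg, ((h.isMinimizer_iff hab).1 hu).2]

end reflection

/-! ### Positivity of minimizers on long intervals -/

/-- Quantitative form of the existence of the asymptotic average. -/
theorem HasAsymptoticAverage.abs_integral_le {p : ℝ → ℝ} {A C ε : ℝ}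
    (hA : HasAsymptoticAverage p A) (hp : Continuous p) (hC : ∀ t, |p t| ≤ C) (hε : 0 < ε) :
    ∃ D : ℝ, 0 ≤ D ∧ ∀ s t, s ≤ t → |∫ r in s..t, (p r - A)| ≤ ε * (t - s) + D := by
  obtain ⟨T₀, hT₀⟩ := eventually_atTop.1 (Metric.tendstoUniformly_iff.1 hA ε hε)
  have hC0 : 0 ≤ C := (abs_nonneg _).trans (hC 0)
  -- Intervals of length at least `T₁` obey the averaging estimate; the contribution of shorter ones
  -- is absorbed in the constant D. The lower bound 1 keeps the length positive when dividing.
  set T₁ := max T₀ 1 with hT₁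
  refine ⟨(C + |A|) * T₁, by positivity, fun s t hst => ?_⟩
  rcases le_or_gt T₁ (t - s) with h1 | h1
  · have hpos : 0 < t - s := by linarith [le_max_right T₀ 1]
    have h2 := hT₀ (t - s) ((le_max_left _ _).trans h1) s
    rw [add_sub_cancel, Real.dist_eq] at h2
    rw [intervalIntegral.integral_sub (hp.intervalIntegrable _ _) intervalIntegrable_const,
      intervalIntegral.integral_const, smul_eq_mul]
    have h3 : (∫ r in s..t, p r) - (t - s) * A
        = -((t - s) * (A - 1 / (t - s) * ∫ r in s..t, p r)) := by field_simp; ring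
    rw [h3, abs_neg, abs_mul, abs_of_pos hpos]
    have : 0 ≤ (C + |A|) * T₁ := by positivity
    nlinarith
  · have h2 : ‖∫ r in s..t, (p r - A)‖ ≤ (C + |A|) * |t - s| :=
      intervalIntegral.norm_integral_le_of_norm_le_const fun r _ => by
        rw [Real.norm_eq_abs]
        exact (abs_sub _ _).trans (by linarith [hC r])
    rw [abs_of_nonneg (sub_nonneg.2 hst), Real.norm_eq_abs] at h2
    have h3 : (C + |A|) * (t - s) ≤ (C + |A|) * T₁ :=
      mul_le_mul_of_nonneg_left h1.le (by positivity)
    have : 0 ≤ ε * (t - s) := mul_nonneg hε.le (by linarith)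
    linarith

/-- Integration by parts rewrites the ramp-weighted integral as the average over `t` in [x,y] of the
integrals of `q` from `t` to `y`, each of which is at most `D`. -/
theorem integral_mul_ramp_le {q : ℝ → ℝ} {x y D : ℝ} (hq : Continuous q) (hxy : x < y)
    (hD : ∀ s t, s ≤ t → ∫ r in s..t, q r ≤ D) :
    ∫ t in x..y, q t * ((t - x) / (y - x)) ≤ D := by
  have hd : ∀ t ∈ uIcc x y, HasDerivAt (fun t => (t - x) * ∫ r in y..t, q r)
      ((∫ r in y..t, q r) + (t - x) * q t) t := fun t _ => by
    have h1 := intervalIntegral.integral_hasDerivAt_right (hq.intervalIntegrable y t)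
      (hq.stronglyMeasurableAtFilter _ _) hq.continuousAt
    exact (((hasDerivAt_id t).sub_const x).mul h1).congr_deriv (by simp)
  have hQ : Continuous fun t => ∫ r in y..t, q r :=
    intervalIntegral.continuous_primitive (fun _ _ => hq.intervalIntegrable _ _) y
  have h1 := intervalIntegral.integral_eq_sub_of_hasDerivAt hd
    (Continuous.intervalIntegrable (by fun_prop) _ _)
  rw [intervalIntegral.integral_add (hQ.intervalIntegrable _ _)
    (Continuous.intervalIntegrable (by fun_prop) _ _)] at h1
  simp only [intervalIntegral.integral_same, mul_zero, sub_self, zero_mul] at h1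
  have h2 : ∫ _ in x..y, -D ≤ ∫ t in x..y, ∫ r in y..t, q r :=
    intervalIntegral.integral_mono_on hxy.le intervalIntegrable_const
      (hQ.intervalIntegrable _ _) fun t ht => by
        rw [intervalIntegral.integral_symm]
        linarith [hD t y ht.2]
  rw [intervalIntegral.integral_const, smul_eq_mul] at h2
  have h3 : ∫ t in x..y, q t * ((t - x) / (y - x)) = (∫ t in x..y, (t - x) * q t) / (y - x) := by
    rw [← intervalIntegral.integral_div]
    exact intervalIntegral.integral_congr fun t _ => by ring
  rw [h3, div_le_iff₀ (sub_pos.2 hxy)]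
  linarith

namespace Admissible

variable {g p : ℝ → ℝ} {C : ℝ} {a b : ℝ} {u : ℝ → ℝ}

theorem abs_integral_forcing_mul_le (h : Admissible g p C) {x y : ℝ} (hxy : x ≤ y)
    {ρ : ℝ → ℝ} (hρ : ∀ t ∈ Icc x y, 0 ≤ ρ t ∧ ρ t ≤ 1) :
    ∫ t in x..y, (p t - g (u t)) * ρ t ≤ 2 * C * (y - x) := by
  have h1 : ‖∫ t in x..y, (p t - g (u t)) * ρ t‖ ≤ 2 * C * |y - x| :=
    intervalIntegral.norm_integral_le_of_norm_le_const fun t ht => by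
      rw [uIoc_of_le hxy] at ht
      obtain ⟨h2, h3⟩ := hρ t (Ioc_subset_Icc_self ht)
      rw [Real.norm_eq_abs, abs_mul, abs_of_nonneg h2]
      have h4 := h.abs_forcing_le t (u t)
      have := mul_le_mul h4 h3 h2 (by linarith [h.C_nonneg])
      linarith
  rw [abs_of_nonneg (sub_nonneg.2 hxy)] at h1
  exact (le_abs_self _).trans h1

theorem slope_le_add (h : Admissible g p C) {x y z : ℝ} (hu : IsMinimizer g p a b u)
    (hax : a ≤ x) (hxy : x < y) (hyz : y < z) (hzb : z ≤ b) :
    (u z - u y) / (z - y) ≤ (u y - u x) / (y - x) +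
      (∫ t in x..y, (p t - g (u t)) * ((t - x) / (y - x))) + 2 * C * (z - y) := by
  have h1 := h.slope_le hu hax hxy hyz hzb
  have h2 := h.abs_integral_forcing_mul_le (u := u) hyz.le (ρ := fun t => (z - t) / (z - y))
    fun t ht => ⟨div_nonneg (by linarith [ht.2]) (by linarith),
      (div_le_one (by linarith)).2 (by linarith [ht.1])⟩
  linarith

/-- To the right of a point where it is large, a minimizer does not vanish. -/
theorem pos_right_of_large (h : Admissible g p C) (hab : 1 ≤ b - a) {K D : ℝ} (hK : 0 < K)
    (hD0 : 0 ≤ D) (hD : ∀ s t, s ≤ t → ∫ r in s..t, (p r - g K) ≤ D)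
    (hu : IsMinimizer g p a b u) {τ d : ℝ} (hτ : a ≤ τ)
    (hlarge : (2 * K + D + 6 * C + 1) * (b - a) ≤ u τ) (hd : d ∈ Ioo τ b) : 0 < u d := by
  have hab' : a ≤ b := by linarith
  have hu1 := (mem_H01Plus_iff hab').1 hu.1
  have hC := h.C_nonneg
  by_contra hneg
  have hud : u d = 0 := le_antisymm (not_lt.1 hneg)
    (hu1.2.2.2 d ⟨hτ.trans hd.1.le, hd.2.le⟩)
  have hcont := hu1.1.continuousOn hab'
  -- One K is lost in the slope down to the level K, D in the ramp term before σ, and 2C in each of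
  -- at most three terms over lengths at most 1. The other K carries the graph below zero if no zero
  -- occurs within distance 1 of σ.
  set S := 2 * K + D + 6 * C + 1 with hS
  have hcpt : IsCompact (Icc τ d ∩ u ⁻¹' Iic K) := by
    refine isCompact_Icc.of_isClosed_subset ?_ inter_subset_left
    exact (hcont.mono (Icc_subset_Icc hτ hd.2.le)).preimage_isClosed_of_isClosed
      isClosed_Icc isClosed_Iic
  -- σ is the first point after τ where `u` is at most `K`; before it, g(u) ≥ g(K), so the averaged
  -- forcing cannot raise the slope by more than `D`.
  obtain ⟨σ, ⟨hσ1, hσ2⟩, hσ3⟩ := hcpt.exists_isLeast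
    ⟨d, right_mem_Icc.2 hd.1.le, by simp [hud, hK.le]⟩
  have hσK : u σ ≤ K := hσ2
  have hgt : ∀ t ∈ Ico τ σ, K < u t := fun t ht => by
    by_contra hc
    exact absurd (hσ3 ⟨⟨ht.1, ht.2.le.trans hσ1.2⟩, not_lt.1 hc⟩) (not_le.2 ht.2)
  have huτ : K < u τ := by nlinarith
  have hτσ : τ < σ := lt_of_le_of_ne hσ1.1 fun e => by rw [← e] at hσK; linarith
  have hσb : σ < b := hσ1.2.trans_lt hd.2
  have hσ0 := hu1.2.2.2 σ ⟨by linarith, hσb.le⟩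
  have hslope : (u σ - u τ) / (σ - τ) ≤ -(S - K) := by
    rw [div_le_iff₀ (by linarith)]
    have h1 : (S - K) * (σ - τ) ≤ (S - K) * (b - a) :=
      mul_le_mul_of_nonneg_left (by linarith) (by linarith)
    nlinarith
  have hramp : ∫ t in τ..σ, (p t - g (u t)) * ((t - τ) / (σ - τ)) ≤ D := by
    refine le_trans ?_ (integral_mul_ramp_le (q := fun t => p t - g K)
      (h.p_cont.sub continuous_const) hτσ hD)
    have hcs := hcont.mono (Icc_subset_Icc hτ hσb.le)
    refine intervalIntegral.integral_mono_on_of_le_Ioo hτσ.le ?_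
      (Continuous.intervalIntegrable
        ((h.p_cont.sub continuous_const).mul (by fun_prop)) _ _) fun t ht => ?_
    · refine ContinuousOn.intervalIntegrable ?_
      rw [uIcc_of_le hτσ.le]
      exact (h.p_cont.continuousOn.sub (h.g_cont.comp_continuousOn hcs)).mul (by fun_prop)
    · refine mul_le_mul_of_nonneg_right ?_ (div_nonneg (by linarith [ht.1]) (by linarith))
      have := h.g_mono (hgt t (Ioo_subset_Ico_self ht)).le
      linarith
  have stepA : ∀ z, σ < z → z ≤ b → (u z - u σ) / (z - σ) ≤ -(S - K) + D + 2 * C * (z - σ) :=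
    fun z h1 h2 => (h.slope_le_add hu hτ hτσ h1 h2).trans (by linarith)
  set δ := min 1 (b - d) with hδ
  have hδ0 : 0 < δ := lt_min one_pos (by linarith [hd.2])
  have hδ1 : δ ≤ 1 := min_le_left _ _
  have hδb : d + δ ≤ b := by linarith [min_le_right 1 (b - d)]
  -- Just after a zero the mean slope is nonnegative because `u` is. The three cases on the position
  -- of `d` relative to σ and σ + 1 contradict this, or the sign of u(σ + 1).
  have hz0 : 0 ≤ (u (d + δ) - u d) / (d + δ - d) := by
    rw [hud, sub_zero, add_sub_cancel_left]
    exact div_nonneg (hu1.2.2.2 _ ⟨by linarith [hd.1], hδb⟩) hδ0.le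
  rcases eq_or_lt_of_le hσ1.2 with e | hσd
  · have h1 := stepA (d + δ) (by linarith) hδb
    rw [e] at h1
    rw [add_sub_cancel_left] at h1 hz0
    nlinarith
  rcases le_or_gt (σ + 1) d with h1 | h1
  · have h2 := stepA (σ + 1) (by linarith) (by linarith [hd.2])
    rw [add_sub_cancel_left, div_one] at h2
    have h3 := hu1.2.2.2 (σ + 1) ⟨by linarith, by linarith [hd.2]⟩
    linarith
  · have h2 := stepA d hσd hd.2.le
    have h3 := h.slope_le_add hu (hτ.trans hτσ.le) hσd (by linarith : d < d + δ) hδb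
    have h4 := h.abs_integral_forcing_mul_le (u := u) hσd.le (ρ := fun t => (t - σ) / (d - σ))
      fun t ht => ⟨div_nonneg (by linarith [ht.1]) (by linarith),
        (div_le_one (by linarith)).2 (by linarith [ht.2])⟩
    rw [add_sub_cancel_left] at h3 hz0
    have h5 : C * (d - σ) ≤ C := mul_le_of_le_one_right hC (by linarith)
    have h6 : C * δ ≤ C := mul_le_of_le_one_right hC hδ1
    linarith

/-- An upper bound for the minimal energy through a parabolic test function. -/
theorem phiPlus_le_parabola (h : Admissible g p C) (hab : a < b) {A K D κ : ℝ}
    (hκ : κ = g K - A) (hκ0 : 0 < κ)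
    (hD : ∀ s t, s ≤ t → |∫ r in s..t, (p r - A)| ≤ κ / 12 * (t - s) + D) :
    phiPlus g p a b ≤ -(κ ^ 2 / 288) * (b - a) ^ 3 + (K * g K - primitive g K) * (b - a)
      + D * κ / 12 * (b - a) ^ 2 := by
  set l := b - a with hl
  have hl0 : 0 < l := sub_pos.2 hab
  -- With κ = 12m the cubic terms are at most m²/2 (kinetic), m² (oscillation of p) and -2m² (gain
  -- κm/6), which add up to -m²/2 = -κ²/288.
  set m := κ / 12 with hm
  have hm0 : 0 < m := by positivity
  have hD0 : 0 ≤ D := by simpa using (abs_nonneg _).trans (hD 0 0 le_rfl)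
  set v : ℝ → ℝ := fun t => m * ((t - a) * (b - t)) with hv
  have hd : ∀ t, HasDerivAt v (m * (a + b - 2 * t)) t := fun t => by
    have h1 := (((hasDerivAt_id t).sub_const a).mul ((hasDerivAt_id t).const_sub b)).const_mul m
    refine h1.congr_deriv ?_
    simp only [id]
    ring
  have hvH : IsH1 a b v := IsH1.of_hasDerivAt hab.le hd (by fun_prop)
  have hvc : Continuous v := by fun_prop
  have hvm : v ∈ H01Plus a b := by
    rw [mem_H01Plus_iff hab.le]
    refine ⟨hvH, by simp [hv], by simp [hv], fun t ht => ?_⟩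
    exact mul_nonneg hm0.le (mul_nonneg (by linarith [ht.1]) (by linarith [ht.2]))
  refine (h.phiPlus_le hab hvm).trans ?_
  rw [h.action_eq hab.le hvH]
  have hd' : ∀ t ∈ Icc a b, |m * (a + b - 2 * t)| ≤ m * l := fun t ht => by
    rw [abs_mul, abs_of_pos hm0]
    refine mul_le_mul_of_nonneg_left ?_ hm0.le
    rw [abs_le]
    constructor <;> linarith [ht.1, ht.2]
  have hkin : kinetic a b v ≤ m ^ 2 * l ^ 3 := by
    have h1 : kinetic a b v ≤ ∫ _ in a..b, (m * l) ^ 2 := by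
      refine intervalIntegral.integral_mono_on hab.le hvH.sq intervalIntegrable_const
        fun t ht => ?_
      rw [(hd t).deriv, sq_le_sq, abs_of_nonneg (by positivity : 0 ≤ m * l)]
      exact hd' t ht
    rw [intervalIntegral.integral_const, smul_eq_mul, ← hl] at h1
    linarith
  have hE : ∀ t, HasDerivAt (fun t => ∫ r in a..t, (p r - A)) (p t - A) t := fun t =>
    intervalIntegral.integral_hasDerivAt_right
      ((h.p_cont.sub continuous_const).intervalIntegrable _ _)
      ((h.p_cont.sub continuous_const).stronglyMeasurableAtFilter _ _)
      (h.p_cont.sub continuous_const).continuousAt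
  have hEc : Continuous fun t => ∫ r in a..t, (p r - A) :=
    continuous_iff_continuousAt.2 fun t => (hE t).continuousAt
  have hpc := h.p_cont
  -- Integration by parts moves the derivative onto the parabola, leaving the primitive of p - A,
  -- which the asymptotic average controls.
  have hosc : ∫ t in a..b, (p t - A) * v t ≤ (m * l + D) * (m * l) * l := by
    have h1 := intervalIntegral.integral_eq_sub_of_hasDerivAt (a := a) (b := b)
      (fun t _ => (hE t).mul (hd t)) (Continuous.intervalIntegrable (by fun_prop) _ _)
    rw [intervalIntegral.integral_add (Continuous.intervalIntegrable (by fun_prop) _ _)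
      (Continuous.intervalIntegrable (by fun_prop) _ _)] at h1
    have h2 : v b = 0 := by simp [hv]
    simp only [intervalIntegral.integral_same, h2, mul_zero, zero_mul, sub_self,
      Pi.mul_apply] at h1
    have h3 : ‖∫ t in a..b, (∫ r in a..t, (p r - A)) * (m * (a + b - 2 * t))‖ ≤
        (m * l + D) * (m * l) * |b - a| := by
      refine intervalIntegral.norm_integral_le_of_norm_le_const fun t ht => ?_
      rw [uIoc_of_le hab.le] at ht
      rw [Real.norm_eq_abs, abs_mul]
      refine mul_le_mul ((hD a t ht.1.le).trans ?_) (hd' t (Ioc_subset_Icc_self ht))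
        (abs_nonneg _) (by positivity)
      have : m * (t - a) ≤ m * l :=
        mul_le_mul_of_nonneg_left (by linarith [ht.2]) hm0.le
      linarith
    rw [← hl, abs_of_pos hl0, Real.norm_eq_abs] at h3
    linarith [(abs_le.1 h3).1]
  have hvint : ∫ t in a..b, v t = m * l ^ 3 / 6 := by
    have h1 := intervalIntegral.integral_eq_sub_of_hasDerivAt (a := a) (b := b) (f' := v)
      (f := fun t => m * (l * (t - a) ^ 2 / 2 - (t - a) ^ 3 / 3)) (fun t _ => by
        have h2 := ((hasDerivAt_id t).sub_const a).pow 2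
        have h3 := ((hasDerivAt_id t).sub_const a).pow 3
        refine ((((h2.const_mul l).div_const 2).sub (h3.div_const 3)).const_mul m).congr_deriv ?_
        simp only [id, hv, hl]
        push_cast
        ring) (hvc.intervalIntegrable _ _)
    rw [h1]
    simp only [sub_self, ← hl]
    ring
  have hpot : potential g p a b v ≤
      (∫ t in a..b, (p t - A) * v t) - κ * (m * l ^ 3 / 6) + (K * g K - primitive g K) * l := by
    have h1 : potential g p a b v ≤
        ∫ t in a..b, ((p t - A) * v t - κ * v t + (K * g K - primitive g K)) := by
      refine intervalIntegral.integral_mono_on hab.le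
        (h.intervalIntegrable_potential hab.le hvc.continuousOn)
        (Continuous.intervalIntegrable (by fun_prop) _ _) fun t _ => ?_
      have := h.primitive_ge K (v t)
      rw [hκ]
      linarith
    rw [intervalIntegral.integral_add (Continuous.intervalIntegrable (by fun_prop) _ _)
      intervalIntegrable_const, intervalIntegral.integral_sub
      (Continuous.intervalIntegrable (by fun_prop) _ _)
      (Continuous.intervalIntegrable (by fun_prop) _ _),
      intervalIntegral.integral_const_mul, hvint, intervalIntegral.integral_const,
      smul_eq_mul, ← hl] at h1
    linarith
  have e : 1 / 2 * (m ^ 2 * l ^ 3) + ((m * l + D) * (m * l) * l - κ * (m * l ^ 3 / 6)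
      + (K * g K - primitive g K) * l) = -(κ ^ 2 / 288) * l ^ 3 +
      (K * g K - primitive g K) * l + D * κ / 12 * l ^ 2 := by
    rw [hm]; ring
  linarith

/-- On long intervals minimizers are large somewhere. -/
theorem exists_large (h : Admissible g p C) {A K D κ S : ℝ}
    (hκ : κ = g K - A) (hκ0 : 0 < κ) (hS : 0 < S)
    (hD : ∀ s t, s ≤ t → |∫ r in s..t, (p r - A)| ≤ κ / 12 * (t - s) + D) :
    ∃ L : ℝ, 1 ≤ L ∧ ∀ a b u, L ≤ b - a → IsMinimizer g p a b u →
      ∃ τ ∈ Ioo a b, S * (b - a) ≤ u τ := by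
  have hD0 : 0 ≤ D := by simpa using (abs_nonneg _).trans (hD 0 0 le_rfl)
  have hC := h.C_nonneg
  set c₁ := K * g K - primitive g K with hc₁
  have hc₁0 : 0 ≤ c₁ := by
    have := h.primitive_ge K 0
    rw [primitive_zero] at this
    linarith
  -- If u ≤ S l throughout, with l = b - a ≥ 1, then (κ²/288) l³ ≤ Q l²; the chosen length excludes
  -- this.
  set Q := c₁ + D * κ / 12 + 2 * C * S with hQ
  have hQ0 : 0 ≤ Q := by positivity
  refine ⟨288 * Q / κ ^ 2 + 1, by linarith [show 0 ≤ 288 * Q / κ ^ 2 by positivity],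
    fun a b u hL hu => ?_⟩
  have hl1 : 1 ≤ b - a := by linarith [show 0 ≤ 288 * Q / κ ^ 2 by positivity]
  have hab : a < b := by linarith
  have hu1 := (mem_H01Plus_iff hab.le).1 hu.1
  by_contra hcon
  push Not at hcon
  have hsmall : ∀ t ∈ Icc a b, u t ≤ S * (b - a) := fun t ht => by
    rcases eq_or_lt_of_le ht.1 with e | h1
    · rw [← e, hu1.2.1]; positivity
    rcases eq_or_lt_of_le ht.2 with e | h2
    · rw [e, hu1.2.2.1]; positivity
    exact (hcon t ⟨h1, h2⟩).le
  have h1 := h.phiPlus_le_parabola hab hκ hκ0 hD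
  rw [← ((h.isMinimizer_iff hab).1 hu).2, h.action_eq hab.le hu1.1] at h1
  have h2 := kinetic_nonneg hab.le u
  have h3 : ∫ _ in a..b, -(2 * C * (S * (b - a))) ≤ potential g p a b u := by
    refine intervalIntegral.integral_mono_on hab.le intervalIntegrable_const
      (h.intervalIntegrable_potential hab.le (hu1.1.continuousOn hab.le)) fun t ht => ?_
    have h4 := (abs_le.1 (h.abs_potential_integrand_le t (u t))).1
    rw [abs_of_nonneg (hu1.2.2.2 t ht)] at h4
    have h5 := mul_le_mul_of_nonneg_left (hsmall t ht) (by linarith : 0 ≤ 2 * C)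
    linarith
  rw [intervalIntegral.integral_const, smul_eq_mul] at h3
  set l := b - a
  have h4 : κ ^ 2 / 288 * l ^ 3 ≤ c₁ * l + D * κ / 12 * l ^ 2 + 2 * C * S * l ^ 2 := by
    nlinarith
  have h5 : c₁ * l ≤ c₁ * l ^ 2 := mul_le_mul_of_nonneg_left (by nlinarith) hc₁0
  have h6 : κ ^ 2 / 288 * l ^ 3 ≤ Q * l ^ 2 := by rw [hQ]; linarith
  have h7 : κ ^ 2 / 288 * l ≤ Q := by
    refine le_of_mul_le_mul_right ?_ (by positivity : 0 < l ^ 2)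
    linarith
  have h8 : 288 * Q / κ ^ 2 < l := by linarith
  rw [div_lt_iff₀ (by positivity)] at h8
  linarith

theorem exists_isPositivityThreshold (h : Admissible g p C) {A K : ℝ}
    (hA : HasAsymptoticAverage p A) (hK : 0 < K) (hAK : A < g K) :
    ∃ L, IsPositivityThreshold g p L := by
  set κ := g K - A with hκ
  have hκ0 : 0 < κ := sub_pos.2 hAK
  obtain ⟨D, hD0, hD⟩ := hA.abs_integral_le h.p_cont h.p_bdd (by positivity : 0 < κ / 12)
  -- The same `D` bounds the integral of p - g(K) from above, since the drift -κ outweighs the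
  -- growth κ/12.
  have hD' : ∀ s t, s ≤ t → ∫ r in s..t, (p r - g K) ≤ D := fun s t hst => by
    have hpA : Continuous fun r => p r - A := h.p_cont.sub continuous_const
    have e : ∫ r in s..t, (p r - g K) = (∫ r in s..t, (p r - A)) - (t - s) * κ := by
      rw [← smul_eq_mul (t - s), ← intervalIntegral.integral_const, ← intervalIntegral.integral_sub
        (hpA.intervalIntegrable _ _) intervalIntegrable_const]
      exact intervalIntegral.integral_congr fun r _ => by rw [hκ]; ring
    have h1 := (abs_le.1 (hD s t hst)).2
    have h2 : 0 ≤ κ * (t - s) := mul_nonneg hκ0.le (by linarith)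
    rw [e]
    linarith
  have hC := h.C_nonneg
  obtain ⟨L, hL1, hL⟩ := h.exists_large (S := 2 * K + D + 6 * C + 1) hκ hκ0 (by positivity) hD
  refine ⟨L, by linarith, fun a b hab u hu t ht => ?_⟩
  obtain ⟨τ, hτ, hlarge⟩ := hL a b u hab hu
  rcases lt_trichotomy t τ with h1 | h1 | h1
  · have hneg : ∀ s t, s ≤ t → ∫ r in s..t, (p (-r) - g K) ≤ D := fun s t hst => by
      rw [intervalIntegral.integral_comp_neg (fun r => p r - g K)]
      exact hD' _ _ (by linarith)
    have h2 := h.comp_neg.pos_right_of_large (a := -b) (b := -a) (by linarith) hK hD0 hneg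
      (hu.comp_neg (by linarith)) (τ := -τ) (d := -t) (by linarith [hτ.2])
      (by rw [neg_neg]; linarith) ⟨by linarith, by linarith [ht.1]⟩
    simpa using h2
  · rw [h1]
    exact lt_of_lt_of_le (mul_pos (by positivity) (by linarith)) hlarge
  · exact h.pos_right_of_large (by linarith) hK hD0 hD' hu hτ.1.le hlarge ⟨h1, ht.2⟩

end Admissible

/-! ### Regularity of positive minimizers -/

/-- `U` is a `C²` function on the line, with derivative `V`, which extends `u` and satisfies the
Euler-Lagrange equation on `[a,b]`. -/
structure IsC2Extension (g p : ℝ → ℝ) (C a b : ℝ) (u U V : ℝ → ℝ) : Prop where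
  eqOn : EqOn u U (Icc a b)
  hasDerivAt : ∀ t, HasDerivAt U (V t) t
  hasDerivAt_deriv : ∀ t ∈ Icc a b, HasDerivAt V (p t - g (U t)) t
  lipschitz : ∀ s t, |V t - V s| ≤ 2 * C * |t - s|

namespace IsC2Extension

variable {g p : ℝ → ℝ} {C a b : ℝ} {u U V : ℝ → ℝ}

theorem continuous (h : IsC2Extension g p C a b u U V) : Continuous U :=
  continuous_iff_continuousAt.2 fun t => (h.hasDerivAt t).continuousAt

theorem continuous_deriv (h : IsC2Extension g p C a b u U V) : Continuous V := by
  refine (LipschitzWith.of_dist_le_mul (K := (2 * C).toNNReal) fun s t => ?_).continuous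
  rw [Real.dist_eq, Real.dist_eq]
  exact (h.lipschitz t s).trans
    (mul_le_mul_of_nonneg_right (Real.le_coe_toNNReal _) (abs_nonneg _))

theorem deriv_eq (h : IsC2Extension g p C a b u U V) {t : ℝ} (ht : t ∈ Ioo a b) :
    deriv u t = V t := by
  rw [deriv_eq_of_eqOn_Icc h.eqOn ht, (h.hasDerivAt t).deriv]

/-- Mean value theorem together with the Lipschitz bound for `V`. The constant depends only on `C`,
so the expansion is uniform over all intervals and minimizers. -/
theorem taylor (h : IsC2Extension g p C a b u U V) (s t : ℝ) :
    |U t - U s - V s * (t - s)| ≤ 2 * C * (t - s) ^ 2 := by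
  wlog hst : s < t generalizing s t
  · rcases eq_or_lt_of_le (not_lt.1 hst) with e | hlt
    · simp [e]
    obtain ⟨r, hr, hr'⟩ := exists_hasDerivAt_eq_slope U V hlt h.continuous.continuousOn
      fun x _ => h.hasDerivAt x
    have h1 : U t - U s - V s * (t - s) = (V r - V s) * (t - s) := by
      rw [hr']
      have : s - t ≠ 0 := by linarith
      field_simp
      ring
    rw [h1, abs_mul, sq, ← abs_mul_abs_self (t - s), ← mul_assoc]
    refine mul_le_mul_of_nonneg_right ((h.lipschitz s r).trans ?_) (abs_nonneg _)
    have h2 : |r - s| ≤ |t - s| := by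
      rw [abs_of_neg (by linarith [hr.2]), abs_of_neg (by linarith)]
      linarith [hr.1]
    have h3 := (abs_nonneg _).trans (h.lipschitz 0 1)
    exact mul_le_mul_of_nonneg_left h2 (by simpa using h3)
  obtain ⟨r, hr, hr'⟩ := exists_hasDerivAt_eq_slope U V hst h.continuous.continuousOn
    fun x _ => h.hasDerivAt x
  have h1 : U t - U s - V s * (t - s) = (V r - V s) * (t - s) := by
    rw [hr']
    have : t - s ≠ 0 := by linarith
    field_simp
  rw [h1, abs_mul, sq, ← abs_mul_abs_self (t - s), ← mul_assoc]
  refine mul_le_mul_of_nonneg_right ((h.lipschitz s r).trans ?_) (abs_nonneg _)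
  have h2 : |r - s| ≤ |t - s| := by
    rw [abs_of_pos (by linarith [hr.1]), abs_of_pos (by linarith)]
    linarith [hr.2]
  have h3 := (abs_nonneg _).trans (h.lipschitz 0 1)
  exact mul_le_mul_of_nonneg_left h2 (by simpa using h3)

/-- A priori bound on the derivative, when `u` vanishes at the endpoints. -/
theorem abs_deriv_le (h : IsC2Extension g p C a b u U V) (hC : 0 ≤ C) (hab : a < b)
    (ha : u a = 0) (hb : u b = 0) {t : ℝ} (ht : t ∈ Icc a b) : |V t| ≤ 2 * C * (b - a) := by
  rw [h.eqOn (left_mem_Icc.2 hab.le)] at ha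
  rw [h.eqOn (right_mem_Icc.2 hab.le)] at hb
  obtain ⟨c, hc, hc'⟩ := exists_hasDerivAt_eq_zero hab h.continuous.continuousOn (ha.trans hb.symm)
    fun x _ => h.hasDerivAt x
  have h1 := h.lipschitz c t
  rw [hc', sub_zero] at h1
  refine h1.trans (mul_le_mul_of_nonneg_left ?_ (by linarith))
  rw [abs_le]
  constructor <;> linarith [ht.1, ht.2, hc.1, hc.2]

theorem isH1 (h : IsC2Extension g p C a b u U V) {c d : ℝ} (hac : a ≤ c) (hcd : c ≤ d)
    (hdb : d ≤ b) : IsH1 c d u :=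
  (IsH1.of_hasDerivAt hcd h.hasDerivAt h.continuous_deriv).congr hcd
    fun _ ht => (h.eqOn ⟨hac.trans ht.1, ht.2.trans hdb⟩).symm

theorem action_eq (h : IsC2Extension g p C a b u U V) {c d : ℝ} (hac : a ≤ c) (hcd : c ≤ d)
    (hdb : d ≤ b) : action g p c d u =
      ∫ t in c..d, ((1 / 2) * V t ^ 2 - primitive g (U t) + p t * U t) :=
  integral_congr_Ioo hcd fun t ht => by
    have ht' : t ∈ Ioo a b := ⟨hac.trans_lt ht.1, ht.2.trans_le hdb⟩
    rw [h.deriv_eq ht', h.eqOn (Ioo_subset_Icc_self ht')]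

end IsC2Extension

/-- Taylor's formula as a second divided difference. -/
theorem slope_sub_slope_eq {P V f : ℝ → ℝ} (hP : ∀ t, HasDerivAt P (V t) t)
    (hV : ∀ t, HasDerivAt V (f t) t) (hf : Continuous f) {x y z : ℝ} (hxy : x < y) (hyz : y < z) :
    (P z - P y) / (z - y) = (P y - P x) / (y - x) +
      ((∫ t in x..y, f t * ((t - x) / (y - x))) + ∫ t in y..z, f t * ((z - t) / (z - y))) := by
  have hVc : Continuous V := continuous_iff_continuousAt.2 fun t => (hV t).continuousAt
  have h1 : ∫ t in x..y, f t * ((t - x) / (y - x)) = V y - (P y - P x) / (y - x) := by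
    have hd : ∀ t ∈ uIcc x y, HasDerivAt (fun t => (V t * (t - x) - P t) / (y - x))
        (f t * ((t - x) / (y - x))) t := fun t _ => by
      refine ((((hV t).mul ((hasDerivAt_id t).sub_const x)).sub (hP t)).div_const
        (y - x)).congr_deriv ?_
      simp only [id]
      ring
    rw [intervalIntegral.integral_eq_sub_of_hasDerivAt hd
      (Continuous.intervalIntegrable (by fun_prop) _ _)]
    have : y - x ≠ 0 := by linarith
    field_simp
    ring
  have h2 : ∫ t in y..z, f t * ((z - t) / (z - y)) = (P z - P y) / (z - y) - V y := by
    have hd : ∀ t ∈ uIcc y z, HasDerivAt (fun t => (V t * (z - t) + P t) / (z - y))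
        (f t * ((z - t) / (z - y))) t := fun t _ => by
      refine ((((hV t).mul ((hasDerivAt_id t).const_sub z)).add (hP t)).div_const
        (z - y)).congr_deriv ?_
      simp only [id]
      ring
    rw [intervalIntegral.integral_eq_sub_of_hasDerivAt hd
      (Continuous.intervalIntegrable (by fun_prop) _ _)]
    have : z - y ≠ 0 := by linarith
    field_simp
    ring
  rw [h1, h2]
  ring

theorem exists_affine_of_slope_eq {D : ℝ → ℝ} {a b : ℝ} (hab : a < b)
    (hD : ContinuousOn D (Icc a b))
    (h : ∀ x y z, a < x → x < y → y < z → z < b →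
      (D z - D y) / (z - y) = (D y - D x) / (y - x)) :
    ∃ m c, ∀ t ∈ Icc a b, D t = c + m * t := by
  set x := (2 * a + b) / 3 with hx
  set y := (a + 2 * b) / 3 with hy
  have hax : a < x := by rw [hx]; linarith
  have hxy : x < y := by rw [hx, hy]; linarith
  have hyb : y < b := by rw [hy]; linarith
  have hxy' : y - x ≠ 0 := by linarith
  set m := (D y - D x) / (y - x) with hm
  have hmy : D y - D x = m * (y - x) := by rw [hm]; field_simp
  clear_value x y m
  refine ⟨m, D x - m * x, ?_⟩
  have hIoo : EqOn D (fun t => (D x - m * x) + m * t) (Ioo a b) := by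
    intro t ht
    simp only
    rcases lt_trichotomy t x with h1 | h1 | h1
    · have h2 := h t x y ht.1 h1 hxy hyb
      rw [← hm, eq_div_iff (by linarith)] at h2
      linarith
    · rw [h1]; ring
    rcases lt_trichotomy t y with h3 | h3 | h3
    · have h2 := h x t y hax h1 h3 hyb
      have h4 : D t - D x = (D t - D x) / (t - x) * (t - x) := by
        have : t - x ≠ 0 := by linarith
        field_simp
      have h5 : D y - D t = (D y - D t) / (y - t) * (y - t) := by
        have : y - t ≠ 0 := by linarith
        field_simp
      rw [h2] at h5
      set k := (D t - D x) / (t - x)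
      have h6 : k = m := by
        have : (k - m) * (y - x) = 0 := by linarith
        rcases mul_eq_zero.1 this with h7 | h7
        · linarith
        · exact absurd h7 hxy'
      rw [h6] at h4
      linarith
    · rw [h3]; linarith
    · have h2 := h x y t hax hxy h3 ht.2
      rw [← hm, div_eq_iff (by linarith)] at h2
      linarith
  have := hIoo.of_subset_closure hD (by fun_prop) Ioo_subset_Icc_self
    (by rw [closure_Ioo hab.ne])
  exact fun t ht => this ht

/-- The endpoints are the last zero before `t₀` and the first zero after it; a nonpositive value in
between would produce a closer zero by the intermediate value theorem. -/
theorem exists_component {d : ℝ → ℝ} {a b t₀ : ℝ} (hd : ContinuousOn d (Icc a b))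
    (ha : d a = 0) (hb : d b = 0) (ht₀ : t₀ ∈ Icc a b) (hpos : 0 < d t₀) :
    ∃ t₁ t₂, a ≤ t₁ ∧ t₁ < t₂ ∧ t₂ ≤ b ∧ d t₁ = 0 ∧ d t₂ = 0 ∧ ∀ t ∈ Ioo t₁ t₂, 0 < d t := by
  have hc : ∀ x y, a ≤ x → y ≤ b → IsCompact (Icc x y ∩ d ⁻¹' {0}) := fun x y hx hy =>
    isCompact_Icc.of_isClosed_subset ((hd.mono (Icc_subset_Icc hx hy)).preimage_isClosed_of_isClosed
      isClosed_Icc isClosed_singleton) inter_subset_left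
  obtain ⟨t₁, ⟨h1, h1z⟩, h1g⟩ := (hc a t₀ le_rfl ht₀.2).exists_isGreatest
    ⟨a, left_mem_Icc.2 ht₀.1, ha⟩
  obtain ⟨t₂, ⟨h2, h2z⟩, h2l⟩ := (hc t₀ b ht₀.1 le_rfl).exists_isLeast
    ⟨b, right_mem_Icc.2 ht₀.2, hb⟩
  have h1z' : d t₁ = 0 := h1z
  have h2z' : d t₂ = 0 := h2z
  have h1lt : t₁ < t₀ := lt_of_le_of_ne h1.2 fun e => by rw [← e, h1z'] at hpos; exact hpos.false
  have h2lt : t₀ < t₂ := lt_of_le_of_ne h2.1 fun e => by rw [e, h2z'] at hpos; exact hpos.false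
  refine ⟨t₁, t₂, h1.1, h1lt.trans h2lt, h2.2, h1z', h2z', fun t ht => ?_⟩
  by_contra hneg
  rcases le_total t t₀ with hle | hle
  · obtain ⟨s, hs, hs'⟩ := intermediate_value_Icc hle
      (hd.mono (Icc_subset_Icc (h1.1.trans ht.1.le) ht₀.2)) ⟨not_lt.1 hneg, hpos.le⟩
    exact absurd (h1g ⟨⟨h1.1.trans (ht.1.le.trans hs.1), hs.2⟩, hs'⟩)
      (not_le.2 (ht.1.trans_le hs.1))
  · obtain ⟨s, hs, hs'⟩ := intermediate_value_Icc' hle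
      (hd.mono (Icc_subset_Icc ht₀.1 (ht.2.le.trans h2.2))) ⟨not_lt.1 hneg, hpos.le⟩
    exact absurd (h2l ⟨⟨hs.1, hs.2.trans (ht.2.le.trans h2.2)⟩, hs'⟩)
      (not_le.2 (hs.2.trans_lt ht.2))

namespace Admissible

variable {g p : ℝ → ℝ} {C : ℝ} {a b : ℝ} {u v : ℝ → ℝ}

/-- Regularity of positive minimizers. -/
theorem exists_isC2Extension (h : Admissible g p C) (hab : a < b) (hu : IsMinimizer g p a b u)
    (hpos : ∀ t ∈ Ioo a b, 0 < u t) : ∃ U V, IsC2Extension g p C a b u U V := by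
  have hu1 := (mem_H01Plus_iff hab.le).1 hu.1
  have hcu := hu1.1.continuousOn hab.le
  -- Freezing `u` outside [a,b] at its endpoint values makes `f` continuous on the whole line, so
  -- its double primitive `P` is globally C².
  set f : ℝ → ℝ := fun t => p t - g (u (projIcc a b hab.le t)) with hf
  have hfc : Continuous f := by
    refine h.p_cont.sub (h.g_cont.comp ?_)
    exact hcu.comp_continuous (continuous_subtype_val.comp continuous_projIcc)
      fun t => (projIcc a b hab.le t).2
  have hfe : ∀ t ∈ Icc a b, f t = p t - g (u t) := fun t ht => by
    simp only [hf, projIcc_of_mem hab.le ht]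
  have hfb : ∀ t, |f t| ≤ 2 * C := fun t => h.abs_forcing_le _ _
  set W : ℝ → ℝ := fun t => ∫ s in a..t, f s with hW
  have hWd : ∀ t, HasDerivAt W (f t) t := fun t =>
    intervalIntegral.integral_hasDerivAt_right (hfc.intervalIntegrable _ _)
      (hfc.stronglyMeasurableAtFilter _ _) hfc.continuousAt
  have hWc : Continuous W := continuous_iff_continuousAt.2 fun t => (hWd t).continuousAt
  set P : ℝ → ℝ := fun t => ∫ s in a..t, W s with hP
  have hPd : ∀ t, HasDerivAt P (W t) t := fun t =>
    intervalIntegral.integral_hasDerivAt_right (hWc.intervalIntegrable _ _)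
      (hWc.stronglyMeasurableAtFilter _ _) hWc.continuousAt
  have hPc : Continuous P := continuous_iff_continuousAt.2 fun t => (hPd t).continuousAt
  -- `u` and `P` have the same second divided differences, so u - P is affine.
  obtain ⟨m, c, hmc⟩ := exists_affine_of_slope_eq (D := fun t => u t - P t) hab
    (hcu.sub hPc.continuousOn) fun x y z hax hxy hyz hzb => by
      have h1 := h.slope_eq_of_pos hu hpos hax hxy hyz hzb
      have h2 := slope_sub_slope_eq hPd hWd hfc hxy hyz
      have e1 : ∫ t in x..y, f t * ((t - x) / (y - x)) =
          ∫ t in x..y, (p t - g (u t)) * ((t - x) / (y - x)) :=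
        integral_congr_Ioo hxy.le fun t ht => by rw [hfe t ⟨by linarith [ht.1], by linarith [ht.2]⟩]
      have e2 : ∫ t in y..z, f t * ((z - t) / (z - y)) =
          ∫ t in y..z, (p t - g (u t)) * ((z - t) / (z - y)) :=
        integral_congr_Ioo hyz.le fun t ht => by rw [hfe t ⟨by linarith [ht.1], by linarith [ht.2]⟩]
      rw [e1, e2] at h2
      have h3 : ∀ s t : ℝ, (u t - P t - (u s - P s)) / (t - s) =
          (u t - u s) / (t - s) - (P t - P s) / (t - s) := fun s t => by ring
      rw [h3, h3, h1, h2]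
      ring
  have heq : EqOn u (fun t => P t + (c + m * t)) (Icc a b) := fun t ht => by
    have := hmc t ht
    simp only at this ⊢
    linarith
  refine ⟨fun t => P t + (c + m * t), fun t => W t + m, heq, fun t => ?_, fun t ht => ?_,
    fun s t => ?_⟩
  · exact ((hPd t).add (((hasDerivAt_id t).const_mul m).const_add c)).congr_deriv (by simp)
  · have h1 := (hWd t).add_const m
    have h2 : P t + (c + m * t) = u t := (heq ht).symm
    rw [hfe t ht] at h1
    simp only [h2]
    exact h1
  · rw [add_sub_add_right_eq_sub, intervalIntegral.integral_interval_sub_left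
      (hfc.intervalIntegrable _ _) (hfc.intervalIntegrable _ _), ← Real.norm_eq_abs]
    exact intervalIntegral.norm_integral_le_of_norm_le_const fun r _ => hfb r

/-! ### Comparison and uniqueness -/

/-- Restrictions of minimizers are minimizers for their boundary values. -/
theorem action_le_of_eq_endpoints (h : Admissible g p C) {c d : ℝ} (hac : a ≤ c) (hcd : c ≤ d)
    (hdb : d ≤ b) (hu : IsMinimizer g p a b u) (hv : IsH1 c d v) (hvc : v c = u c)
    (hvd : v d = u d) (hv0 : ∀ t ∈ Icc c d, 0 ≤ v t) :
    action g p c d u ≤ action g p c d v := by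
  have hab : a ≤ b := by linarith
  have hu1 := (mem_H01Plus_iff hab).1 hu.1
  have hw1 := IsH1.glue hac hcd (hu1.1.mono le_rfl hac (by linarith)) hv hvc.symm
  set w₁ : ℝ → ℝ := fun t => if t ≤ c then u t else v t with hw₁
  have hw1d : w₁ d = u d := by
    by_cases hdc : d ≤ c
    · simp [hw₁, hdc]
    · simp [hw₁, hdc, hvd]
  have hw2 := IsH1.glue (hac.trans hcd) hdb hw1 (hu1.1.mono (by linarith) hdb le_rfl) hw1d
  set w : ℝ → ℝ := fun t => if t ≤ d then w₁ t else u t with hw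
  have e1 : EqOn w u (Icc a c) := fun t ht => by simp [hw, hw₁, ht.2, ht.2.trans hcd]
  have e2 : EqOn w v (Icc c d) := fun t ht => by
    rcases eq_or_lt_of_le ht.1 with e | hlt
    · simp [hw, hw₁, ← e, hcd, hvc]
    · simp [hw, hw₁, ht.2, not_le.2 hlt]
  have e3 : EqOn w u (Icc d b) := fun t ht => by
    rcases eq_or_lt_of_le ht.1 with e | hlt
    · simp [hw, ← e, hw1d]
    · simp [hw, not_le.2 hlt]
  have hmem : w ∈ H01Plus a b := by
    rw [mem_H01Plus_iff hab]
    refine ⟨hw2, by rw [e1 (left_mem_Icc.2 hac), hu1.2.1],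
      by rw [e3 (right_mem_Icc.2 hdb), hu1.2.2.1], fun t ht => ?_⟩
    rcases le_total t c with h1 | h1
    · rw [e1 ⟨ht.1, h1⟩]; exact hu1.2.2.2 t ht
    rcases le_total t d with h2 | h2
    · rw [e2 ⟨h1, h2⟩]; exact hv0 t ⟨h1, h2⟩
    · rw [e3 ⟨h2, ht.2⟩]; exact hu1.2.2.2 t ht
  have h1 := hu.2 w hmem
  rw [h.action_add hac (hcd.trans hdb) hw2, h.action_add hcd hdb (hw2.mono hac (by linarith) le_rfl),
    h.action_add hac (hcd.trans hdb) hu1.1,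
    h.action_add hcd hdb (hu1.1.mono hac (by linarith) le_rfl),
    action_congr g p hac e1, action_congr g p hcd e2, action_congr g p hdb e3] at h1
  linarith

/-- Two ordered solutions with the same boundary values: the larger one has smaller action. -/
theorem action_lt_of_lt (h : Admissible g p C) {c d : ℝ} (hac : a ≤ c) (hcd : c < d)
    (hdb : d ≤ b) {U₁ V₁ U₂ V₂ : ℝ → ℝ} (hu : IsC2Extension g p C a b u U₁ V₁)
    (hv : IsC2Extension g p C a b v U₂ V₂) (hc : u c = v c) (hd : u d = v d)
    (hpos : ∀ t ∈ Ioo c d, 0 < u t) (hlt : ∀ t ∈ Ioo c d, u t < v t) :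
    action g p c d v < action g p c d u := by
  have hmem : ∀ t ∈ Icc c d, t ∈ Icc a b := fun t ht => ⟨hac.trans ht.1, ht.2.trans hdb⟩
  have hU1 := hu.continuous
  have hU2 := hv.continuous
  have hV1 := hu.continuous_deriv
  have hV2 := hv.continuous_deriv
  have hG := continuous_primitive h.g_cont
  have hp := h.p_cont
  have hg := h.g_cont
  rw [hu.action_eq hac hcd.le hdb, hv.action_eq hac hcd.le hdb, ← sub_pos,
    ← intervalIntegral.integral_sub (Continuous.intervalIntegrable (by fun_prop) _ _)
      (Continuous.intervalIntegrable (by fun_prop) _ _)]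
  -- This function vanishes at both ends, so its derivative can be added to the integrand freely. It
  -- cancels the kinetic terms and leaves exactly the error of the trapezoidal rule for `g` between
  -- the two solutions.
  have hder : ∀ t ∈ uIcc c d, HasDerivAt (fun t => (V₁ t + V₂ t) / 2 * (U₂ t - U₁ t))
      ((p t - (g (U₁ t) + g (U₂ t)) / 2) * (U₂ t - U₁ t) + (V₂ t ^ 2 - V₁ t ^ 2) / 2) t := by
    intro t ht
    rw [uIcc_of_le hcd.le] at ht
    refine ((((hu.hasDerivAt_deriv t (hmem t ht)).add
      (hv.hasDerivAt_deriv t (hmem t ht))).div_const 2).mul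
      ((hv.hasDerivAt t).sub (hu.hasDerivAt t))).congr_deriv ?_
    simp only [Pi.add_apply, Pi.sub_apply]
    ring
  have hFTC := intervalIntegral.integral_eq_sub_of_hasDerivAt hder
    (Continuous.intervalIntegrable (by fun_prop) _ _)
  have hc' : U₂ c - U₁ c = 0 := by
    rw [← hu.eqOn (hmem c (left_mem_Icc.2 hcd.le)), ← hv.eqOn (hmem c (left_mem_Icc.2 hcd.le)), hc,
      sub_self]
  have hd' : U₂ d - U₁ d = 0 := by
    rw [← hu.eqOn (hmem d (right_mem_Icc.2 hcd.le)), ← hv.eqOn (hmem d (right_mem_Icc.2 hcd.le)),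
      hd, sub_self]
  rw [hc', hd', mul_zero, mul_zero, sub_self] at hFTC
  have hi : IntervalIntegrable (fun t => (1 / 2 * V₁ t ^ 2 - primitive g (U₁ t) + p t * U₁ t) -
      (1 / 2 * V₂ t ^ 2 - primitive g (U₂ t) + p t * U₂ t)) volume c d :=
    Continuous.intervalIntegrable (by fun_prop) _ _
  have hj : IntervalIntegrable (fun t => (p t - (g (U₁ t) + g (U₂ t)) / 2) * (U₂ t - U₁ t) +
      (V₂ t ^ 2 - V₁ t ^ 2) / 2) volume c d := Continuous.intervalIntegrable (by fun_prop) _ _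
  have hsum := intervalIntegral.integral_add hi hj
  rw [hFTC, add_zero] at hsum
  rw [← hsum]
  refine intervalIntegral.intervalIntegral_pos_of_pos_on (hi.add hj) (fun t ht => ?_) hcd
  have ht' := hmem t (Ioo_subset_Icc_self ht)
  have h1 := hpos t ht
  have h2 := hlt t ht
  rw [hu.eqOn ht'] at h1 h2
  rw [hv.eqOn ht'] at h2
  have h3 := h.trapezoid_lt h1 h2
  nlinarith

/-- On a component of {u < v} the larger function has strictly smaller action, whereas minimality of
`u` forbids any gain from pasting `v` into it. Exchanging the roles of the two gives uniqueness. -/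
theorem not_lt_of_isMinimizer (h : Admissible g p C) (hab : a < b)
    (hu : IsMinimizer g p a b u) (hv : IsMinimizer g p a b v)
    (hupos : ∀ t ∈ Ioo a b, 0 < u t) (hvpos : ∀ t ∈ Ioo a b, 0 < v t)
    {t : ℝ} (ht : t ∈ Icc a b) : ¬ u t < v t := by
  intro hlt
  have hu1 := (mem_H01Plus_iff hab.le).1 hu.1
  have hv1 := (mem_H01Plus_iff hab.le).1 hv.1
  obtain ⟨c, d, hac, hcd, hdb, hc, hd, hpos⟩ := exists_component (d := fun t => v t - u t)
    ((hv1.1.continuousOn hab.le).sub (hu1.1.continuousOn hab.le)) (by simp [hu1.2.1, hv1.2.1])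
    (by simp [hu1.2.2.1, hv1.2.2.1]) ht (sub_pos.2 hlt)
  obtain ⟨U₁, V₁, hU⟩ := h.exists_isC2Extension hab hu hupos
  obtain ⟨U₂, V₂, hV⟩ := h.exists_isC2Extension hab hv hvpos
  have h1 := h.action_lt_of_lt hac hcd hdb hU hV (sub_eq_zero.1 hc).symm (sub_eq_zero.1 hd).symm
    (fun t ht => hupos t ⟨hac.trans_lt ht.1, ht.2.trans_le hdb⟩) fun t ht => sub_pos.1 (hpos t ht)
  have h2 := h.action_le_of_eq_endpoints hac hcd.le hdb hu (hV.isH1 hac hcd.le hdb)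
    (sub_eq_zero.1 hc) (sub_eq_zero.1 hd)
    fun t ht => hv1.2.2.2 t ⟨hac.trans ht.1, ht.2.trans hdb⟩
  linarith

/-- Uniqueness of minimizers when all of them are positive. -/
theorem eqOn_of_isMinimizer (h : Admissible g p C) (hab : a < b)
    (hu : IsMinimizer g p a b u) (hv : IsMinimizer g p a b v)
    (hupos : ∀ t ∈ Ioo a b, 0 < u t) (hvpos : ∀ t ∈ Ioo a b, 0 < v t) : EqOn v u (Icc a b) :=
  fun _ ht => le_antisymm (not_lt.1 (h.not_lt_of_isMinimizer hab hu hv hupos hvpos ht))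
    (not_lt.1 (h.not_lt_of_isMinimizer hab hv hu hvpos hupos ht))

end Admissible

/-! ### Energy estimates for a moving endpoint -/

/-- A minimizer, positive in the interior, together with its `C²` extension. -/
structure IsPositiveMinimizer (g p : ℝ → ℝ) (C a b : ℝ) (u U V : ℝ → ℝ) : Prop where
  isMinimizer : IsMinimizer g p a b u
  pos : ∀ t ∈ Ioo a b, 0 < u t
  ext : IsC2Extension g p C a b u U V

section reflection

variable {g p : ℝ → ℝ} {C a b : ℝ} {u U V : ℝ → ℝ}

theorem IsC2Extension.comp_neg (h : IsC2Extension g p C a b u U V) :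
    IsC2Extension g (fun t => p (-t)) C (-b) (-a) (fun t => u (-t)) (fun t => U (-t))
      (fun t => -V (-t)) where
  eqOn t ht := h.eqOn ⟨by linarith [ht.2], by linarith [ht.1]⟩
  hasDerivAt t := ((h.hasDerivAt (-t)).comp t (hasDerivAt_neg t)).congr_deriv (by ring)
  hasDerivAt_deriv t ht := (((h.hasDerivAt_deriv (-t) ⟨by linarith [ht.2], by linarith [ht.1]⟩).comp
    t (hasDerivAt_neg t)).neg).congr_deriv (by ring)
  lipschitz s t := by
    have h1 := h.lipschitz (-t) (-s)
    rwa [show -V (-t) - -V (-s) = V (-s) - V (-t) by ring, show t - s = -s - -t by ring]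

theorem IsPositiveMinimizer.comp_neg (hab : a ≤ b) (h : IsPositiveMinimizer g p C a b u U V) :
    IsPositiveMinimizer g (fun t => p (-t)) C (-b) (-a) (fun t => u (-t)) (fun t => U (-t))
      (fun t => -V (-t)) where
  isMinimizer := h.isMinimizer.comp_neg hab
  pos t ht := h.pos _ ⟨by linarith [ht.2], by linarith [ht.1]⟩
  ext := h.ext.comp_neg

end reflection

namespace Admissible

variable {g p : ℝ → ℝ} {C : ℝ} {a b : ℝ} {u U V : ℝ → ℝ}

theorem abs_potential_le (h : Admissible g p C) (hab : a ≤ b)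
    (hu : ContinuousOn u (Icc a b)) {B : ℝ} (hB : ∀ t ∈ Icc a b, |u t| ≤ B) :
    |potential g p a b u| ≤ 2 * C * B * (b - a) := by
  have h1 := h.abs_potential_sub_le hab hu (v := fun _ => 0) continuousOn_const (r := B)
    (by simpa using hB)
  simpa [potential, primitive_zero] using h1

/-- Moving the right endpoint: upper bound for the minimal energy, obtained by replacing a
minimizer near the endpoint by an affine function. -/
theorem phiPlus_right_le (h : Admissible g p C) (hab : a < b)
    (hu : IsPositiveMinimizer g p C a b u U V) {M r e : ℝ} (hM : 2 * C * (b - a) ≤ M)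
    (hr0 : 0 < r) (hr : r ≤ 1 / 2) (hrb : r ^ 2 ≤ b - a) (he : |e| = r ^ 3) (hbe : a < b + e) :
    phiPlus g p a (b + e) ≤
      phiPlus g p a b - 1 / 2 * V b ^ 2 * e + (M ^ 2 + 6 * C * M) * r ^ 4 := by
  have hC := h.C_nonneg
  have hM0 : 0 ≤ M := (mul_nonneg (by linarith) (by linarith)).trans hM
  have hu1 := (mem_H01Plus_iff hab.le).1 hu.isMinimizer.1
  have hV : ∀ t ∈ Icc a b, |V t| ≤ M := fun t ht =>
    (hu.ext.abs_deriv_le hC hab hu1.2.1 hu1.2.2.1 ht).trans hM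
  -- The final piece has length δ = r² and the displacement is |e| = r³: the potential terms O(δ²)
  -- and the kinetic error O(e²/δ) are then both O(r⁴), which is o(|e|).
  set δ := r ^ 2 with hδ
  have hδ0 : 0 < δ := by positivity
  have hδ1 : δ ≤ 1 / 4 := by nlinarith
  have heδ : |e| ≤ δ / 2 := by rw [he, hδ]; nlinarith
  obtain ⟨he1, he2⟩ := abs_le.1 heδ
  have hbδ : b - δ ∈ Icc a b := ⟨by linarith, by linarith⟩
  have hbb : b ∈ Icc a b := right_mem_Icc.2 hab.le
  have hUb : U b = 0 := by rw [← hu.ext.eqOn hbb, hu1.2.2.1]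
  have hsmall : ∀ t ∈ Icc (b - δ) b, |u t| ≤ M * δ := by
    intro t ht
    have ht' : t ∈ Icc a b := ⟨hbδ.1.trans ht.1, ht.2⟩
    rcases eq_or_lt_of_le ht.2 with e | hlt
    · rw [e, hu1.2.2.1, abs_zero]; positivity
    obtain ⟨s, hs, hs'⟩ := exists_hasDerivAt_eq_slope U V hlt hu.ext.continuous.continuousOn
      fun x _ => hu.ext.hasDerivAt x
    have h1 := hV s ⟨ht'.1.trans hs.1.le, hs.2.le⟩
    rw [hs', hUb, zero_sub, abs_div, abs_neg, abs_of_pos (sub_pos.2 hlt),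
      div_le_iff₀ (sub_pos.2 hlt)] at h1
    rw [hu.ext.eqOn ht']
    exact h1.trans (mul_le_mul_of_nonneg_left (by linarith [ht.1]) hM0)
  set x := u (b - δ) with hx
  -- `q` is minus the mean slope of `u` on the discarded piece; Taylor's formula at `b` puts it
  -- within O(δ) of -V(b).
  set q := x / δ with hq
  have hxq : x = q * δ := by rw [hq]; field_simp
  have hx0 : 0 ≤ x := hu1.2.2.2 _ hbδ
  have hq0 : 0 ≤ q := div_nonneg hx0 hδ0.le
  have hxM : x ≤ M * δ := (le_abs_self _).trans (hsmall _ ⟨le_rfl, by linarith⟩)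
  have hqM : q ≤ M := (div_le_iff₀ hδ0).2 hxM
  have hqV : |q + V b| ≤ 2 * C * δ := by
    have h1 := hu.ext.taylor b (b - δ)
    rw [hUb, ← hu.ext.eqOn hbδ, ← hx, hxq,
      show q * δ - 0 - V b * (b - δ - b) = (q + V b) * δ by ring, abs_mul, abs_of_pos hδ0,
      show 2 * C * (b - δ - b) ^ 2 = 2 * C * δ * δ by ring] at h1
    exact le_of_mul_le_mul_right h1 hδ0
  have hs0 : 0 < δ + e := by linarith
  set lin : ℝ → ℝ := fun t => x / (δ + e) * (b + e - t) with hlin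
  have hld : ∀ t, HasDerivAt lin (-(x / (δ + e))) t := fun t =>
    (((hasDerivAt_id t).const_sub (b + e)).const_mul (x / (δ + e))).congr_deriv (by ring)
  have hle : b - δ ≤ b + e := by linarith
  have hlH : IsH1 (b - δ) (b + e) lin := IsH1.of_hasDerivAt hle hld continuous_const
  have hlx : lin (b - δ) = x := by
    simp only [hlin]; field_simp; ring
  have hl0 : ∀ t ∈ Icc (b - δ) (b + e), 0 ≤ lin t ∧ lin t ≤ x := fun t ht => by
    have hk : 0 ≤ x / (δ + e) := div_nonneg hx0 hs0.le
    refine ⟨mul_nonneg hk (by linarith [ht.2]), ?_⟩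
    rw [← hlx]
    exact mul_le_mul_of_nonneg_left (by linarith [ht.1]) hk
  have hwH := IsH1.glue hbδ.1 hle (hu1.1.mono le_rfl hbδ.1 hbδ.2) hlH hlx.symm
  set w : ℝ → ℝ := fun t => if t ≤ b - δ then u t else lin t with hw
  have e1 : EqOn w u (Icc a (b - δ)) := fun t ht => by simp [hw, ht.2]
  have e2 : EqOn w lin (Icc (b - δ) (b + e)) := fun t ht => by
    rcases eq_or_lt_of_le ht.1 with e | hlt
    · simp [hw, ← e, hlx, hx]
    · simp [hw, not_le.2 hlt]
  have hwm : w ∈ H01Plus a (b + e) := by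
    rw [mem_H01Plus_iff hbe.le]
    refine ⟨hwH, by rw [e1 (left_mem_Icc.2 hbδ.1), hu1.2.1], ?_, fun t ht => ?_⟩
    · rw [e2 (right_mem_Icc.2 hle)]; simp [hlin]
    · rcases le_total t (b - δ) with h1 | h1
      · rw [e1 ⟨ht.1, h1⟩]; exact hu1.2.2.2 t ⟨ht.1, h1.trans hbδ.2⟩
      · rw [e2 ⟨h1, ht.2⟩]; exact (hl0 t ⟨h1, ht.2⟩).1
  have h1 := h.phiPlus_le hbe hwm
  rw [h.action_add hbδ.1 hle hwH, action_congr g p hbδ.1 e1, action_congr g p hle e2,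
    h.action_eq hle hlH] at h1
  have h2 := ((h.isMinimizer_iff hab).1 hu.isMinimizer).2
  have huH := hu1.1.mono hbδ.1 hbδ.2 le_rfl
  rw [h.action_add hbδ.1 hbδ.2 hu1.1, h.action_eq hbδ.2 huH] at h2
  have hk1 : kinetic (b - δ) (b + e) lin = x ^ 2 / (δ + e) := by
    unfold kinetic
    simp only [(hld _).deriv]
    rw [intervalIntegral.integral_const, smul_eq_mul]
    field_simp
    ring
  -- Cauchy-Schwarz: the discarded piece costs at least the kinetic integral of the affine function
  -- with the same end values.
  have hk2 : x ^ 2 / δ ≤ kinetic (b - δ) b u := by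
    have h3 := huH.sq_sub_le hbδ.2
    rw [hu1.2.2.1, ← hx, zero_sub, neg_sq, sub_sub_cancel] at h3
    rw [div_le_iff₀ hδ0, mul_comm]
    exact h3
  have hp1 := (abs_le.1 (h.abs_potential_le hle (hlH.continuousOn hle) (B := x) fun t ht => by
    rw [abs_of_nonneg (hl0 t ht).1]; exact (hl0 t ht).2)).2
  have hp2 := (abs_le.1 (h.abs_potential_le hbδ.2 (huH.continuousOn hbδ.2) hsmall)).1
  have hp1' : potential g p (b - δ) (b + e) lin ≤ 3 * C * M * δ ^ 2 := by
    refine hp1.trans ?_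
    have h3 : x * (δ + e) ≤ M * δ * (3 / 2 * δ) :=
      mul_le_mul hxM (by linarith) hs0.le (by positivity)
    have h4 := mul_le_mul_of_nonneg_left h3 (by linarith : 0 ≤ 2 * C)
    linarith
  have hp2' : -(2 * C * M * δ ^ 2) ≤ potential g p (b - δ) b u := by
    refine le_trans (le_of_eq ?_) hp2
    ring
  have hkin : 1 / 2 * (x ^ 2 / (δ + e)) - 1 / 2 * (x ^ 2 / δ) ≤
      -(1 / 2 * V b ^ 2 * e) + (M ^ 2 + C * M) * r ^ 4 := by
    have h3 : 1 / 2 * (x ^ 2 / (δ + e)) - 1 / 2 * (x ^ 2 / δ) =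
        -(1 / 2 * q ^ 2 * e) + 1 / 2 * q ^ 2 * (e ^ 2 / (δ + e)) := by
      rw [hxq]
      field_simp
      ring
    have h4 : e ^ 2 / (δ + e) ≤ 2 * r ^ 4 := by
      rw [div_le_iff₀ hs0, ← sq_abs, he]
      have : r ^ 4 * (δ / 2) ≤ r ^ 4 * (δ + e) :=
        mul_le_mul_of_nonneg_left (by linarith) (by positivity)
      rw [hδ] at this
      rw [hδ]
      linarith
    have h5 : 1 / 2 * q ^ 2 * (e ^ 2 / (δ + e)) ≤ M ^ 2 * r ^ 4 := by
      have h6 : q ^ 2 ≤ M ^ 2 := pow_le_pow_left₀ hq0 hqM 2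
      have := mul_le_mul h6 h4 (div_nonneg (sq_nonneg e) hs0.le) (sq_nonneg M)
      linarith
    have h7 : |V b ^ 2 - q ^ 2| ≤ 4 * C * M * δ := by
      rw [show V b ^ 2 - q ^ 2 = (q + V b) * (V b - q) by ring, abs_mul]
      have h8 : |V b - q| ≤ 2 * M := by
        have h9 := abs_le.1 (hV b hbb)
        rw [abs_le]
        constructor <;> linarith
      have := mul_le_mul hqV h8 (abs_nonneg _) (by positivity)
      linarith
    have h10 : (V b ^ 2 - q ^ 2) * e ≤ 4 * C * M * δ * r ^ 3 := by
      refine (le_abs_self _).trans ?_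
      rw [abs_mul, he]
      exact mul_le_mul_of_nonneg_right h7 (by positivity)
    have h11 : 4 * C * M * δ * r ^ 3 ≤ 2 * C * M * r ^ 4 := by
      have h12 : 4 * C * M * δ * r ^ 3 = 4 * C * M * r ^ 4 * r := by rw [hδ]; ring
      rw [h12]
      have : 4 * C * M * r ^ 4 * r ≤ 4 * C * M * r ^ 4 * (1 / 2) :=
        mul_le_mul_of_nonneg_left hr (by positivity)
      linarith
    rw [h3]
    linarith
  have hδ4 : δ ^ 2 = r ^ 4 := by rw [hδ]; ring
  rw [hδ4] at hp1' hp2'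
  rw [hk1] at h1
  linarith

/-- Moving the left endpoint. -/
theorem phiPlus_left_le (h : Admissible g p C) (hab : a < b)
    (hu : IsPositiveMinimizer g p C a b u U V) {M r e : ℝ} (hM : 2 * C * (b - a) ≤ M)
    (hr0 : 0 < r) (hr : r ≤ 1 / 2) (hrb : r ^ 2 ≤ b - a) (he : |e| = r ^ 3) (hbe : a + e < b) :
    phiPlus g p (a + e) b ≤
      phiPlus g p a b + 1 / 2 * V a ^ 2 * e + (M ^ 2 + 6 * C * M) * r ^ 4 := by
  have h1 := h.comp_neg.phiPlus_right_le (neg_lt_neg hab) (hu.comp_neg hab.le) (M := M) (r := r)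
    (e := -e) (by linarith) hr0 hr (by linarith) (by rwa [abs_neg]) (by linarith)
  rw [← neg_add, h.phiPlus_comp_neg hbe, h.phiPlus_comp_neg hab, neg_neg, neg_sq] at h1
  linarith

theorem exists_isPositiveMinimizer (h : Admissible g p C) {L : ℝ}
    (hL : IsPositivityThreshold g p L) (hab : L ≤ b - a) :
    ∃ u U V, IsPositiveMinimizer g p C a b u U V := by
  have hab' : a < b := by linarith [hL.1]
  obtain ⟨u, hu⟩ := h.exists_isMinimizer hab'
  have hpos := hL.2 a b hab u hu
  obtain ⟨U, V, hUV⟩ := h.exists_isC2Extension hab' hu hpos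
  exact ⟨u, U, V, hu, hpos, hUV⟩

/-- Shrinking the interval a little increases the minimal energy only a little. -/
theorem exists_phiPlus_shrink_le (h : Admissible g p C) {L : ℝ}
    (hL : IsPositivityThreshold g p L) (Λ : ℝ) :
    ∃ N η₀ : ℝ, 0 ≤ N ∧ 0 < η₀ ∧ ∀ η ∈ Ioc 0 η₀, ∀ a b, L ≤ b - a - η → b - a ≤ Λ →
      phiPlus g p (a + η) (b - η) ≤ phiPlus g p a b + N * η := by
  have hC := h.C_nonneg
  have hL0 := hL.1
  set M := 2 * C * |Λ| with hM
  -- Each of the two endpoint moves costs at most (M²/2)η plus (M² + 6CM)η/2; `N` bounds the total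
  -- and is not sharp.
  set N := 3 * M ^ 2 + 12 * C * M with hN
  set r₀ := min (1 / 2) L with hr₀
  have hr₀0 : 0 < r₀ := lt_min (by norm_num) hL0
  have hr₀h : r₀ ≤ 1 / 2 := min_le_left _ _
  have hr₀L : r₀ ≤ L := min_le_right _ _
  refine ⟨N, r₀ ^ 3, by positivity, by positivity, fun η hη a b hab hΛ => ?_⟩
  obtain ⟨r, hr0, hrη⟩ : ∃ r : ℝ, 0 < r ∧ r ^ 3 = η :=
    ⟨η ^ ((3 : ℕ) : ℝ)⁻¹, Real.rpow_pos_of_pos hη.1 _, Real.rpow_inv_natCast_pow hη.1.le (by norm_num)⟩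
  have hrr : r ≤ r₀ := by
    by_contra hc
    have := pow_lt_pow_left₀ (not_le.1 hc) hr₀0.le (three_ne_zero)
    rw [hrη] at this
    linarith [hη.2]
  have hr2 : r ≤ 1 / 2 := hrr.trans hr₀h
  have hrL : r ≤ L := hrr.trans hr₀L
  have hrsq : r ^ 2 ≤ L := by nlinarith
  have hηL : η < L := by rw [← hrη]; nlinarith [pow_pos hr0 2]
  have hr4 : r ^ 4 ≤ η / 2 := by rw [← hrη]; nlinarith [pow_pos hr0 3]
  have hη0 := hη.1
  have hb : ∀ c d, c < d → d - c ≤ Λ → 2 * C * (d - c) ≤ M := fun c d h1 h2 =>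
    mul_le_mul_of_nonneg_left (h2.trans (le_abs_self _)) (by linarith)
  have hM0 : 0 ≤ M := by positivity
  have hK : (M ^ 2 + 6 * C * M) * r ^ 4 ≤ (M ^ 2 + 6 * C * M) * (η / 2) :=
    mul_le_mul_of_nonneg_left hr4 (by positivity)
  have hMV : ∀ c d u U V, c < d → d - c ≤ Λ → IsPositiveMinimizer g p C c d u U V →
      ∀ t ∈ Icc c d, 1 / 2 * V t ^ 2 * η ≤ M ^ 2 * η / 2 := by
    intro c d u U V hcd hdc hu t ht
    have hu1 := (mem_H01Plus_iff hcd.le).1 hu.isMinimizer.1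
    have h1 := (hu.ext.abs_deriv_le hC hcd hu1.2.1 hu1.2.2.1 ht).trans (hb c d hcd hdc)
    have h2 : V t ^ 2 ≤ M ^ 2 := by rw [← sq_abs]; exact pow_le_pow_left₀ (abs_nonneg _) h1 2
    have := mul_le_mul_of_nonneg_right h2 hη0.le
    linarith
  -- Only the right endpoint moves first; the left one moves next, starting from a minimizer on [a,
  -- b - η], whose length is still at least `L`.
  obtain ⟨u, U, V, hu⟩ := h.exists_isPositiveMinimizer hL (a := a) (b := b) (by linarith)
  have h1 := h.phiPlus_right_le (by linarith) hu (hb a b (by linarith) hΛ) hr0 hr2 (by linarith)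
    (e := -η) (by rw [abs_neg, abs_of_pos hη0, hrη]) (by linarith)
  have h2 := hMV a b u U V (by linarith) hΛ hu b (right_mem_Icc.2 (by linarith))
  obtain ⟨u', U', V', hu'⟩ := h.exists_isPositiveMinimizer hL (a := a) (b := b - η) (by linarith)
  have h3 := h.phiPlus_left_le (by linarith) hu' (hb a (b - η) (by linarith) (by linarith)) hr0 hr2
    (by linarith) (e := η) (by rw [abs_of_pos hη0, hrη]) (by linarith)
  have h4 := hMV a (b - η) u' U' V' (by linarith) (by linarith) hu' a
    (left_mem_Icc.2 (by linarith))
  rw [← sub_eq_add_neg] at h1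
  have h5 : 0 ≤ M ^ 2 * η := by positivity
  have h6 : 0 ≤ C * M * η := by positivity
  rw [hN]
  linarith

/-! ### Extension by zero and monotonicity in the interval -/

/-- The action of a function vanishing outside a subinterval. -/
theorem action_eq_of_eq_zero (h : Admissible g p C) {c d : ℝ} (hac : a ≤ c) (hcd : c ≤ d)
    (hdb : d ≤ b) (hu : IsH1 a b u) (h1 : ∀ t ∈ Icc a c, u t = 0) (h2 : ∀ t ∈ Icc d b, u t = 0) :
    action g p a b u = action g p c d u := by
  rw [h.action_add hac (hcd.trans hdb) hu, h.action_add hcd hdb (hu.mono hac (hcd.trans hdb) le_rfl),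
    action_congr g p hac (v := fun _ => 0) h1, action_congr g p hdb (v := fun _ => 0) h2,
    action_zero, action_zero]
  ring

theorem indicator_mem_H01Plus {c d : ℝ} (hac : a ≤ c) (hcd : c ≤ d)
    (hdb : d ≤ b) (hu : u ∈ H01Plus c d) : (Icc c d).indicator u ∈ H01Plus a b := by
  have hu1 := (mem_H01Plus_iff hcd).1 hu
  have hz : ∀ x y : ℝ, x ≤ y → IsH1 x y (fun _ => 0) := fun x y hxy =>
    ((mem_H01Plus_iff hxy).1 (zero_mem_H01Plus hxy)).1
  have h1 := IsH1.glue hac hcd (hz a c hac) hu1.1 hu1.2.1.symm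
  have hcdz : (if d ≤ c then (0 : ℝ) else u d) = 0 := by
    split_ifs
    · rfl
    · exact hu1.2.2.1
  have h2 := IsH1.glue (hac.trans hcd) hdb h1 (hz d b hdb) hcdz
  have hab : a ≤ b := by linarith
  have heq : ∀ t, (if t ≤ d then (if t ≤ c then (0 : ℝ) else u t) else 0)
      = (Icc c d).indicator u t := fun t => by
    by_cases htd : t ≤ d
    · rcases lt_trichotomy t c with h3 | h3 | h3
      · simp [htd, h3.le, indicator, not_le.2 h3]
      · simp [h3, indicator, hcd, hu1.2.1]
      · simp [htd, h3.le, indicator, not_le.2 h3]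
    · simp [htd, indicator]
  rw [mem_H01Plus_iff hab]
  refine ⟨h2.congr hab fun t _ => heq t, ?_, ?_, fun t _ => indicator_nonneg hu1.2.2.2 t⟩
  · by_cases hc : c ≤ a
    · rw [le_antisymm hac hc, indicator_of_mem (left_mem_Icc.2 hcd), hu1.2.1]
    · exact indicator_of_notMem (fun h => hc h.1) _
  · by_cases hd : b ≤ d
    · rw [le_antisymm hd hdb, indicator_of_mem (right_mem_Icc.2 hcd), hu1.2.2.1]
    · exact indicator_of_notMem (fun h => hd h.2) _

theorem action_indicator (h : Admissible g p C) {c d : ℝ} (hac : a ≤ c) (hcd : c ≤ d)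
    (hdb : d ≤ b) (hu : u ∈ H01Plus c d) :
    action g p a b ((Icc c d).indicator u) = action g p c d u := by
  have hab : a ≤ b := by linarith
  have hu1 := (mem_H01Plus_iff hcd).1 hu
  have hm := (mem_H01Plus_iff hab).1 (indicator_mem_H01Plus hac hcd hdb hu)
  rw [h.action_eq_of_eq_zero hac hcd hdb hm.1 ?_ ?_]
  · exact action_congr g p hcd fun t ht => indicator_of_mem ht _
  · intro t ht
    rcases eq_or_lt_of_le ht.2 with e | hlt
    · rw [e, indicator_of_mem (left_mem_Icc.2 hcd), hu1.2.1]
    · exact indicator_of_notMem (fun h => absurd h.1 (not_le.2 hlt)) _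
  · intro t ht
    rcases eq_or_lt_of_le ht.1 with e | hlt
    · rw [← e, indicator_of_mem (right_mem_Icc.2 hcd), hu1.2.2.1]
    · exact indicator_of_notMem (fun h => absurd h.2 (not_le.2 hlt)) _

/-- Extension by zero turns a minimizer on the smaller interval into a competitor of equal action on
the larger one. -/
theorem phiPlus_anti (h : Admissible g p C) {c d : ℝ} (hac : a ≤ c) (hcd : c < d)
    (hdb : d ≤ b) : phiPlus g p a b ≤ phiPlus g p c d := by
  obtain ⟨u, hu⟩ := h.exists_isMinimizer hcd
  rw [← ((h.isMinimizer_iff hcd).1 hu).2, ← h.action_indicator hac hcd.le hdb hu.1]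
  exact h.phiPlus_le (by linarith) (indicator_mem_H01Plus hac hcd.le hdb hu.1)

end Admissible

/-! ### Continuous dependence of minimizers and endpoint slopes -/

namespace Admissible

variable {g p : ℝ → ℝ} {C : ℝ} {L : ℝ} {u U V : ℝ → ℝ → ℝ → ℝ}

/-- Stability of minimizers under perturbation of the interval, along sequences. -/
theorem exists_tendsto_subseq (h : Admissible g p C) (hL : IsPositivityThreshold g p L)
    (hu : ∀ a b, L ≤ b - a → IsMinimizer g p a b (u a b)) {a₀ b₀ : ℝ} (h₀ : L < b₀ - a₀)
    {x : ℕ → ℝ × ℝ} (hx : Tendsto x atTop (𝓝 (a₀, b₀))) (hxL : ∀ n, L ≤ (x n).2 - (x n).1)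
    (hxa : ∀ n, a₀ - 1 ≤ (x n).1) (hxb : ∀ n, (x n).2 ≤ b₀ + 1) {t : ℝ} (ht : t ∈ Ioo a₀ b₀) :
    ∃ φ : ℕ → ℕ, StrictMono φ ∧
      Tendsto (fun k => u (x (φ k)).1 (x (φ k)).2 t) atTop (𝓝 (u a₀ b₀ t)) := by
  have hL0 := hL.1
  have hab₀ : a₀ < b₀ := by linarith
  set A := a₀ - 1 with hA
  set B := b₀ + 1 with hB
  have hAB : A < B := by linarith
  have hlt : ∀ n, (x n).1 < (x n).2 := fun n => by linarith [hxL n]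
  have ha : Tendsto (fun n => (x n).1) atTop (𝓝 a₀) := (continuous_fst.tendsto _).comp hx
  have hb : Tendsto (fun n => (x n).2) atTop (𝓝 b₀) := (continuous_snd.tendsto _).comp hx
  -- Extending by zero places all the minimizers in one cone over the fixed interval [A,B], where
  -- the compactness lemma applies.
  set w : ℕ → ℝ → ℝ := fun n => (Icc (x n).1 (x n).2).indicator (u (x n).1 (x n).2) with hw
  have hum := fun n => hu _ _ (hxL n)
  have hwm : ∀ n, w n ∈ H01Plus A B := fun n =>
    indicator_mem_H01Plus (hxa n) (hlt n).le (hxb n) (hum n).1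
  have hwJ : ∀ n, action g p A B (w n) = phiPlus g p (x n).1 (x n).2 := fun n => by
    rw [hw, h.action_indicator (hxa n) (hlt n).le (hxb n) (hum n).1]
    exact ((h.isMinimizer_iff (hlt n)).1 (hum n)).2
  obtain ⟨N, η₀, hN, hη₀, hshrink⟩ := h.exists_phiPlus_shrink_le hL (B - A)
  have hη : ∀ ε > 0, ∃ η ∈ Ioc 0 η₀, η ≤ 1 ∧ η ≤ (b₀ - a₀ - L) / 4 ∧ N * η < ε := by
    intro ε hε
    refine ⟨min η₀ (min 1 (min ((b₀ - a₀ - L) / 4) (ε / (N + 1) / 2))), ⟨?_, min_le_left _ _⟩,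
      (min_le_right _ _).trans (min_le_left _ _),
      (min_le_right _ _).trans ((min_le_right _ _).trans (min_le_left _ _)), ?_⟩
    · exact lt_min hη₀ (lt_min one_pos (lt_min (by linarith) (by positivity)))
    · have h1 : min η₀ (min 1 (min ((b₀ - a₀ - L) / 4) (ε / (N + 1) / 2))) ≤ ε / (N + 1) / 2 :=
        (min_le_right _ _).trans ((min_le_right _ _).trans (min_le_right _ _))
      have h2 := mul_le_mul_of_nonneg_left h1 hN
      have h3 : N * (ε / (N + 1) / 2) = ε / 2 * (N / (N + 1)) := by field_simp
      have h4 : N / (N + 1) ≤ 1 := (div_le_one (by linarith)).2 (by linarith)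
      have h5 : ε / 2 * (N / (N + 1)) ≤ ε / 2 := mul_le_of_le_one_right (by linarith) h4
      linarith
  have hclose : ∀ η > 0, ∃ n₀, ∀ n ≥ n₀, |(x n).1 - a₀| ≤ η ∧ |(x n).2 - b₀| ≤ η := by
    intro η hη
    obtain ⟨n₁, hn₁⟩ := Metric.tendsto_atTop.1 ha η hη
    obtain ⟨n₂, hn₂⟩ := Metric.tendsto_atTop.1 hb η hη
    exact ⟨max n₁ n₂, fun n hn => ⟨(hn₁ n ((le_max_left _ _).trans hn)).le,
      (hn₂ n ((le_max_right _ _).trans hn)).le⟩⟩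
  -- Monotonicity traps the energies of nearby intervals between those of [a₀ - η, b₀ + η] and [a₀ +
  -- η, b₀ - η]; the shrinking estimate places both within Nη of the energy at (a₀,b₀).
  have hlow : ∀ η ∈ Ioc 0 η₀, η ≤ 1 → η ≤ (b₀ - a₀ - L) / 4 →
      phiPlus g p a₀ b₀ ≤ phiPlus g p (a₀ - η) (b₀ + η) + N * η := fun η h1 h2 h3 => by
    have := hshrink η h1 (a₀ - η) (b₀ + η) (by linarith [h1.1]) (by linarith)
    rwa [sub_add_cancel, add_sub_cancel_right] at this
  have hup : ∀ η ∈ Ioc 0 η₀, η ≤ 1 → η ≤ (b₀ - a₀ - L) / 4 →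
      phiPlus g p (a₀ + η) (b₀ - η) ≤ phiPlus g p a₀ b₀ + N * η := fun η h1 h2 h3 =>
    hshrink η h1 a₀ b₀ (by linarith [h1.1]) (by linarith)
  have hlim : Tendsto (fun n => action g p A B (w n)) atTop (𝓝 (phiPlus g p a₀ b₀)) := by
    rw [Metric.tendsto_atTop]
    intro ε hε
    obtain ⟨η, h1, h2, h3, h4⟩ := hη ε hε
    obtain ⟨n₀, hn₀⟩ := hclose η h1.1
    refine ⟨n₀, fun n hn => ?_⟩
    obtain ⟨h5, h6⟩ := hn₀ n hn
    rw [abs_le] at h5 h6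
    have h7 := h.phiPlus_anti (a := a₀ - η) (b := b₀ + η) (c := (x n).1) (d := (x n).2)
      (by linarith) (hlt n) (by linarith)
    have h8 := h.phiPlus_anti (a := (x n).1) (b := (x n).2) (c := a₀ + η) (d := b₀ - η)
      (by linarith) (by linarith) (by linarith)
    rw [hwJ, Real.dist_eq, abs_lt]
    constructor <;> linarith [hlow η h1 h2 h3, hup η h1 h2 h3]
  have hzero : ∀ n s, s ∉ Ioo (x n).1 (x n).2 → w n s = 0 := by
    intro n s hs
    have hn := (mem_H01Plus_iff (hlt n).le).1 (hum n).1
    by_cases hs' : s ∈ Icc (x n).1 (x n).2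
    · simp only [hw]
      rw [indicator_of_mem hs']
      rcases eq_or_lt_of_le hs'.1 with e | h1
      · rw [← e]; exact hn.2.1
      rcases eq_or_lt_of_le hs'.2 with e | h2
      · rw [e]; exact hn.2.2.1
      exact absurd ⟨h1, h2⟩ hs
    · exact indicator_of_notMem hs' _
  -- Midpoints of late terms vanish outside [a₀ - η, b₀ + η], so they compete there and their action
  -- is at least the energy of that interval.
  have hmid : ∀ ε > 0, ∃ n₀, ∀ n ≥ n₀, ∀ m ≥ n₀, phiPlus g p a₀ b₀ - ε ≤
      action g p A B (fun t => 1 / 2 * w n t + 1 / 2 * w m t) := by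
    intro ε hε
    obtain ⟨η, h1, h2, h3, h4⟩ := hη ε hε
    obtain ⟨n₀, hn₀⟩ := hclose η h1.1
    refine ⟨n₀, fun n hn m hm => ?_⟩
    have h0 := h1.1
    set c := a₀ - η with hc
    set d := b₀ + η with hd
    have hcd : c < d := by linarith
    have hAc : A ≤ c := by linarith
    have hdB : d ≤ B := by linarith
    have hout : ∀ k ≥ n₀, ∀ s, (s ≤ c ∨ d ≤ s) → w k s = 0 := by
      intro k hk s hs
      obtain ⟨h5, h6⟩ := hn₀ k hk
      rw [abs_le] at h5 h6
      refine hzero k s fun h7 => ?_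
      rcases hs with hs | hs
      · linarith [h7.1]
      · linarith [h7.2]
    have hn1 := (mem_H01Plus_iff hAB.le).1 (hwm n)
    have hm1 := (mem_H01Plus_iff hAB.le).1 (hwm m)
    have hz := hn1.1.lin hAB.le hm1.1 (1 / 2) (1 / 2)
    have hzo : ∀ s, (s ≤ c ∨ d ≤ s) → 1 / 2 * w n s + 1 / 2 * w m s = 0 := fun s hs => by
      rw [hout n hn s hs, hout m hm s hs]; ring
    rw [h.action_eq_of_eq_zero hAc hcd.le hdB hz (fun s hs => hzo s (Or.inl hs.2))
      fun s hs => hzo s (Or.inr hs.1)]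
    have hzm : (fun t => 1 / 2 * w n t + 1 / 2 * w m t) ∈ H01Plus c d := by
      rw [mem_H01Plus_iff hcd.le]
      refine ⟨hz.mono hAc hcd.le hdB, hzo c (Or.inl le_rfl), hzo d (Or.inr le_rfl), fun s hs => ?_⟩
      have hs' : s ∈ Icc A B := ⟨hAc.trans hs.1, hs.2.trans hdB⟩
      have h5 := hn1.2.2.2 s hs'
      have h6 := hm1.2.2.2 s hs'
      positivity
    linarith [h.phiPlus_le hcd hzm, hlow η h1 h2 h3]
  obtain ⟨φ, hφ, v, hv, hvJ, hconv⟩ := h.exists_subseq_limit hAB hwm hlim hmid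
  refine ⟨φ, hφ, ?_⟩
  have hv1 := (mem_H01Plus_iff hAB.le).1 hv
  have hpt : ∀ s ∈ Icc A B, Tendsto (fun k => w (φ k) s) atTop (𝓝 (v s)) := fun s hs =>
    hconv.tendsto_at hs
  -- Left of a₀ the extensions are eventually zero at each point; the value at a₀ itself follows by
  -- continuity of `v`.
  have hleft : EqOn v (fun _ => 0) (Icc A a₀) := by
    have h1 : EqOn v (fun _ => 0) (Ico A a₀) := fun s hs => by
      refine tendsto_nhds_unique (hpt s ⟨hs.1, by linarith [hs.2]⟩) ?_
      refine tendsto_const_nhds.congr' ?_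
      filter_upwards [(ha.comp hφ.tendsto_atTop).eventually (lt_mem_nhds hs.2)] with k hk
      exact (hzero _ _ fun h2 => absurd h2.1 (not_lt.2 (le_of_lt hk))).symm
    refine h1.of_subset_closure ((hv1.1.continuousOn hAB.le).mono
      (Icc_subset_Icc_right (by linarith))) continuousOn_const Ico_subset_Icc_self ?_
    rw [closure_Ico (by linarith : A ≠ a₀)]
  have hright : EqOn v (fun _ => 0) (Icc b₀ B) := by
    have h1 : EqOn v (fun _ => 0) (Ioc b₀ B) := fun s hs => by
      refine tendsto_nhds_unique (hpt s ⟨by linarith [hs.1], hs.2⟩) ?_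
      refine tendsto_const_nhds.congr' ?_
      filter_upwards [(hb.comp hφ.tendsto_atTop).eventually (gt_mem_nhds hs.1)] with k hk
      exact (hzero _ _ fun h2 => absurd h2.2 (not_lt.2 (le_of_lt hk))).symm
    refine h1.of_subset_closure ((hv1.1.continuousOn hAB.le).mono
      (Icc_subset_Icc_left (by linarith))) continuousOn_const Ioc_subset_Icc_self ?_
    rw [closure_Ioc (by linarith : b₀ ≠ B)]
  have hAa : A ≤ a₀ := by linarith
  have hbB : b₀ ≤ B := by linarith
  have hvmin : IsMinimizer g p a₀ b₀ v := by
    rw [h.isMinimizer_iff hab₀]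
    refine ⟨?_, ?_⟩
    · rw [mem_H01Plus_iff hab₀.le]
      exact ⟨hv1.1.mono hAa hab₀.le hbB, hleft (right_mem_Icc.2 hAa),
        hright (left_mem_Icc.2 hbB), fun s hs => hv1.2.2.2 s ⟨hAa.trans hs.1, hs.2.trans hbB⟩⟩
    · rw [← h.action_eq_of_eq_zero hAa hab₀.le hbB hv1.1 hleft hright, hvJ]
  -- The limit minimizes on (a₀,b₀), so uniqueness identifies it with the prescribed minimizer.
  have huv := h.eqOn_of_isMinimizer hab₀ (hu a₀ b₀ h₀.le) hvmin
    (hL.2 a₀ b₀ h₀.le _ (hu a₀ b₀ h₀.le)) (hL.2 a₀ b₀ h₀.le _ hvmin) (Ioo_subset_Icc_self ht)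
  rw [← huv]
  refine (hpt t ⟨by linarith [ht.1], by linarith [ht.2]⟩).congr' ?_
  filter_upwards [(ha.comp hφ.tendsto_atTop).eventually (gt_mem_nhds ht.1),
    (hb.comp hφ.tendsto_atTop).eventually (lt_mem_nhds ht.2)] with k hk1 hk2
  have hmem : t ∈ Icc (x (φ k)).1 (x (φ k)).2 := ⟨le_of_lt hk1, le_of_lt hk2⟩
  exact indicator_of_mem hmem _

/-- Stability of minimizers under perturbation of the interval. -/
theorem tendsto_minimizer (h : Admissible g p C) (hL : IsPositivityThreshold g p L)
    (hu : ∀ a b, L ≤ b - a → IsMinimizer g p a b (u a b)) {x₀ : ℝ × ℝ} (h₀ : L < x₀.2 - x₀.1)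
    {t : ℝ} (ht : t ∈ Ioo x₀.1 x₀.2) :
    Tendsto (fun x : ℝ × ℝ => u x.1 x.2 t) (𝓝 x₀) (𝓝 (u x₀.1 x₀.2 t)) := by
  rw [Metric.tendsto_nhds]
  by_contra hcon
  push Not at hcon
  obtain ⟨ε, hε, hfreq⟩ := hcon
  have hev : ∀ᶠ x : ℝ × ℝ in 𝓝 x₀, L ≤ x.2 - x.1 ∧ x₀.1 - 1 ≤ x.1 ∧ x.2 ≤ x₀.2 + 1 := by
    have h1 : Continuous fun x : ℝ × ℝ => x.2 - x.1 := by fun_prop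
    filter_upwards [h1.continuousAt.eventually (lt_mem_nhds h₀),
      continuous_fst.continuousAt.eventually (lt_mem_nhds (by linarith : x₀.1 - 1 < x₀.1)),
      continuous_snd.continuousAt.eventually (gt_mem_nhds (by linarith : x₀.2 < x₀.2 + 1))]
      with x hx1 hx2 hx3 using ⟨hx1.le, hx2.le, hx3.le⟩
  -- If convergence failed, some sequence of intervals would keep the values at `t` at distance at
  -- least ε, and so would all its subsequences.
  obtain ⟨x, hx, hx'⟩ := exists_seq_forall_of_frequently (hfreq.and_eventually hev)
  obtain ⟨φ, -, hlim⟩ := h.exists_tendsto_subseq hL hu h₀ hx (fun n => (hx' n).2.1)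
    (fun n => (hx' n).2.2.1) (fun n => (hx' n).2.2.2) ht
  obtain ⟨k, hk⟩ := (Metric.tendsto_nhds.1 hlim ε hε).exists
  exact absurd hk (not_lt.2 (hx' (φ k)).1)

/-- The derivative at an endpoint depends continuously on the interval. -/
theorem tendsto_deriv_endpoint (h : Admissible g p C) (hL : IsPositivityThreshold g p L)
    (hu : ∀ a b, L ≤ b - a → IsPositiveMinimizer g p C a b (u a b) (U a b) (V a b))
    {e : ℝ × ℝ → ℝ} (he : Continuous e) (hU : ∀ x : ℝ × ℝ, L ≤ x.2 - x.1 → U x.1 x.2 (e x) = 0)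
    {x₀ : ℝ × ℝ} (h₀ : L < x₀.2 - x₀.1)
    (hnear : ∀ δ > 0, ∃ t ∈ Ioo x₀.1 x₀.2, t ≠ e x₀ ∧ |t - e x₀| < δ) :
    Tendsto (fun x : ℝ × ℝ => V x.1 x.2 (e x)) (𝓝 x₀) (𝓝 (V x₀.1 x₀.2 (e x₀))) := by
  have hC := h.C_nonneg
  -- The endpoint slope differs from a difference quotient of `u` by at most 2C|t - e(x)|, uniformly
  -- in the interval; for fixed `t` the quotient is continuous in the interval.
  have key : ∀ x : ℝ × ℝ, L ≤ x.2 - x.1 → ∀ t, t ≠ e x → t ∈ Icc x.1 x.2 →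
      |V x.1 x.2 (e x) - u x.1 x.2 t / (t - e x)| ≤ 2 * C * |t - e x| := by
    intro x hx t hne ht
    have h1 := (hu _ _ hx).ext.taylor (e x) t
    rw [hU x hx, ← (hu _ _ hx).ext.eqOn ht] at h1
    have hpos : 0 < |t - e x| := abs_pos.2 (sub_ne_zero.2 hne)
    have hne' : t - e x ≠ 0 := sub_ne_zero.2 hne
    refine le_of_mul_le_mul_right ?_ hpos
    rw [← abs_mul]
    have e1 : (V x.1 x.2 (e x) - u x.1 x.2 t / (t - e x)) * (t - e x) =
        -(u x.1 x.2 t - 0 - V x.1 x.2 (e x) * (t - e x)) := by field_simp; ring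
    rw [e1, abs_neg, mul_assoc, abs_mul_abs_self, ← sq]
    exact h1
  rw [Metric.tendsto_nhds]
  intro ε hε
  -- With this distance each of the two Taylor errors is at most ε/6, leaving ε/2 for the quotients.
  obtain ⟨t, ht, hne, hlt⟩ := hnear (ε / (12 * (C + 1))) (by positivity)
  have hsmall : 2 * C * (ε / (12 * (C + 1))) ≤ ε / 6 := by
    have h1 : 2 * C * (ε / (12 * (C + 1))) = ε / 6 * (C / (C + 1)) := by field_simp; ring
    rw [h1]
    exact mul_le_of_le_one_right (by positivity) ((div_le_one (by linarith)).2 (by linarith))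
  have hlim : Tendsto (fun x : ℝ × ℝ => u x.1 x.2 t / (t - e x)) (𝓝 x₀)
      (𝓝 (u x₀.1 x₀.2 t / (t - e x₀))) :=
    (h.tendsto_minimizer hL (fun a b hab => (hu a b hab).isMinimizer) h₀ ht).div
      ((continuous_const.sub he).tendsto x₀) (sub_ne_zero.2 hne)
  have hdc : Continuous fun x : ℝ × ℝ => |t - e x| := by fun_prop
  have hlc : Continuous fun x : ℝ × ℝ => x.2 - x.1 := by fun_prop
  filter_upwards [Metric.tendsto_nhds.1 hlim (ε / 2) (by positivity),
    hdc.continuousAt.eventually (gt_mem_nhds hlt),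
    hdc.continuousAt.eventually (lt_mem_nhds (abs_pos.2 (sub_ne_zero.2 hne))),
    hlc.continuousAt.eventually (lt_mem_nhds h₀),
    continuous_fst.continuousAt.eventually (gt_mem_nhds ht.1),
    continuous_snd.continuousAt.eventually (lt_mem_nhds ht.2)] with x h1 h2 h3 h4 h5 h6
  have hx := key x h4.le t (sub_ne_zero.1 (abs_pos.1 h3)) ⟨h5.le, h6.le⟩
  have hx₀ := key x₀ h₀.le t hne (Ioo_subset_Icc_self ht)
  have h7 : 2 * C * |t - e x| ≤ ε / 6 :=
    (mul_le_mul_of_nonneg_left h2.le (by linarith)).trans hsmall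
  have h8 : 2 * C * |t - e x₀| ≤ ε / 6 :=
    (mul_le_mul_of_nonneg_left hlt.le (by linarith)).trans hsmall
  rw [Real.dist_eq, abs_lt] at h1 ⊢
  have h9 := abs_le.1 (hx.trans h7)
  have h10 := abs_le.1 (hx₀.trans h8)
  constructor <;> linarith [h1.1, h1.2, h9.1, h9.2, h10.1, h10.2]

theorem tendsto_deriv_right (h : Admissible g p C) (hL : IsPositivityThreshold g p L)
    (hu : ∀ a b, L ≤ b - a → IsPositiveMinimizer g p C a b (u a b) (U a b) (V a b))
    {x₀ : ℝ × ℝ} (h₀ : L < x₀.2 - x₀.1) :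
    Tendsto (fun x : ℝ × ℝ => V x.1 x.2 x.2) (𝓝 x₀) (𝓝 (V x₀.1 x₀.2 x₀.2)) := by
  have hL0 := hL.1
  refine h.tendsto_deriv_endpoint hL hu continuous_snd (fun x hx => ?_) h₀ fun δ hδ => ?_
  · have hab : x.1 ≤ x.2 := by linarith
    rw [← (hu _ _ hx).ext.eqOn (right_mem_Icc.2 hab)]
    exact ((mem_H01Plus_iff hab).1 (hu _ _ hx).isMinimizer.1).2.2.1
  · have h1 : 0 < min δ (x₀.2 - x₀.1) := lt_min hδ (by linarith)
    have h2 := min_le_left δ (x₀.2 - x₀.1)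
    have h3 := min_le_right δ (x₀.2 - x₀.1)
    refine ⟨x₀.2 - min δ (x₀.2 - x₀.1) / 2, ⟨by linarith, by linarith⟩, by linarith, ?_⟩
    rw [abs_lt]
    constructor <;> linarith

theorem tendsto_deriv_left (h : Admissible g p C) (hL : IsPositivityThreshold g p L)
    (hu : ∀ a b, L ≤ b - a → IsPositiveMinimizer g p C a b (u a b) (U a b) (V a b))
    {x₀ : ℝ × ℝ} (h₀ : L < x₀.2 - x₀.1) :
    Tendsto (fun x : ℝ × ℝ => V x.1 x.2 x.1) (𝓝 x₀) (𝓝 (V x₀.1 x₀.2 x₀.1)) := by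
  have hL0 := hL.1
  refine h.tendsto_deriv_endpoint hL hu continuous_fst (fun x hx => ?_) h₀ fun δ hδ => ?_
  · have hab : x.1 ≤ x.2 := by linarith
    rw [← (hu _ _ hx).ext.eqOn (left_mem_Icc.2 hab)]
    exact ((mem_H01Plus_iff hab).1 (hu _ _ hx).isMinimizer.1).2.1
  · have h1 : 0 < min δ (x₀.2 - x₀.1) := lt_min hδ (by linarith)
    have h2 := min_le_left δ (x₀.2 - x₀.1)
    have h3 := min_le_right δ (x₀.2 - x₀.1)
    refine ⟨x₀.1 + min δ (x₀.2 - x₀.1) / 2, ⟨by linarith, by linarith⟩, by linarith, ?_⟩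
    rw [abs_lt]
    constructor <;> linarith

end Admissible

/-! ### Differentiability of the minimal energy -/

/-- A function with a continuous field of supergradients, up to a superlinear error, is
differentiable. -/
theorem hasDerivAt_of_le_add {f D : ℝ → ℝ} {b ρ r₀ K : ℝ} (hD : ContinuousAt D b) (hρ : 0 < ρ)
    (hr₀ : 0 < r₀) (hK : 0 ≤ K)
    (H : ∀ y y', |y - b| < ρ → |y' - b| < ρ → ∀ r, 0 < r → r ≤ r₀ → |y' - y| = r ^ 3 →
      f y' ≤ f y + D y * (y' - y) + K * r ^ 4) : HasDerivAt f (D b) b := by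
  rw [hasDerivAt_iff_isLittleO, Asymptotics.isLittleO_iff]
  intro c hc
  -- With r the cube root of |y - b|, the error K r⁴ equals K r |y - b|, hence at most (c/2)|y - b|
  -- for r ≤ r₁.
  set r₁ := min r₀ (c / (2 * (K + 1))) with hr₁
  have hr₁0 : 0 < r₁ := lt_min hr₀ (by positivity)
  have hr₁K : K * r₁ ≤ c / 2 := by
    have h1 := mul_le_mul_of_nonneg_left (min_le_right r₀ (c / (2 * (K + 1)))) hK
    have h2 : K * (c / (2 * (K + 1))) = c / 2 * (K / (K + 1)) := by field_simp
    have h3 : c / 2 * (K / (K + 1)) ≤ c / 2 :=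
      mul_le_of_le_one_right (by positivity) ((div_le_one (by linarith)).2 (by linarith))
    linarith
  have hdist : Continuous fun y : ℝ => |y - b| := by fun_prop
  have hnear : ∀ η > 0, ∀ᶠ y in 𝓝 b, |y - b| < η := fun η hη =>
    hdist.continuousAt.eventually (gt_mem_nhds (by simpa using hη))
  filter_upwards [hnear ρ hρ, hnear (r₁ ^ 3) (by positivity),
    Metric.tendsto_nhds.1 hD (c / 2) (by positivity)] with y h1 h2 h3
  rw [smul_eq_mul, Real.norm_eq_abs, Real.norm_eq_abs]
  rcases eq_or_ne y b with rfl | hne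
  · simp
  have hpos : 0 < |y - b| := abs_pos.2 (sub_ne_zero.2 hne)
  obtain ⟨r, hr0, hr⟩ : ∃ r : ℝ, 0 < r ∧ r ^ 3 = |y - b| :=
    ⟨|y - b| ^ ((3 : ℕ) : ℝ)⁻¹, Real.rpow_pos_of_pos hpos _,
      Real.rpow_inv_natCast_pow hpos.le (by norm_num)⟩
  have hrr : r ≤ r₁ := by
    by_contra hcon
    have := pow_lt_pow_left₀ (not_le.1 hcon) hr₁0.le three_ne_zero
    rw [hr] at this
    linarith
  have herr : K * r ^ 4 ≤ c / 2 * |y - b| := by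
    have h4 : K * r ^ 4 = K * r * |y - b| := by rw [← hr]; ring
    rw [h4]
    exact mul_le_mul_of_nonneg_right ((mul_le_mul_of_nonneg_left hrr hK).trans hr₁K) hpos.le
  have hb0 : |b - b| < ρ := by simpa using hρ
  -- The hypothesis read from `b` to `y` bounds f(y) from above; read from `y` to `b` it bounds f(y)
  -- from below with slope D(y), which continuity replaces by D(b).
  have h5 := H b y hb0 h1 r hr0 (hrr.trans (min_le_left _ _)) hr.symm
  have h6 := H y b h1 hb0 r hr0 (hrr.trans (min_le_left _ _)) (by rw [abs_sub_comm]; exact hr.symm)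
  have h7 : |(D y - D b) * (y - b)| ≤ c / 2 * |y - b| := by
    rw [abs_mul]
    exact mul_le_mul_of_nonneg_right (by rw [← Real.dist_eq]; exact h3.le) hpos.le
  have h8 := abs_le.1 h7
  rw [abs_le]
  constructor <;> nlinarith [h8.1, h8.2]

namespace Admissible

variable {g p : ℝ → ℝ} {C : ℝ} {L : ℝ} {u U V : ℝ → ℝ → ℝ → ℝ} {a b : ℝ}

/-- The one-sided estimate holds with one constant for all right endpoints near `b`, because their
lengths stay between `L` and b - a + 1; continuity of the endpoint slope supplies the remaining
hypothesis. -/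
theorem hasDerivAt_phiPlus_right (h : Admissible g p C) (hL : IsPositivityThreshold g p L)
    (hu : ∀ a b, L ≤ b - a → IsPositiveMinimizer g p C a b (u a b) (U a b) (V a b))
    (hab : L < b - a) :
    HasDerivAt (fun y => phiPlus g p a y) (-(1 / 2) * V a b b ^ 2) b := by
  have hL0 := hL.1
  have hC := h.C_nonneg
  set M := 2 * C * (b - a + 1) with hM
  have hM0 : 0 ≤ M := mul_nonneg (by linarith) (by linarith)
  have hD : ContinuousAt (fun y => -(1 / 2) * V a y y ^ 2) b := by
    have h1 : Tendsto (fun y : ℝ => (a, y)) (𝓝 b) (𝓝 (a, b)) :=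
      (Continuous.prodMk continuous_const continuous_id).tendsto b
    exact (((h.tendsto_deriv_right hL hu (x₀ := (a, b)) hab).comp h1).pow 2).const_mul _
  refine hasDerivAt_of_le_add (f := fun y => phiPlus g p a y) (ρ := min 1 (b - a - L))
    (r₀ := min (1 / 2) L) (K := M ^ 2 + 6 * C * M) hD (lt_min one_pos (by linarith))
    (lt_min (by norm_num) hL0) (by positivity) fun y y' hy hy' r hr0 hr hyy => ?_
  rw [lt_min_iff, abs_lt, abs_lt] at hy hy'
  obtain ⟨hr1, hr2⟩ := le_min_iff.1 hr
  have h1 := h.phiPlus_right_le (by linarith) (hu a y (by linarith)) (M := M) (r := r)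
    (e := y' - y) (mul_le_mul_of_nonneg_left (by linarith) (by linarith)) hr0 hr1
    (by nlinarith) hyy (by linarith)
  rw [add_sub_cancel] at h1
  linarith

theorem hasDerivAt_phiPlus_left (h : Admissible g p C) (hL : IsPositivityThreshold g p L)
    (hu : ∀ a b, L ≤ b - a → IsPositiveMinimizer g p C a b (u a b) (U a b) (V a b))
    (hab : L < b - a) :
    HasDerivAt (fun x => phiPlus g p x b) (1 / 2 * V a b a ^ 2) a := by
  have hL0 := hL.1
  have hC := h.C_nonneg
  set M := 2 * C * (b - a + 1) with hM
  have hM0 : 0 ≤ M := mul_nonneg (by linarith) (by linarith)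
  have hD : ContinuousAt (fun y => 1 / 2 * V y b y ^ 2) a := by
    have h1 : Tendsto (fun y : ℝ => (y, b)) (𝓝 a) (𝓝 (a, b)) :=
      (Continuous.prodMk continuous_id continuous_const).tendsto a
    exact (((h.tendsto_deriv_left hL hu (x₀ := (a, b)) hab).comp h1).pow 2).const_mul _
  refine hasDerivAt_of_le_add (f := fun x => phiPlus g p x b) (ρ := min 1 (b - a - L))
    (r₀ := min (1 / 2) L) (K := M ^ 2 + 6 * C * M) hD (lt_min one_pos (by linarith))
    (lt_min (by norm_num) hL0) (by positivity) fun y y' hy hy' r hr0 hr hyy => ?_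
  rw [lt_min_iff, abs_lt, abs_lt] at hy hy'
  obtain ⟨hr1, hr2⟩ := le_min_iff.1 hr
  have h1 := h.phiPlus_left_le (by linarith) (hu y b (by linarith)) (M := M) (r := r)
    (e := y' - y) (mul_le_mul_of_nonneg_left (by linarith) (by linarith)) hr0 hr1
    (by nlinarith) hyy (by linarith)
  rw [add_sub_cancel] at h1
  linarith

/-- Both partial derivatives exist near each point and are jointly continuous there, which gives
strict differentiability with a continuous derivative. -/
theorem contDiffOn_phiPlus (h : Admissible g p C) (hL : IsPositivityThreshold g p L)
    (hu : ∀ a b, L ≤ b - a → IsPositiveMinimizer g p C a b (u a b) (U a b) (V a b)) :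
    ContDiffOn ℝ 1 (fun x : ℝ × ℝ => phiPlus g p x.1 x.2) {x : ℝ × ℝ | L < x.2 - x.1} := by
  have hopen : IsOpen {x : ℝ × ℝ | L < x.2 - x.1} :=
    isOpen_lt continuous_const (by fun_prop)
  set f₁ : ℝ → ℝ → ℝ →L[ℝ] ℝ := fun a b =>
    ContinuousLinearMap.toSpanSingleton ℝ (1 / 2 * V a b a ^ 2) with hf₁
  set f₂ : ℝ → ℝ → ℝ →L[ℝ] ℝ := fun a b =>
    ContinuousLinearMap.toSpanSingleton ℝ (-(1 / 2) * V a b b ^ 2) with hf₂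
  have hts : Continuous fun c : ℝ => ContinuousLinearMap.toSpanSingleton ℝ c :=
    (ContinuousLinearMap.toSpanSingletonCLE (𝕜 := ℝ) (E := ℝ)).continuous
  have hc₁ : ∀ x : ℝ × ℝ, L < x.2 - x.1 → ContinuousAt (fun x : ℝ × ℝ => f₁ x.1 x.2) x :=
    fun x hx => (hts.tendsto _).comp
      (((h.tendsto_deriv_left hL hu (x₀ := x) hx).pow 2).const_mul (1 / 2))
  have hc₂ : ∀ x : ℝ × ℝ, L < x.2 - x.1 → ContinuousAt (fun x : ℝ × ℝ => f₂ x.1 x.2) x :=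
    fun x hx => (hts.tendsto _).comp
      (((h.tendsto_deriv_right hL hu (x₀ := x) hx).pow 2).const_mul (-(1 / 2)))
  have hF : ∀ x : ℝ × ℝ, L < x.2 - x.1 → HasFDerivAt (fun x : ℝ × ℝ => phiPlus g p x.1 x.2)
      ((f₁ x.1 x.2).coprod (f₂ x.1 x.2)) x := by
    intro x hx
    have hev : ∀ᶠ y : ℝ × ℝ in 𝓝 x, L < y.2 - y.1 := hopen.mem_nhds hx
    refine (hasStrictFDerivAt_uncurry_coprod (f := phiPlus g p) (f₁ := f₁) (f₂ := f₂)
      (hev.mono fun y hy => ?_) (hev.mono fun y hy => ?_) (hc₁ x hx) (hc₂ x hx)).hasFDerivAt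
    · exact (h.hasDerivAt_phiPlus_left hL hu hy).hasFDerivAt
    · exact (h.hasDerivAt_phiPlus_right hL hu hy).hasFDerivAt
  rw [show (1 : WithTop ℕ∞) = 0 + 1 from rfl, contDiffOn_succ_iff_fderiv_of_isOpen hopen]
  refine ⟨fun x hx => (hF x hx).differentiableAt.differentiableWithinAt, by simp, ?_⟩
  rw [contDiffOn_zero]
  refine ContinuousOn.congr (f := fun x : ℝ × ℝ => (f₁ x.1 x.2).coprod (f₂ x.1 x.2))
    (fun x hx => ContinuousAt.continuousWithinAt ?_) fun x hx => (hF x hx).fderiv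
  have e : (fun x : ℝ × ℝ => (f₁ x.1 x.2).coprod (f₂ x.1 x.2)) = fun x : ℝ × ℝ =>
      (f₁ x.1 x.2).comp (ContinuousLinearMap.fst ℝ ℝ ℝ) +
        (f₂ x.1 x.2).comp (ContinuousLinearMap.snd ℝ ℝ ℝ) := by
    ext x <;> simp
  rw [e]
  exact ((hc₁ x hx).clm_comp continuousAt_const).add ((hc₂ x hx).clm_comp continuousAt_const)

end Admissible

/-! ### The boundary value problem and the main theorem -/

theorem IsPositiveMinimizer.solvesPositiveBVP {g p : ℝ → ℝ} {C a b : ℝ} {u U V : ℝ → ℝ}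
    (hab : a < b) (h : IsPositiveMinimizer g p C a b u U V) : SolvesPositiveBVP g p a b u := by
  have hu := (mem_H01Plus_iff hab.le).1 h.isMinimizer.1
  refine ⟨fun t ht => ?_, hu.1.continuousOn hab.le, hu.2.1, hu.2.2.1, h.pos⟩
  have hev : u =ᶠ[𝓝 t] U := eventuallyEq_of_mem (Icc_mem_nhds ht.1 ht.2) h.ext.eqOn
  have hev' : deriv u =ᶠ[𝓝 t] V := eventuallyEq_of_mem (Ioo_mem_nhds ht.1 ht.2)
    fun s hs => h.ext.deriv_eq hs
  refine ⟨((h.ext.hasDerivAt t).congr_of_eventuallyEq hev).differentiableAt, ?_⟩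
  rw [h.ext.eqOn (Ioo_subset_Icc_self ht)]
  exact (h.ext.hasDerivAt_deriv t (Ioo_subset_Icc_self ht)).congr_of_eventuallyEq hev'

end BoundedReaction

end

theorem proposition6 (g : ℝ → ℝ) (hg : BoundedReaction.Reaction g) (gm gp : ℝ)
    (hgm : Tendsto g atBot (𝓝 gm)) (hgp : Tendsto g atTop (𝓝 gp))
    (p : ℝ → ℝ) (hp : BoundedReaction.Forcing gm gp p) :
    (∃ L : ℝ, BoundedReaction.IsPositivityThreshold g p L) ∧
    ∀ L : ℝ, BoundedReaction.IsPositivityThreshold g p L →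
      ContDiffOn ℝ 1 (fun x : ℝ × ℝ => BoundedReaction.phiPlus g p x.1 x.2)
        {x : ℝ × ℝ | L < x.2 - x.1} ∧
      ∀ a b : ℝ, L < b - a →
        ∃ u : ℝ → ℝ, BoundedReaction.IsMinimizer g p a b u ∧
          (∀ v : ℝ → ℝ, BoundedReaction.IsMinimizer g p a b v → EqOn v u (Icc a b)) ∧
          BoundedReaction.SolvesPositiveBVP g p a b u ∧
          ∃ ua ub : ℝ,
            Tendsto (deriv u) (𝓝[>] a) (𝓝 ua) ∧ Tendsto (deriv u) (𝓝[<] b) (𝓝 ub) ∧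
            HasDerivAt (fun x => BoundedReaction.phiPlus g p x b) (1 / 2 * ua ^ 2) a ∧
            HasDerivAt (fun y => BoundedReaction.phiPlus g p a y) (-(1 / 2) * ub ^ 2) b := by
  obtain ⟨Cg, hCg⟩ := hg.bounded
  obtain ⟨Cp, hCp⟩ := hp.bounded
  have h : BoundedReaction.Admissible g p (max Cg Cp) :=
    { g_cont := hg.contDiff.continuous
      g_mono := hg.strictMono.monotone
      concave := hg.strictConcave
      g_bdd := fun s => (hCg s).trans (le_max_left _ _)
      p_cont := hp.continuous
      p_bdd := fun t => (hCp t).trans (le_max_right _ _) }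
  refine ⟨?_, fun L hL => ?_⟩
  · obtain ⟨A, hA, -, hAgp⟩ := hp.average
    -- Since A lies below the limit of `g` at +∞, some positive level K has g(K) > A.
    obtain ⟨K, hAK, hK⟩ := ((hgp.eventually (lt_mem_nhds hAgp)).and (eventually_gt_atTop 0)).exists
    exact h.exists_isPositivityThreshold hA hK hAK
  · have hex : ∀ a b, ∃ u U V : ℝ → ℝ, L ≤ b - a →
        BoundedReaction.IsPositiveMinimizer g p (max Cg Cp) a b u U V := fun a b => by
      by_cases hab : L ≤ b - a
      · obtain ⟨u, U, V, hu⟩ := h.exists_isPositiveMinimizer hL hab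
        exact ⟨u, U, V, fun _ => hu⟩
      · exact ⟨0, 0, 0, fun hc => absurd hc hab⟩
    choose u U V hu using hex
    refine ⟨h.contDiffOn_phiPlus hL hu, fun a b hLab => ?_⟩
    have hab : a < b := by linarith [hL.1]
    have huab := hu a b hLab.le
    refine ⟨u a b, huab.isMinimizer, fun v hv => h.eqOn_of_isMinimizer hab huab.isMinimizer hv
      huab.pos (hL.2 a b hLab.le v hv), huab.solvesPositiveBVP hab, V a b a, V a b b, ?_, ?_,
      h.hasDerivAt_phiPlus_left hL hu hLab, h.hasDerivAt_phiPlus_right hL hu hLab⟩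
    -- Inside (a,b) the derivative of `u` is the continuous function `V`, so its one-sided endpoint
    -- limits are the values of `V`.
    · refine ((huab.ext.continuous_deriv.tendsto a).mono_left nhdsWithin_le_nhds).congr' ?_
      filter_upwards [Ioo_mem_nhdsGT hab] with t ht using (huab.ext.deriv_eq ht).symm
    · refine ((huab.ext.continuous_deriv.tendsto b).mono_left nhdsWithin_le_nhds).congr' ?_
      filter_upwards [Ioo_mem_nhdsLT hab] with t ht using (huab.ext.deriv_eq ht).symm
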